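/- Let $k\ge 1$ and $d\ge 1$ be integers, and let $H$ be the random operator on $\ell^2(\mathbb Z^d)\otimes\mathbb C^k$ $$(H\psi)(x)=(v(x)A+B)\psi(x)+g^{-1}\sum_{y:\ \|y-x\|_1=1}K(x-y)\psi(y),\qquad g>0,$$ where $A,B$ are Hermitian $k\times k$ matrices, $A$ is invertible, $\|A\|,\|A^{-1}\|\le C_{B1}$, $\|B\|\le C_{B2}$; $K(-e)=K(e)^*$ and $\|K(e)\|\le C_{B3}$ for every $e \in \mathbb Z^d$ with $\|e\|_1=1$; and $(v(x))_{x\in\mathbb Z^d}$ are independent real random variables on a probability space, with a common distribution $\mu$ such that, for some $\alpha,q>0$, $\mu[t-\epsilon,t+\epsilon]\le C_{A1}\epsilon^\alpha$ for all $\epsilon>0$, $t\in\mathbb R$, and $\int|x|^q\,d\mu(x)\le C_{A2}$. The density of states is the (unique) finite measure $\rho$ on $\mathbb R$ with $\int f\,d\rho=\frac1k\,\mathrm{tr}\,\langle f(H)(n,n)\rangle$ for all $f\in C_0(\mathbb R)$ and all $n\in\mathbb Z^d$, where $f(H)(n,n)$ is the diagonal $k\times k$ block of $f(H)$ at $n$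 and $\langle\cdot\rangle$ is the expectation; the integrated density of states is $N(\lambda)=\rho(-\infty,\lambda]$. (1) Put $s=\frac{\alpha q}{2k\alpha+kq}$. There is $C>0$, depending only on $k,\alpha,q,C_{A1},C_{A2},C_{B1},C_{B2},C_{B3}$ (in particular not on $d$, $g$, $\lambda$), such that whenever $\lambda\in\mathbb R$ and $g\ge C d^{1/s}/(1+|\lambda|)$, $$\rho[\lambda-\epsilon,\lambda+\epsilon]\le C(1+|\lambda|)^{-s}\epsilon^s\quad\text{for all }\epsilon>0,$$ and $N$ is $s$-Hölder at $\lambda$, uniformly in $g$: $|N(\lambda')-N(\lambda)|\le C(1+|\lambda|)^{-s}|\lambda'-\lambda|^s$ for all $\lambda'\in\mathbb R$. (2) In particular, let $\mu$ have a bounded density and finite moments of all orders, and let $\delta>0$. Then there is $C>0$, depending only on $k,\delta,\mu,C_{B1},C_{B2},C_{B3}$, such that whenever $g\ge Cd^{k+\delta}/(1+|\lambda|)$ one has $|N(\lambda')-N(\lambda)|\le C(1+|\lambda|)^{-1/(k+\delta)}|\lambda'-\lambda|^{1/(k+\delta)}$ for all $\lambda'\in\mathbb R$; and if $g\ge Cd^{k+\delta}$,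 then $N$ is $1/(k+\delta)$-Hölder on $\mathbb R$: $|N(\lambda')-N(\lambda)|\le C|\lambda'-\lambda|^{1/(k+\delta)}$ for all $\lambda,\lambda'\in\mathbb R$. -/

import Mathlib

open MeasureTheory ProbabilityTheory
open scoped ENNReal NNReal ZeroAtInfty Matrix.Norms.L2Operator

noncomputable section

/-! ### Functional calculus of an unbounded self-adjoint operator -/

/-- `R` is the bounded two-sided inverse of `T - z : dom T → E`, that is `R = (T - z)⁻¹`. -/
def IsResolventAt {E : Type*} [NormedAddCommGroup E] [NormedSpace ℂ E]
    (T : E →ₗ.[ℂ] E) (z : ℂ) (R : E →L[ℂ] E) : Prop :=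
  (∀ ψ : E, ∃ h : R ψ ∈ T.domain, T ⟨R ψ, h⟩ - z • R ψ = ψ) ∧
    ∀ φ : T.domain, R (T φ - z • (φ : E)) = φ

/-- There is at most one resolvent at `z`. -/
theorem IsResolventAt.unique {E : Type*} [NormedAddCommGroup E] [NormedSpace ℂ E]
    {T : E →ₗ.[ℂ] E} {z : ℂ} {R R' : E →L[ℂ] E}
    (h : IsResolventAt T z R) (h' : IsResolventAt T z R') : R = R' := by
  ext ψ
  obtain ⟨hm, he⟩ := h'.1 ψ
  have := h.2 ⟨R' ψ, hm⟩
  simp only [he] at this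
  exact this

open Classical in
/-- The resolvent `(T - z)⁻¹`; it exists for every self-adjoint `T` and every nonreal `z`
(and is set to `0` where it does not exist). -/
def resolventAt {E : Type*} [NormedAddCommGroup E] [NormedSpace ℂ E]
    (T : E →ₗ.[ℂ] E) (z : ℂ) : E →L[ℂ] E :=
  if h : ∃ R, IsResolventAt T z R then h.choose else 0

open Classical in
/-- `f(T)` for a self-adjoint operator `T` and `f ∈ C₀(ℝ)`. With `w(t) = (t + i)⁻¹`, a bijection
of `ℝ` onto a circle without the point `0`, one has `f(T) = F((T + i)⁻¹)`, where `F(w(t)) = f(t)`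
and `F(0) = 0`, and `F` is applied to the bounded normal operator `(T + i)⁻¹` through the
continuous functional calculus. Note that `t = Re (w(t)⁻¹)`. -/
def funCalc {E : Type*} [NormedAddCommGroup E] [InnerProductSpace ℂ E] [CompleteSpace E]
    (T : E →ₗ.[ℂ] E) (f : C₀(ℝ, ℝ)) : E →L[ℂ] E :=
  cfc (fun w : ℂ => if w = 0 then (0 : ℂ) else ((f (w⁻¹).re : ℝ) : ℂ))
    (resolventAt T (-Complex.I))

/-! ### The Hamiltonian on `ℓ²(ℤ^d) ⊗ ℂ^k` -/

/-- The vertices of the lattice `ℤ^d`. -/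
abbrev Site (d : ℕ) : Type := Fin d → ℤ

/-- The `i`-th unit vector of `ℤ^d`; the neighbours of `x` are the `2d` points `x ± e_i`. -/
abbrev unitVec {d : ℕ} (i : Fin d) : Site d := Pi.single i 1

/-- The space of internal degrees of freedom of a single site. -/
abbrev Spin (k : ℕ) : Type := EuclideanSpace ℂ (Fin k)

/-- The Hilbert space `ℓ²(ℤ^d) ⊗ ℂ^k` of square-summable functions `ℤ^d → ℂ^k`. -/
abbrev Wave (d k : ℕ) : Type := lp (fun _ : Site d => Spin k) 2

/-- The non-random data of the translation-invariant model: `V(x) = v(x) A + B`, and the hopping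
kernel `K(x, y) = K(x - y)` for adjacent `x`, `y` (the other values of `K` are never used). -/
structure ModelData (d k : ℕ) where
  A : Matrix (Fin k) (Fin k) ℂ
  B : Matrix (Fin k) (Fin k) ℂ
  K : Site d → Matrix (Fin k) (Fin k) ℂ

/-- The standing assumptions on the non-random data, with operator norms of matrices. -/
structure ModelData.Admissible {d k : ℕ} (M : ModelData d k) (CB1 CB2 CB3 : ℝ) : Prop where
  hermitian_A : M.A.IsHermitian
  hermitian_B : M.B.IsHermitian
  isUnit_A : IsUnit M.A
  norm_A : ‖M.A‖ ≤ CB1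
  norm_inv_A : ‖M.A⁻¹‖ ≤ CB1
  norm_B : ‖M.B‖ ≤ CB2
  hermitian_K : ∀ i : Fin d, M.K (-unitVec i) = (M.K (unitVec i)).conjTranspose
  norm_K : ∀ i : Fin d, ‖M.K (unitVec i)‖ ≤ CB3 ∧ ‖M.K (-unitVec i)‖ ≤ CB3

/-- The formal action
`(Hψ)(x) = (v(x) A + B) ψ(x) + g⁻¹ ∑_{y ∼ x} K(x - y) ψ(y)`
on all functions `ψ : ℤ^d → ℂ^k`, for a given configuration `v : ℤ^d → ℝ`. -/
def ModelData.formal {d k : ℕ} (M : ModelData d k) (g : ℝ) (v : Site d → ℝ) :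
    (Site d → Spin k) →ₗ[ℂ] (Site d → Spin k) where
  toFun ψ x :=
    Matrix.toEuclideanLin ((v x : ℂ) • M.A + M.B) (ψ x) +
      ((g⁻¹ : ℝ) : ℂ) • ∑ i : Fin d,
        (Matrix.toEuclideanLin (M.K (unitVec i)) (ψ (x - unitVec i)) +
          Matrix.toEuclideanLin (M.K (-unitVec i)) (ψ (x + unitVec i)))
  map_add' ψ φ := by
    funext x
    simp only [Pi.add_apply, map_add, Finset.sum_add_distrib, smul_add]
    abel
  map_smul' c ψ := by
    funext x
    simp only [Pi.smul_apply, map_smul, RingHom.id_apply, smul_add, ← Finset.smul_sum,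
      Finset.sum_add_distrib]
    simp only [smul_comm c]

/-- The Hamiltonian `H` as an unbounded operator on `ℓ²(ℤ^d) ⊗ ℂ^k`, with its natural (maximal)
domain `{ψ : Hψ ∈ ℓ²}`, on which it is self-adjoint. -/
def ModelData.hamiltonian {d k : ℕ} (M : ModelData d k) (g : ℝ) (v : Site d → ℝ) :
    Wave d k →ₗ.[ℂ] Wave d k where
  domain :=
    { carrier := {ψ | Memℓp (M.formal g v (fun x => ψ x)) 2}
      zero_mem' := by
        change Memℓp (M.formal g v 0) 2
        rw [map_zero]
        exact zero_memℓp
      add_mem' := by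
        intro ψ φ hψ hφ
        change Memℓp (M.formal g v ((fun x => ψ x) + fun x => φ x)) 2
        rw [map_add]
        exact Memℓp.add hψ hφ
      smul_mem' := by
        intro c ψ hψ
        change Memℓp (M.formal g v (c • fun x => ψ x)) 2
        rw [map_smul]
        exact Memℓp.const_smul hψ c }
  toFun :=
    { toFun := fun ψ => ⟨M.formal g v (fun x => ψ.1 x), ψ.2⟩
      map_add' := by
        intro ψ φ
        apply Subtype.ext
        change M.formal g v ((fun x => ψ.1 x) + fun x => φ.1 x) = _
        rw [map_add]
        rfl
      map_smul' := by
        intro c ψ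
        apply Subtype.ext
        change M.formal g v (c • fun x => ψ.1 x) = _
        rw [map_smul]
        rfl }

/-- The matrix kernel `T(m, n)` of a bounded operator `T` on `ℓ²(ℤ^d) ⊗ ℂ^k`. -/
def kernel {d k : ℕ} (T : Wave d k →L[ℂ] Wave d k) (m n : Site d) :
    Matrix (Fin k) (Fin k) ℂ :=
  Matrix.of fun i j => T (lp.single 2 n (EuclideanSpace.single j (1 : ℂ))) m i

/-! ### Random potential and density of states -/

/-- `μ` is `α`-regular with constant `C`. -/
def IsRegularWith (α C : ℝ) (μ : Measure ℝ) : Prop :=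
  ∀ ε : ℝ, 0 < ε → ∀ t : ℝ, μ.real (Set.Icc (t - ε) (t + ε)) ≤ C * ε ^ α

/-- `μ` has a finite `q`-moment, bounded by `C`. -/
def HasMomentBound (q C : ℝ) (μ : Measure ℝ) : Prop :=
  Integrable (fun x : ℝ => |x| ^ q) μ ∧ ∫ x, |x| ^ q ∂μ ≤ C

/-- `(v x)_{x ∈ ℤ^d}` are independent random variables, all with the distribution `μ`. -/
structure IsIID {Ω : Type*} [MeasurableSpace Ω] {d : ℕ} (v : Site d → Ω → ℝ) (P : Measure Ω)
    (μ : Measure ℝ) : Prop where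
  measurable : ∀ x, Measurable (v x)
  indep : iIndepFun v P
  law : ∀ x, P.map (v x) = μ

/-- `ρ` is the density of states of the random operator `H`: the finite measure with
`∫ f dρ = k⁻¹ tr ⟨f(H)(n, n)⟩` for all `f ∈ C₀(ℝ)` and at every vertex `n`. -/
structure IsDensityOfStates {Ω : Type*} [MeasurableSpace Ω] {d k : ℕ}
    (H : Ω → Wave d k →ₗ.[ℂ] Wave d k) (P : Measure Ω) (ρ : Measure ℝ) : Prop where
  finite : IsFiniteMeasure ρ
  integrable : ∀ (f : C₀(ℝ, ℝ)) (n : Site d) (i j : Fin k),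
    Integrable (fun ω => kernel (funCalc (H ω) f) n n i j) P
  integral_eq : ∀ (f : C₀(ℝ, ℝ)) (n : Site d),
    ((∫ t, f t ∂ρ : ℝ) : ℂ) =
      (k : ℂ)⁻¹ * Matrix.trace (Matrix.of fun i j => ∫ ω, kernel (funCalc (H ω) f) n n i j ∂P)

/-- The integrated density of states `λ ↦ ρ(-∞, λ]`. -/
def ids (ρ : Measure ℝ) (lam : ℝ) : ℝ := ρ.real (Set.Iic lam)

/-- The exponent `s = αq / (2kα + kq)`. -/
def wegnerExponent (α q : ℝ) (k : ℕ) : ℝ := α * q / (2 * k * α + k * q)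

end

/-!
The argument is the fractional moment method. By Cramer's rule for a perturbation at one site, the
components of `φ = ((H - z)⁻¹ ψ)(x)` are, as functions of `v(x)`, quotients of polynomials of degree
at most `k`. The `s`-th moment of such a quotient over the whole line is comparable to its `s`-th
moment over the set of bounded values of `v(x)` that stay away from the roots and from the
eigenvalues of `A⁻¹(z - B)`; there `‖(v(x) A + B - z) φ‖ ≥ c (1 + |z|) ‖φ‖`. Hence
`⟨‖φ‖ ^ s⟩ ≤ K (1 + |z|) ^ (-s) ⟨‖(v(x) A + B - z) φ‖ ^ s⟩`. The equation `(H - z)(H - z)⁻¹ ψ = ψ`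
expresses `(v(x) A + B - z) φ` by `ψ(x)` and `g⁻¹` times the values at the `2d` neighbours, so for
large `g` the supremum over `x` of the left-hand moments is at most `2K (1 + |z|) ^ (-s)`.

With `z = λ + iε`, the Poisson integral `ε / ((H - λ)² + ε²)` is `ε (H - z)⁻¹ (H - conj z)⁻¹`, a
difference of two resolvents by the resolvent identity. Its kernel is at most `ε⁻¹`, which turns
the fractional moments into a bound `ε ^ (s - 1)` on its expectation, and `ρ[λ - ε, λ + ε]` is at
most `2ε` times the Poisson integral of `ρ`. This uses `s ≤ 1`, which holds because a probability
measure cannot be `α`-regular with `α > 1`. The measure `ρ` itself comes from the Riesz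
representation theorem, and does not depend on the site because the potential is shift invariant.
-/

noncomputable section

open scoped InnerProductSpace ComplexConjugate
open Filter Topology

/-! ### Resolvents of self-adjoint operators -/

section Resolvent

variable {E : Type*} [NormedAddCommGroup E]

namespace IsResolventAt

variable [NormedSpace ℂ E] {T : E →ₗ.[ℂ] E} {z w : ℂ} {R S : E →L[ℂ] E}

theorem resolventAt_eq (h : IsResolventAt T z R) : resolventAt T z = R := by
  have hex : ∃ R, IsResolventAt T z R := ⟨R, h⟩
  rw [resolventAt, dif_pos hex]
  exact hex.choose_spec.unique h

theorem sub_eq_smul_mul (hR : IsResolventAt T z R) (hS : IsResolventAt T w S) :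
    R - S = (z - w) • (R * S) := by
  ext ψ
  obtain ⟨hm, he⟩ := hS.1 ψ
  have h := hR.2 ⟨S ψ, hm⟩
  rw [eq_add_of_sub_eq he] at h
  simp only [map_add, map_sub, map_smul] at h
  simp only [sub_apply, smul_apply, mul_apply_eq_comp]
  linear_combination (norm := module) h

protected theorem commute (hR : IsResolventAt T z R) (hS : IsResolventAt T w S) :
    Commute R S := by
  by_cases hzw : z = w
  · subst hzw
    rw [hR.unique hS]
  · have h : (z - w) • (R * S - S * R) = 0 := by
      linear_combination (norm := module) -(hR.sub_eq_smul_mul hS) - hS.sub_eq_smul_mul hR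
    exact sub_eq_zero.1 ((smul_eq_zero.1 h).resolve_left (sub_ne_zero.2 hzw))

end IsResolventAt

variable [InnerProductSpace ℂ E] {T : E →ₗ.[ℂ] E} {z : ℂ}

theorem abs_im_mul_norm_le_norm_apply_sub_smul (hT : T.IsFormalAdjoint T) (z : ℂ)
    (φ : T.domain) : |z.im| * ‖(φ : E)‖ ≤ ‖T φ - z • (φ : E)‖ := by
  have hreal : (⟪(φ : E), T φ⟫_ℂ).im = 0 := by
    rw [← Complex.conj_eq_iff_im, inner_conj_symm, hT φ φ]
  have him : (⟪(φ : E), T φ - z • (φ : E)⟫_ℂ).im = -(z.im * ‖(φ : E)‖ ^ 2) := by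
    rw [inner_sub_right, inner_smul_right, inner_self_eq_norm_sq_to_K, Complex.sub_im, hreal]
    simp [← Complex.ofReal_pow]
  have hmul : ‖(φ : E)‖ * (|z.im| * ‖(φ : E)‖) ≤ ‖(φ : E)‖ * ‖T φ - z • (φ : E)‖ :=
    calc ‖(φ : E)‖ * (|z.im| * ‖(φ : E)‖) = |(⟪(φ : E), T φ - z • (φ : E)⟫_ℂ).im| := by
          rw [him, abs_neg, abs_mul, abs_of_nonneg (sq_nonneg ‖(φ : E)‖)]
          ring
      _ ≤ ‖⟪(φ : E), T φ - z • (φ : E)⟫_ℂ‖ := Complex.abs_im_le_norm _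
      _ ≤ ‖(φ : E)‖ * ‖T φ - z • (φ : E)‖ := norm_inner_le_norm _ _
  rcases (norm_nonneg (φ : E)).eq_or_lt with h0 | h0
  · simp [← h0]
  · exact le_of_mul_le_mul_left hmul h0

theorem eq_zero_of_apply_eq_smul (hT : T.IsFormalAdjoint T) (hz : z.im ≠ 0) {φ : T.domain}
    (hφ : T φ = z • (φ : E)) : (φ : E) = 0 := by
  have h := abs_im_mul_norm_le_norm_apply_sub_smul hT z φ
  rw [hφ, sub_self, norm_zero] at h
  exact norm_le_zero_iff.1 (nonpos_of_mul_nonpos_right h (abs_pos.2 hz))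

namespace IsResolventAt

variable {R S : E →L[ℂ] E}

theorem norm_le (hT : T.IsFormalAdjoint T) (hz : z.im ≠ 0) (hR : IsResolventAt T z R) :
    ‖R‖ ≤ |z.im|⁻¹ := by
  refine R.opNorm_le_bound (by positivity) fun ψ => ?_
  obtain ⟨hm, he⟩ := hR.1 ψ
  have h := abs_im_mul_norm_le_norm_apply_sub_smul hT z ⟨R ψ, hm⟩
  rw [he] at h
  rwa [inv_mul_eq_div, le_div_iff₀' (abs_pos.2 hz)]

theorem adjoint_eq [CompleteSpace E] (hT : T.IsFormalAdjoint T) (hR : IsResolventAt T z R)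
    (hS : IsResolventAt T (conj z) S) : ContinuousLinearMap.adjoint R = S := by
  symm
  rw [ContinuousLinearMap.eq_adjoint_iff]
  intro φ ψ
  obtain ⟨hRm, hRe⟩ := hR.1 ψ
  obtain ⟨hSm, hSe⟩ := hS.1 φ
  nth_rewrite 1 [← hRe]
  nth_rewrite 2 [← hSe]
  rw [inner_sub_left, inner_sub_right, inner_smul_left, inner_smul_right,
    hT ⟨S φ, hSm⟩ ⟨R ψ, hRm⟩, Complex.conj_conj]

end IsResolventAt

/-- The operator `(φ, Tφ) ↦ Tφ - zφ` on the graph of `T`. Unlike `T - z` itself it is bounded, and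
its domain is complete as soon as `T` is closed; so Banach space theory provides its inverse. -/
def graphSubSMul (T : E →ₗ.[ℂ] E) (z : ℂ) : T.graph →L[ℂ] E :=
  (ContinuousLinearMap.snd ℂ E E - z • ContinuousLinearMap.fst ℂ E E) ∘L T.graph.subtypeL

theorem antilipschitzWith_graphSubSMul (hT : T.IsFormalAdjoint T) (hz : z.im ≠ 0) :
    AntilipschitzWith (1 + (1 + ‖z‖₊) * ‖z.im‖₊⁻¹) (graphSubSMul T z) := by
  refine AddMonoidHomClass.antilipschitz_of_bound _ ?_
  rintro ⟨p, hp⟩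
  obtain ⟨φ, rfl⟩ := T.mem_graph_iff'.1 hp
  set r := ‖T φ - z • (φ : E)‖
  have hr : 0 ≤ r := norm_nonneg _
  have hφ : ‖(φ : E)‖ ≤ |z.im|⁻¹ * r := by
    rw [inv_mul_eq_div, le_div_iff₀' (abs_pos.2 hz)]
    exact abs_im_mul_norm_le_norm_apply_sub_smul hT z φ
  have hTφ : ‖T φ‖ ≤ r + ‖z‖ * ‖(φ : E)‖ := by
    rw [← norm_smul]
    exact norm_le_norm_sub_add _ _
  have hmax : ‖(φ : E)‖ ⊔ ‖T φ‖ ≤ r + (1 + ‖z‖) * ‖(φ : E)‖ :=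
    max_le (by nlinarith [mul_nonneg (norm_nonneg z) (norm_nonneg (φ : E))])
      (by linarith [norm_nonneg (φ : E)])
  calc ‖(φ : E)‖ ⊔ ‖T φ‖ ≤ r + (1 + ‖z‖) * (|z.im|⁻¹ * r) := by
        refine hmax.trans ?_
        gcongr
    _ = (1 + (1 + ‖z‖) * |z.im|⁻¹) * r := by ring

variable [CompleteSpace E]

theorem isSelfAdjoint_of_isFormalAdjoint (hdense : Dense (T.domain : Set E))
    (hT : T.IsFormalAdjoint T)
    (hmax : ∀ χ η : E, (∀ φ : T.domain, ⟪η, (φ : E)⟫_ℂ = ⟪χ, T φ⟫_ℂ) →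
      ∃ h : χ ∈ T.domain, T ⟨χ, h⟩ = η) : IsSelfAdjoint T := by
  have hadj : ∀ χ : T.adjoint.domain, ∃ h : (χ : E) ∈ T.domain, T ⟨χ, h⟩ = T.adjoint χ := fun χ =>
    hmax χ (T.adjoint χ) fun φ => LinearPMap.adjoint_isFormalAdjoint hdense χ φ
  rw [LinearPMap.isSelfAdjoint_def]
  refine le_antisymm (LinearPMap.le_of_le_graph fun p hp => ?_) (hT.le_adjoint hdense)
  obtain ⟨χ, rfl⟩ := T.adjoint.mem_graph_iff'.1 hp
  obtain ⟨hχ, he⟩ := hadj χ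
  exact T.mem_graph_iff.2 ⟨⟨χ, hχ⟩, rfl, he⟩

theorem isFormalAdjoint_self (hT : IsSelfAdjoint T) : T.IsFormalAdjoint T := by
  have h := LinearPMap.adjoint_isFormalAdjoint hT.dense_domain
  rwa [LinearPMap.isSelfAdjoint_def.1 hT] at h

theorem exists_apply_eq_of_forall_inner_eq (hT : IsSelfAdjoint T) {χ η : E}
    (h : ∀ φ : T.domain, ⟪η, (φ : E)⟫_ℂ = ⟪χ, T φ⟫_ℂ) :
    ∃ hχ : χ ∈ T.domain, T ⟨χ, hχ⟩ = η := by
  have hadj : ∃ hχ : χ ∈ T.adjoint.domain, T.adjoint ⟨χ, hχ⟩ = η :=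
    ⟨LinearPMap.mem_adjoint_domain_of_exists χ ⟨η, h⟩,
      LinearPMap.adjoint_apply_eq hT.dense_domain _ h⟩
  rwa [LinearPMap.isSelfAdjoint_def.1 hT] at hadj

theorem range_graphSubSMul (hT : IsSelfAdjoint T) (hz : z.im ≠ 0) :
    (graphSubSMul T z).range = ⊤ := by
  have : CompleteSpace T.graph := hT.isClosed.completeSpace_coe
  have hclosed : IsClosed (graphSubSMul T z).range.carrier :=
    (antilipschitzWith_graphSubSMul (isFormalAdjoint_self hT) hz).isClosed_range
      (graphSubSMul T z).uniformContinuous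
  have : CompleteSpace (graphSubSMul T z).range := hclosed.completeSpace_coe
  rw [← Submodule.orthogonal_eq_bot_iff, Submodule.eq_bot_iff]
  intro χ hχ
  have hinner (φ : T.domain) : ⟪conj z • χ, (φ : E)⟫_ℂ = ⟪χ, T φ⟫_ℂ := by
    have h : ⟪χ, T φ - z • (φ : E)⟫_ℂ = 0 :=
      (Submodule.mem_orthogonal' _ _).1 hχ _ ⟨⟨_, T.mem_graph φ⟩, rfl⟩
    rw [inner_sub_right, sub_eq_zero, inner_smul_right] at h
    rw [h, inner_smul_left, Complex.conj_conj]
  obtain ⟨hm, he⟩ := exists_apply_eq_of_forall_inner_eq hT hinner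
  exact eq_zero_of_apply_eq_smul (isFormalAdjoint_self hT) (by simpa using hz) he

theorem exists_isResolventAt (hT : IsSelfAdjoint T) (hz : z.im ≠ 0) :
    ∃ R, IsResolventAt T z R := by
  have : CompleteSpace T.graph := hT.isClosed.completeSpace_coe
  let e : T.graph ≃L[ℂ] E := ContinuousLinearEquiv.ofBijective (graphSubSMul T z)
    (LinearMap.ker_eq_bot.2
      (antilipschitzWith_graphSubSMul (isFormalAdjoint_self hT) hz).injective)
    (range_graphSubSMul hT hz)
  have he (φ : T.domain) : e ⟨_, T.mem_graph φ⟩ = T φ - z • (φ : E) := rfl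
  let R : E →L[ℂ] E :=
    ContinuousLinearMap.fst ℂ E E ∘L T.graph.subtypeL ∘L e.symm.toContinuousLinearMap
  have hR (φ : T.domain) : R (T φ - z • (φ : E)) = φ := by
    change (e.symm (T φ - z • (φ : E))).1.1 = φ
    rw [← he, e.symm_apply_apply]
  refine ⟨R, fun ψ => ?_, hR⟩
  obtain ⟨⟨p, hp⟩, rfl⟩ := e.surjective ψ
  obtain ⟨φ, rfl⟩ := T.mem_graph_iff'.1 hp
  simpa only [he, hR, exists_prop, and_true] using φ.2

theorem isResolventAt_resolventAt (hT : IsSelfAdjoint T) (hz : z.im ≠ 0) :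
    IsResolventAt T z (resolventAt T z) := by
  obtain ⟨R, hR⟩ := exists_isResolventAt hT hz
  rwa [hR.resolventAt_eq]

theorem norm_resolventAt_le (hT : IsSelfAdjoint T) (hz : z.im ≠ 0) :
    ‖resolventAt T z‖ ≤ |z.im|⁻¹ :=
  (isResolventAt_resolventAt hT hz).norm_le (isFormalAdjoint_self hT) hz

theorem star_resolventAt (hT : IsSelfAdjoint T) (hz : z.im ≠ 0) :
    star (resolventAt T z) = resolventAt T (conj z) :=
  (isResolventAt_resolventAt hT hz).adjoint_eq (isFormalAdjoint_self hT)
    (isResolventAt_resolventAt hT (by simpa using hz))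

theorem commute_resolventAt (hT : IsSelfAdjoint T) {z w : ℂ} (hz : z.im ≠ 0) (hw : w.im ≠ 0) :
    Commute (resolventAt T z) (resolventAt T w) :=
  (isResolventAt_resolventAt hT hz).commute (isResolventAt_resolventAt hT hw)

end Resolvent

/-! ### The continuous functional calculus of a self-adjoint operator -/

section Circle

/-- The circle `{(t + i)⁻¹ : t ∈ ℝ} ∪ {0}`, on which the functions of `(T + i)⁻¹` live; the
equation is `w⁻¹ - conj w⁻¹ = 2i` cleared of denominators, so that it includes `w = 0`. -/
def cayleyCircle : Set ℂ := {w | w - conj w = -(2 * Complex.I) * (w * conj w)}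

theorem norm_le_one_of_mem_cayleyCircle {w : ℂ} (hw : w ∈ cayleyCircle) : ‖w‖ ≤ 1 := by
  have h : ‖w - conj w‖ = 2 * (‖w‖ * ‖w‖) := by
    rw [show w - conj w = _ from hw]
    simp
  have h2 : ‖w - conj w‖ ≤ ‖w‖ + ‖w‖ := by
    simpa using norm_sub_le w (conj w)
  nlinarith [norm_nonneg w]

instance : CompactSpace cayleyCircle := by
  refine isCompact_iff_compactSpace.1 (Metric.isCompact_of_isClosed_isBounded ?_ ?_)
  · exact isClosed_eq (by fun_prop) (by fun_prop)
  · refine (Metric.isBounded_closedBall (x := (0 : ℂ)) (r := 1)).subset fun w hw => ?_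
    simpa using norm_le_one_of_mem_cayleyCircle hw

theorem inv_eq_of_mem_cayleyCircle {w : ℂ} (hw : w ∈ cayleyCircle) (h0 : w ≠ 0) :
    w⁻¹ = (((w⁻¹).re : ℝ) : ℂ) + Complex.I := by
  have h0' : conj w ≠ 0 := by simpa using h0
  have hsub : w⁻¹ - conj w⁻¹ = 2 * Complex.I := by
    have h : w - conj w = -(2 * Complex.I) * (w * conj w) := hw
    rw [map_inv₀]
    field_simp
    linear_combination -h
  linear_combination Complex.re_eq_add_conj w⁻¹ * (-1) + hsub / 2

theorem tendsto_inv_re_cayleyCircle :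
    Tendsto (fun w : ℂ => (w⁻¹).re) (𝓝[cayleyCircle \ {0}] 0) (cocompact ℝ) := by
  rw [← Metric.cobounded_eq_cocompact, ← tendsto_norm_atTop_iff_cobounded]
  have hinv : Tendsto (fun w : ℂ => ‖w⁻¹‖ - 1) (𝓝[cayleyCircle \ {0}] 0) atTop := by
    refine tendsto_atTop_add_const_right _ _ ?_
    exact (tendsto_norm_atTop_iff_cobounded.2 (tendsto_inv₀_nhdsNE_zero (α := ℂ))).mono_left
      (nhdsWithin_mono _ fun w hw => hw.2)
  refine tendsto_atTop_mono' _ ?_ hinv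
  filter_upwards [self_mem_nhdsWithin] with w hw
  have hle : ‖w⁻¹‖ ≤ ‖(w⁻¹).re‖ + 1 :=
    calc ‖w⁻¹‖ = ‖(((w⁻¹).re : ℝ) : ℂ) + Complex.I‖ := by
          rw [← inv_eq_of_mem_cayleyCircle hw.1 hw.2]
      _ ≤ _ := by simpa using norm_add_le (((w⁻¹).re : ℝ) : ℂ) Complex.I
  linarith

open Classical in
/-- The function `F` on `ℂ` with `F((t + i)⁻¹) = f(t)` and `F(0) = 0`, which enters `funCalc`. -/
def circlePullback (f : C₀(ℝ, ℝ)) (w : ℂ) : ℂ :=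
  if w = 0 then (0 : ℂ) else ((f (w⁻¹).re : ℝ) : ℂ)

theorem circlePullback_zero (f : C₀(ℝ, ℝ)) : circlePullback f 0 = 0 := if_pos rfl

theorem circlePullback_of_ne_zero (f : C₀(ℝ, ℝ)) {w : ℂ} (hw : w ≠ 0) :
    circlePullback f w = (f (w⁻¹).re : ℝ) := if_neg hw

theorem circlePullback_add (f h : C₀(ℝ, ℝ)) :
    circlePullback (f + h) = circlePullback f + circlePullback h := by
  ext w
  by_cases hw : w = 0 <;> simp [circlePullback, hw]

theorem circlePullback_smul (c : ℝ) (f : C₀(ℝ, ℝ)) :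
    circlePullback (c • f) = (c : ℂ) • circlePullback f := by
  ext w
  by_cases hw : w = 0 <;> simp [circlePullback, hw]

theorem continuousOn_circlePullback (f : C₀(ℝ, ℝ)) :
    ContinuousOn (circlePullback f) cayleyCircle := by
  intro w hw
  by_cases h0 : w = 0
  · subst h0
    rw [← continuousWithinAt_sdiff_self, ContinuousWithinAt, circlePullback_zero]
    have h := (Complex.continuous_ofReal.tendsto 0).comp
      ((zero_at_infty f).comp tendsto_inv_re_cayleyCircle)
    rw [Complex.ofReal_zero] at h
    refine h.congr' ?_
    filter_upwards [self_mem_nhdsWithin] with w hw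
    exact (circlePullback_of_ne_zero f hw.2).symm
  · have h : ContinuousAt (fun w : ℂ => ((f (w⁻¹).re : ℝ) : ℂ)) w :=
      Complex.continuous_ofReal.continuousAt.comp ((map_continuous f).continuousAt.comp
        (Complex.continuous_re.continuousAt.comp (continuousAt_inv₀ h0)))
    refine (h.congr ?_).continuousWithinAt
    filter_upwards [isOpen_ne.mem_nhds h0] with w' hw'
    exact (circlePullback_of_ne_zero f hw').symm

variable {A : Type*} [CStarAlgebra A]

theorem spectrum_subset_cayleyCircle {a : A} (ha : IsStarNormal a)
    (h : a - star a = (-(2 * Complex.I)) • (a * star a)) :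
    spectrum ℂ a ⊆ cayleyCircle := by
  have hcfc : cfc (fun w : ℂ => w - star w) a =
      cfc (fun w : ℂ => (-(2 * Complex.I)) • (w * star w)) a := by
    rw [cfc_sub (fun w : ℂ => w) (fun w : ℂ => star w) a, cfc_smul _ (fun w : ℂ => w * star w) a,
      cfc_mul (fun w : ℂ => w) (fun w : ℂ => star w) a, cfc_star_id (a := a), cfc_id' ℂ a, h]
  have heq := eqOn_of_cfc_eq_cfc hcfc
  exact fun w hw => heq hw

end Circle

section FunCalc

variable {E : Type*} [NormedAddCommGroup E] [InnerProductSpace ℂ E] [CompleteSpace E]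
  {T : E →ₗ.[ℂ] E}

theorem funCalc_eq_cfc (T : E →ₗ.[ℂ] E) (f : C₀(ℝ, ℝ)) :
    funCalc T f = cfc (circlePullback f) (resolventAt T (-Complex.I)) := rfl

theorem norm_funCalc_le (T : E →ₗ.[ℂ] E) (f : C₀(ℝ, ℝ)) {C : ℝ} (hC : 0 ≤ C)
    (hf : ∀ t, |f t| ≤ C) : ‖funCalc T f‖ ≤ C := by
  refine norm_cfc_le hC fun w _ => ?_
  split_ifs
  · simpa using hC
  · simpa using hf _

theorem isSelfAdjoint_funCalc (T : E →ₗ.[ℂ] E) (f : C₀(ℝ, ℝ)) : IsSelfAdjoint (funCalc T f) := by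
  rw [IsSelfAdjoint, funCalc, ← cfc_star]
  congr 1
  ext w
  split_ifs <;> simp

open ComplexOrder in
theorem funCalc_nonneg (T : E →ₗ.[ℂ] E) {f : C₀(ℝ, ℝ)} (hf : ∀ t, 0 ≤ f t) :
    0 ≤ funCalc T f := by
  refine cfc_nonneg fun w _ => ?_
  split_ifs
  · exact le_rfl
  · exact Complex.zero_le_real.2 (hf _)

theorem isStarNormal_resolventAt (hT : IsSelfAdjoint T) {z : ℂ} (hz : z.im ≠ 0) :
    IsStarNormal (resolventAt T z) := by
  constructor
  rw [star_resolventAt hT hz]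
  exact commute_resolventAt hT (by simpa using hz) hz

theorem spectrum_resolventAt_subset (hT : IsSelfAdjoint T) :
    spectrum ℂ (resolventAt T (-Complex.I)) ⊆ cayleyCircle := by
  have hI : (-Complex.I).im ≠ 0 := by simp
  refine spectrum_subset_cayleyCircle (isStarNormal_resolventAt hT hI) ?_
  rw [star_resolventAt hT hI, (isResolventAt_resolventAt hT hI).sub_eq_smul_mul
    (isResolventAt_resolventAt hT (by simp))]
  congr 1
  rw [map_neg, Complex.conj_I]
  ring

theorem continuousOn_spectrum_resolventAt (hT : IsSelfAdjoint T) (f : C₀(ℝ, ℝ)) :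
    ContinuousOn (circlePullback f) (spectrum ℂ (resolventAt T (-Complex.I))) :=
  (continuousOn_circlePullback f).mono (spectrum_resolventAt_subset hT)

theorem funCalc_add (hT : IsSelfAdjoint T) (f h : C₀(ℝ, ℝ)) :
    funCalc T (f + h) = funCalc T f + funCalc T h := by
  rw [funCalc_eq_cfc, funCalc_eq_cfc, funCalc_eq_cfc, circlePullback_add]
  exact cfc_add _ _ _ (continuousOn_spectrum_resolventAt hT f)
    (continuousOn_spectrum_resolventAt hT h)

theorem funCalc_smul (hT : IsSelfAdjoint T) (c : ℝ) (f : C₀(ℝ, ℝ)) :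
    funCalc T (c • f) = (c : ℂ) • funCalc T f := by
  rw [funCalc_eq_cfc, funCalc_eq_cfc, circlePullback_smul]
  exact cfc_smul (c : ℂ) (circlePullback f) (resolventAt T (-Complex.I))
    (continuousOn_spectrum_resolventAt hT f)

theorem funCalc_eq_conj {E' : Type*} [NormedAddCommGroup E'] [InnerProductSpace ℂ E']
    [CompleteSpace E'] {T' : E' →ₗ.[ℂ] E'} (hT : IsSelfAdjoint T) (hT' : IsSelfAdjoint T')
    (U : E ≃ₗᵢ[ℂ] E')
    (h : resolventAt T' (-Complex.I) = U.conjStarAlgEquiv (resolventAt T (-Complex.I)))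
    (f : C₀(ℝ, ℝ)) : funCalc T' f = U.conjStarAlgEquiv (funCalc T f) := by
  have hcont : Continuous U.conjStarAlgEquiv := by
    change Continuous fun S : E →L[ℂ] E =>
      (U : E →L[ℂ] E') ∘L S ∘L (U.symm : E' →L[ℂ] E)
    fun_prop
  rw [funCalc_eq_cfc, funCalc_eq_cfc, h]
  refine (StarAlgHomClass.map_cfc U.conjStarAlgEquiv (circlePullback f) _
    (continuousOn_spectrum_resolventAt hT f) hcont (isStarNormal_resolventAt hT (by simp)) ?_).symm
  rw [← h]
  exact isStarNormal_resolventAt hT' (by simp)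

/-- The continuous functional calculus of `(T + i)⁻¹` as a homomorphism on `C(cayleyCircle)`, an
algebra that does not depend on `T`. -/
def circleCalculus (hT : IsSelfAdjoint T) : C(cayleyCircle, ℂ) →⋆ₐ[ℂ] (E →L[ℂ] E) :=
  cfcHomSuperset (isStarNormal_resolventAt hT (by simp)) (spectrum_resolventAt_subset hT)

theorem circleCalculus_id (hT : IsSelfAdjoint T) :
    circleCalculus hT (.restrict cayleyCircle (.id ℂ)) = resolventAt T (-Complex.I) :=
  cfcHomSuperset_id _ _

theorem circleCalculus_star_id (hT : IsSelfAdjoint T) :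
    circleCalculus hT (star (.restrict cayleyCircle (.id ℂ))) = resolventAt T Complex.I := by
  rw [map_star, circleCalculus_id, star_resolventAt hT (by simp), map_neg, Complex.conj_I,
    neg_neg]

theorem norm_circleCalculus_le (hT : IsSelfAdjoint T) (h : C(cayleyCircle, ℂ)) :
    ‖circleCalculus hT h‖ ≤ ‖h‖ :=
  NonUnitalStarAlgHom.norm_apply_le _ _

/-- `circlePullback f` as a continuous function on the circle. -/
def circleFun (f : C₀(ℝ, ℝ)) : C(cayleyCircle, ℂ) where
  toFun w := circlePullback f w
  continuous_toFun := continuousOn_iff_continuous_domRestrict.1 (continuousOn_circlePullback f)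

theorem circleCalculus_circleFun (hT : IsSelfAdjoint T) (f : C₀(ℝ, ℝ)) :
    circleCalculus hT (circleFun f) = funCalc T f := by
  rw [funCalc_eq_cfc, circleCalculus, cfcHomSuperset_apply,
    cfc_apply _ _ (isStarNormal_resolventAt hT (by simp)) (continuousOn_spectrum_resolventAt hT f)]
  rfl

end FunCalc

section StrongContinuity

variable {X : Type*} [TopologicalSpace X]

theorem isClosed_setOf_continuousAt_of_lipschitzWith {α β : Type*} [PseudoMetricSpace α]
    [PseudoMetricSpace β] {L : X → α → β} {C : ℝ≥0} (hL : ∀ x, LipschitzWith C (L x)) (x₀ : X) :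
    IsClosed {a | ContinuousAt (fun x => L x a) x₀} :=
  (LipschitzWith.uniformEquicontinuous _ C hL).equicontinuous.isClosed_setOfPred_tendsto
    (hL x₀).continuous

theorem isClosed_setOf_continuous_of_lipschitzWith {α β : Type*} [PseudoMetricSpace α]
    [PseudoMetricSpace β] {L : X → α → β} {C : ℝ≥0} (hL : ∀ x, LipschitzWith C (L x)) :
    IsClosed {a | Continuous fun x => L x a} := by
  simp only [continuous_iff_continuousAt, Set.ofPred_forall]
  exact isClosed_iInter fun x => isClosed_setOf_continuousAt_of_lipschitzWith hL x

theorem continuousAt_clm_apply_of_dense_span {𝕜 E F : Type*} [NontriviallyNormedField 𝕜]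
    [SeminormedAddCommGroup E] [NormedSpace 𝕜 E] [SeminormedAddCommGroup F] [NormedSpace 𝕜 F]
    {L : X → E →L[𝕜] F} {C : ℝ} (hL : ∀ x, ‖L x‖ ≤ C) {s : Set E}
    (hs : Dense (Submodule.span 𝕜 s : Set E)) {x₀ : X}
    (hcont : ∀ a ∈ s, ContinuousAt (fun x => L x a) x₀) (a : E) :
    ContinuousAt (fun x => L x a) x₀ := by
  have hspan (a : E) (ha : a ∈ Submodule.span 𝕜 s) : ContinuousAt (fun x => L x a) x₀ := by
    induction ha using Submodule.span_induction with
    | mem a ha => exact hcont a ha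
    | zero => simpa only [map_zero] using (continuousAt_const : ContinuousAt (fun _ => (0 : F)) x₀)
    | add a b _ _ ha hb => simpa only [map_add] using ha.fun_add hb
    | smul c a _ ha => simpa only [map_smul] using ha.fun_const_smul c
  have hlip (x : X) : LipschitzWith C.toNNReal (L x) :=
    (L x).lipschitz.weaken (NNReal.coe_le_coe.1 ((hL x).trans (Real.le_coe_toNNReal C)))
  have hclosed := isClosed_setOf_continuousAt_of_lipschitzWith hlip x₀
  exact hclosed.closure_subset_iff.2 hspan (hs a)

variable {E : Type*} [NormedAddCommGroup E] [InnerProductSpace ℂ E] [CompleteSpace E]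
  {T : X → E →ₗ.[ℂ] E}

theorem continuous_circleCalculus_apply (hT : ∀ x, IsSelfAdjoint (T x))
    (hcont : ∀ z : ℂ, z.im ≠ 0 → ∀ ψ, Continuous fun x => resolventAt (T x) z ψ)
    (h : C(cayleyCircle, ℂ)) (ψ : E) : Continuous fun x => circleCalculus (hT x) h ψ := by
  induction h using ContinuousMap.induction_on_of_compact generalizing ψ with
  | const r =>
    have hconst (x : X) : circleCalculus (hT x) (.const _ r) = r • 1 := by
      rw [show ContinuousMap.const cayleyCircle r = r • 1 by ext; simp, map_smul, map_one]
    simp only [hconst]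
    exact continuous_const
  | id => simpa only [circleCalculus_id] using hcont (-Complex.I) (by simp) ψ
  | star_id => simpa only [circleCalculus_star_id] using hcont Complex.I (by simp) ψ
  | add f h hf hh => simpa only [map_add, add_apply] using (hf ψ).fun_add (hh ψ)
  | mul f h hf hh =>
    have hlip (x : X) : LipschitzWith ‖f‖₊ (circleCalculus (hT x) f) :=
      (ContinuousLinearMap.lipschitz _).weaken (norm_circleCalculus_le (hT x) f)
    have hprod : Continuous fun p : E × X => circleCalculus (hT p.2) f p.1 :=
      continuous_prod_of_continuous_lipschitzWith _ ‖f‖₊ hf hlip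
    have hcomp : Continuous fun x => circleCalculus (hT x) f (circleCalculus (hT x) h ψ) :=
      hprod.comp₂ (hh ψ) continuous_id
    exact hcomp.congr fun x => by rw [map_mul, mul_apply_eq_comp]
  | frequently f hf =>
    have hlip (x : X) : LipschitzWith ‖ψ‖₊ fun h => circleCalculus (hT x) h ψ := by
      refine LipschitzWith.of_dist_le_mul fun a b => ?_
      rw [dist_eq_norm, dist_eq_norm, ← sub_apply, ← map_sub, mul_comm]
      exact ContinuousLinearMap.le_of_opNorm_le _ (norm_circleCalculus_le (hT x) _) ψ
    exact (isClosed_setOf_continuous_of_lipschitzWith hlip).closure_subset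
      (mem_closure_iff_frequently.2 (hf.mono fun h hh => hh ψ))

theorem continuous_funCalc_apply (hT : ∀ x, IsSelfAdjoint (T x))
    (hcont : ∀ z : ℂ, z.im ≠ 0 → ∀ ψ, Continuous fun x => resolventAt (T x) z ψ)
    (f : C₀(ℝ, ℝ)) (ψ : E) : Continuous fun x => funCalc (T x) f ψ := by
  simpa only [circleCalculus_circleFun] using
    continuous_circleCalculus_apply hT hcont (circleFun f) ψ

end StrongContinuity

section Poisson

/-- The Poisson kernel `t ↦ ε / ((t - λ)² + ε²)` at `z = λ + iε`, and `0` at a real `z`. -/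
def poisson (z : ℂ) : C₀(ℝ, ℝ) where
  toFun t := if z.im = 0 then 0 else |z.im| / ((t - z.re) ^ 2 + z.im ^ 2)
  continuous_toFun := by
    split_ifs with h
    · exact continuous_const
    · refine Continuous.div (by fun_prop) (by fun_prop) fun t => ?_
      positivity
  zero_at_infty' := by
    split_ifs with h
    · exact tendsto_const_nhds
    · have hsub : Tendsto (fun t : ℝ => t - z.re) (cocompact ℝ) (cocompact ℝ) :=
        (Homeomorph.subRight z.re).isClosedEmbedding.tendsto_cocompact
      have hsq : Tendsto (fun t : ℝ => (t - z.re) ^ 2) (cocompact ℝ) atTop := by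
        simpa only [Function.comp_def, Real.norm_eq_abs, sq_abs] using
          (tendsto_pow_atTop two_ne_zero).comp ((tendsto_norm_cocompact_atTop (E := ℝ)).comp hsub)
      exact tendsto_const_nhds.div_atTop (tendsto_atTop_add_const_right _ _ hsq)

theorem poisson_apply {z : ℂ} (hz : z.im ≠ 0) (t : ℝ) :
    poisson z t = |z.im| / ((t - z.re) ^ 2 + z.im ^ 2) := if_neg hz

theorem poisson_nonneg (z : ℂ) (t : ℝ) : 0 ≤ poisson z t := by
  change 0 ≤ if z.im = 0 then 0 else |z.im| / ((t - z.re) ^ 2 + z.im ^ 2)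
  positivity

theorem one_sub_mul_eq_of_mem_cayleyCircle {w : ℂ} (hw : w ∈ cayleyCircle) (h0 : w ≠ 0) (z : ℂ) :
    1 - (z + Complex.I) * w = w * (((w⁻¹).re : ℝ) - z) := by
  have h : w * (((w⁻¹).re : ℝ) + Complex.I) = 1 := by
    rw [← inv_eq_of_mem_cayleyCircle hw h0, mul_inv_cancel₀ h0]
  linear_combination -h

theorem one_sub_mul_ne_zero_of_mem_cayleyCircle {w : ℂ} (hw : w ∈ cayleyCircle) {z : ℂ}
    (hz : z.im ≠ 0) : 1 - (z + Complex.I) * w ≠ 0 := by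
  by_cases h0 : w = 0
  · simp [h0]
  · rw [one_sub_mul_eq_of_mem_cayleyCircle hw h0]
    refine mul_ne_zero h0 fun h => hz ?_
    simpa using congrArg Complex.im h

/-- The function `t ↦ (t - z)⁻¹` transported to the circle by `w = (t + i)⁻¹`; it has complex
values, hence no counterpart in the domain of `funCalc`. -/
def circleResolvent {z : ℂ} (hz : z.im ≠ 0) : C(cayleyCircle, ℂ) where
  toFun w := w / (1 - (z + Complex.I) * w)
  continuous_toFun := Continuous.div (by fun_prop) (by fun_prop) fun w =>
    one_sub_mul_ne_zero_of_mem_cayleyCircle w.2 hz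

theorem circleFun_poisson {z : ℂ} (hz : z.im ≠ 0) (hz' : (conj z).im ≠ 0) :
    circleFun (poisson z) =
      ((|z.im| : ℝ) : ℂ) • (circleResolvent hz * circleResolvent hz') := by
  ext w
  change circlePullback (poisson z) w =
    ((|z.im| : ℝ) : ℂ) * (w / (1 - (z + Complex.I) * w) * (w / (1 - (conj z + Complex.I) * w)))
  by_cases h0 : (w : ℂ) = 0
  · simp [h0, circlePullback_zero]
  · rw [circlePullback_of_ne_zero _ h0, poisson_apply hz,
      one_sub_mul_eq_of_mem_cayleyCircle w.2 h0, one_sub_mul_eq_of_mem_cayleyCircle w.2 h0,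
      div_mul_cancel_left₀ h0, div_mul_cancel_left₀ h0, ← mul_inv]
    set t := ((w : ℂ)⁻¹).re
    have hprod : ((t : ℂ) - z) * (t - conj z) = (((t - z.re) ^ 2 + z.im ^ 2 : ℝ) : ℂ) := by
      rw [← Complex.conj_ofReal t, ← map_sub, Complex.conj_ofReal, Complex.mul_conj,
        Complex.normSq_apply, Complex.sub_re, Complex.sub_im, Complex.ofReal_re,
        Complex.ofReal_im]
      push_cast
      ring
    rw [hprod, Complex.ofReal_div, div_eq_mul_inv]

variable {E : Type*} [NormedAddCommGroup E] [InnerProductSpace ℂ E] [CompleteSpace E]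
  {T : E →ₗ.[ℂ] E}

theorem circleCalculus_circleResolvent (hT : IsSelfAdjoint T) {z : ℂ} (hz : z.im ≠ 0) :
    circleCalculus hT (circleResolvent hz) = resolventAt T z := by
  set R := resolventAt T (-Complex.I)
  set b := circleCalculus hT (circleResolvent hz)
  have hfac : (1 - (z + Complex.I) • .restrict cayleyCircle (.id ℂ)) * circleResolvent hz =
      .restrict cayleyCircle (.id ℂ) := by
    ext w
    exact mul_div_cancel₀ _ (one_sub_mul_ne_zero_of_mem_cayleyCircle w.2 hz)
  have hb : (1 - (z + Complex.I) • R) * b = R := by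
    have h := congrArg (circleCalculus hT) hfac
    rwa [map_mul, map_sub, map_one, map_smul, circleCalculus_id] at h
  have hR : resolventAt T z - R = (z + Complex.I) • (resolventAt T z * R) := by
    simpa using (isResolventAt_resolventAt hT hz).sub_eq_smul_mul
      (isResolventAt_resolventAt hT (z := -Complex.I) (by simp))
  have hinv : (1 + (z + Complex.I) • resolventAt T z) * (1 - (z + Complex.I) • R) = 1 := by
    simp only [add_mul, mul_sub, mul_one, one_mul, smul_mul_assoc, mul_smul_comm]
    linear_combination (norm := module) (z + Complex.I) • hR
  calc b = (1 + (z + Complex.I) • resolventAt T z) * ((1 - (z + Complex.I) • R) * b) := by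
        rw [← mul_assoc, hinv, one_mul]
    _ = resolventAt T z := by
        rw [hb, add_mul, one_mul, smul_mul_assoc, ← hR, add_sub_cancel]

theorem funCalc_poisson (hT : IsSelfAdjoint T) {z : ℂ} (hz : z.im ≠ 0) :
    funCalc T (poisson z) =
      ((|z.im| : ℝ) : ℂ) • (resolventAt T z * resolventAt T (conj z)) := by
  have hz' : (conj z).im ≠ 0 := by simpa using hz
  rw [← circleCalculus_circleFun hT, circleFun_poisson hz hz', map_smul, map_mul,
    circleCalculus_circleResolvent, circleCalculus_circleResolvent]

end Poisson

section Operators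

variable {d k : ℕ}

theorem memℓp_comp_equiv {ι ι' F : Type*} [NormedAddCommGroup F] {f : ι → F}
    (hf : Memℓp f 2) (e : ι' ≃ ι) : Memℓp (fun i => f (e i)) 2 := by
  have h_two : 0 < (2 : ℝ≥0∞).toReal := by simp
  rw [memℓp_gen_iff h_two] at hf ⊢
  exact e.summable_iff.2 hf

/-- The unitary shift `(S_a ψ)(x) = ψ(x + a)`. -/
def shift (a : Site d) : Wave d k ≃ₗᵢ[ℂ] Wave d k where
  toFun ψ := ⟨fun x => ψ (x + a), memℓp_comp_equiv (lp.memℓp ψ) (Equiv.addRight a)⟩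
  invFun ψ := ⟨fun x => ψ (x - a), memℓp_comp_equiv (lp.memℓp ψ) (Equiv.subRight a)⟩
  map_add' _ _ := rfl
  map_smul' _ _ := rfl
  left_inv ψ := lp.ext (funext fun x => congrArg ψ (sub_add_cancel x a))
  right_inv ψ := lp.ext (funext fun x => congrArg ψ (add_sub_cancel_right x a))
  norm_map' ψ := by
    have h_two : 0 < (2 : ℝ≥0∞).toReal := by simp
    rw [lp.norm_eq_tsum_rpow h_two, lp.norm_eq_tsum_rpow h_two]
    congr 1
    exact (Equiv.addRight a).tsum_eq fun x => ‖ψ x‖ ^ (2 : ℝ≥0∞).toReal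

@[simp]
theorem shift_apply (a : Site d) (ψ : Wave d k) (x : Site d) : shift a ψ x = ψ (x + a) := rfl

@[simp]
theorem shift_symm_apply (a : Site d) (ψ : Wave d k) (x : Site d) :
    (shift a).symm ψ x = ψ (x - a) := rfl

theorem shift_inner (a : Site d) (ψ φ : Wave d k) :
    ⟪shift a ψ, φ⟫_ℂ = ⟪ψ, shift (-a) φ⟫_ℂ := by
  rw [← LinearIsometryEquiv.inner_map_map (shift a) ψ]
  congr 1
  exact lp.ext (funext fun x => by simp)

theorem norm_toEuclideanLin_le (K : Matrix (Fin k) (Fin k) ℂ) (ψ : Spin k) :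
    ‖Matrix.toEuclideanLin K ψ‖ ≤ ‖K‖ * ‖ψ‖ := Matrix.l2_opNorm_mulVec K ψ

theorem norm_toEuclideanLin_le_norm_smul (K : Matrix (Fin k) (Fin k) ℂ) (ψ : Spin k) :
    ‖Matrix.toEuclideanLin K ψ‖ ≤ ‖(‖K‖ : ℂ) • ψ‖ := by
  rw [norm_smul, Complex.norm_real, norm_norm]
  exact norm_toEuclideanLin_le K ψ

theorem memℓp_toEuclideanLin (K : Matrix (Fin k) (Fin k) ℂ) (ψ : Wave d k) :
    Memℓp (fun x => Matrix.toEuclideanLin K (ψ x)) 2 :=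
  Memℓp.mono' ((lp.memℓp ψ).const_smul (‖K‖ : ℂ)) fun _ => norm_toEuclideanLin_le_norm_smul K _

/-- The multiplication `ψ ↦ K ψ(·)` by a fixed matrix. -/
def blockMul (K : Matrix (Fin k) (Fin k) ℂ) : Wave d k →L[ℂ] Wave d k :=
  LinearMap.mkContinuous
    { toFun := fun ψ => ⟨fun x => Matrix.toEuclideanLin K (ψ x), memℓp_toEuclideanLin K ψ⟩
      map_add' := fun ψ φ => lp.ext (funext fun x => map_add _ _ _)
      map_smul' := fun c ψ =>
        lp.ext (funext fun x => map_smul (Matrix.toEuclideanLin K) c (ψ x)) }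
    ‖K‖ fun ψ => by
      rw [show ‖K‖ * ‖ψ‖ = ‖(‖K‖ : ℂ) • ψ‖ by rw [norm_smul, Complex.norm_real, norm_norm]]
      exact lp.norm_mono two_ne_zero fun x => norm_toEuclideanLin_le_norm_smul K (ψ x)

@[simp]
theorem blockMul_apply (K : Matrix (Fin k) (Fin k) ℂ) (ψ : Wave d k) (x : Site d) :
    blockMul K ψ x = Matrix.toEuclideanLin K (ψ x) := rfl

theorem blockMul_shift (K : Matrix (Fin k) (Fin k) ℂ) (a : Site d) (ψ : Wave d k) :
    blockMul K (shift a ψ) = shift a (blockMul K ψ) := rfl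

theorem inner_toEuclideanLin (K : Matrix (Fin k) (Fin k) ℂ) (ψ φ : Spin k) :
    ⟪Matrix.toEuclideanLin K ψ, φ⟫_ℂ = ⟪ψ, Matrix.toEuclideanLin K.conjTranspose φ⟫_ℂ := by
  rw [Matrix.toEuclideanLin_conjTranspose_eq_adjoint, LinearMap.adjoint_inner_right]

theorem blockMul_inner (K : Matrix (Fin k) (Fin k) ℂ) (ψ φ : Wave d k) :
    ⟪blockMul K ψ, φ⟫_ℂ = ⟪ψ, blockMul K.conjTranspose φ⟫_ℂ := by
  simp only [lp.inner_eq_tsum, blockMul_apply, inner_toEuclideanLin]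

/-- The hopping operator `(Wψ)(x) = ∑_{y ∼ x} K(x - y) ψ(y)`. -/
def ModelData.hopping (M : ModelData d k) : Wave d k →L[ℂ] Wave d k :=
  ∑ i : Fin d,
    (blockMul (M.K (unitVec i)) ∘L
        (shift (k := k) (-unitVec i)).toContinuousLinearEquiv.toContinuousLinearMap +
      blockMul (M.K (-unitVec i)) ∘L
        (shift (k := k) (unitVec i)).toContinuousLinearEquiv.toContinuousLinearMap)

theorem ModelData.hopping_apply (M : ModelData d k) (ψ : Wave d k) (x : Site d) :
    M.hopping ψ x = ∑ i : Fin d,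
        (Matrix.toEuclideanLin (M.K (unitVec i)) (ψ (x - unitVec i)) +
          Matrix.toEuclideanLin (M.K (-unitVec i)) (ψ (x + unitVec i))) := by
  rw [ModelData.hopping, sum_apply, lp.coeFn_sum, Finset.sum_apply]
  exact Finset.sum_congr rfl fun i _ => by simp [sub_eq_add_neg]

theorem ModelData.hopping_inner {M : ModelData d k}
    (hK : ∀ i : Fin d, M.K (-unitVec i) = (M.K (unitVec i)).conjTranspose) (ψ φ : Wave d k) :
    ⟪M.hopping ψ, φ⟫_ℂ = ⟪ψ, M.hopping φ⟫_ℂ := by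
  simp only [ModelData.hopping, sum_apply, sum_inner, inner_sum]
  refine Finset.sum_congr rfl fun i _ => ?_
  simp only [add_apply, ContinuousLinearMap.comp_apply, inner_add_left, inner_add_right,
    ContinuousLinearEquiv.coe_coe, LinearIsometryEquiv.coe_toContinuousLinearEquiv,
    blockMul_inner, shift_inner, ← blockMul_shift, hK, neg_neg, Matrix.conjTranspose_conjTranspose]
  exact add_comm _ _

theorem ModelData.formal_apply (M : ModelData d k) (g : ℝ) (v : Site d → ℝ) (ψ : Wave d k)
    (x : Site d) : M.formal g v (fun x => ψ x) x =
      Matrix.toEuclideanLin ((v x : ℂ) • M.A + M.B) (ψ x) + ((g⁻¹ : ℝ) : ℂ) • M.hopping ψ x := by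
  rw [ModelData.hopping_apply]
  rfl

end Operators

section Hamiltonian

variable {d k : ℕ} {M : ModelData d k} {g : ℝ} {v : Site d → ℝ} {CB1 CB2 CB3 : ℝ}

theorem ModelData.hamiltonian_apply (φ : (M.hamiltonian g v).domain) (x : Site d) :
    M.hamiltonian g v φ x = Matrix.toEuclideanLin ((v x : ℂ) • M.A + M.B) (φ.1 x) +
      ((g⁻¹ : ℝ) : ℂ) • M.hopping φ.1 x :=
  M.formal_apply g v φ.1 x

theorem ModelData.exists_hamiltonian_apply_eq {ψ χ : Wave d k}
    (h : ∀ x, Matrix.toEuclideanLin ((v x : ℂ) • M.A + M.B) (ψ x) +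
      ((g⁻¹ : ℝ) : ℂ) • M.hopping ψ x = χ x) :
    ∃ hψ : ψ ∈ (M.hamiltonian g v).domain, M.hamiltonian g v ⟨ψ, hψ⟩ = χ := by
  have hformal : M.formal g v (fun x => ψ x) = χ := by
    funext x
    rw [M.formal_apply, h]
  have hmem : Memℓp (M.formal g v (fun x => ψ x)) 2 := hformal ▸ lp.memℓp χ
  exact ⟨hmem, lp.ext hformal⟩

theorem ModelData.exists_hamiltonian_single_eq (M : ModelData d k) (g : ℝ) (v : Site d → ℝ)
    (x : Site d) (a : Spin k) :
    ∃ h : (lp.single 2 x a : Wave d k) ∈ (M.hamiltonian g v).domain,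
      M.hamiltonian g v ⟨lp.single 2 x a, h⟩ =
        lp.single 2 x (Matrix.toEuclideanLin ((v x : ℂ) • M.A + M.B) a) +
          ((g⁻¹ : ℝ) : ℂ) • M.hopping (lp.single 2 x a) := by
  refine ModelData.exists_hamiltonian_apply_eq fun y => ?_
  rw [lp.coeFn_add, lp.coeFn_smul, Pi.add_apply, Pi.smul_apply]
  congr 1
  by_cases h : y = x
  · subst h
    simp only [lp.single_apply_self]
  · rw [lp.single_apply_ne _ _ _ h, lp.single_apply_ne _ _ _ h, map_zero]

theorem ModelData.dense_domain_hamiltonian (M : ModelData d k) (g : ℝ) (v : Site d → ℝ) :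
    Dense ((M.hamiltonian g v).domain : Set (Wave d k)) := by
  rw [Submodule.dense_iff_topologicalClosure_eq_top,
    Submodule.topologicalClosure_eq_top_iff, Submodule.eq_bot_iff]
  intro χ hχ
  refine lp.ext (funext fun x => ext_inner_left ℂ fun a => ?_)
  have horth : ⟪(lp.single 2 x a : Wave d k), χ⟫_ℂ = 0 :=
    (Submodule.mem_orthogonal _ _).1 hχ _ (M.exists_hamiltonian_single_eq g v x a).1
  rw [lp.inner_single_left] at horth
  exact horth.trans (inner_zero_right _).symm

theorem ModelData.Admissible.isHermitian_site (hM : M.Admissible CB1 CB2 CB3) (t : ℝ) :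
    ((t : ℂ) • M.A + M.B).conjTranspose = (t : ℂ) • M.A + M.B := by
  rw [Matrix.conjTranspose_add, Matrix.conjTranspose_smul, hM.hermitian_A.eq, hM.hermitian_B.eq,
    Complex.star_def, Complex.conj_ofReal]

theorem ModelData.Admissible.isFormalAdjoint (hM : M.Admissible CB1 CB2 CB3) :
    (M.hamiltonian g v).IsFormalAdjoint (M.hamiltonian g v) := by
  intro φ ψ
  have hdiag : ⟪M.hamiltonian g v φ - ((g⁻¹ : ℝ) : ℂ) • M.hopping φ.1, ψ.1⟫_ℂ =
      ⟪φ.1, M.hamiltonian g v ψ - ((g⁻¹ : ℝ) : ℂ) • M.hopping ψ.1⟫_ℂ := by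
    simp only [lp.inner_eq_tsum, lp.coeFn_sub, lp.coeFn_smul, Pi.sub_apply, Pi.smul_apply,
      ModelData.hamiltonian_apply, add_sub_cancel_right, inner_toEuclideanLin,
      hM.isHermitian_site]
  rw [inner_sub_left, inner_sub_right, inner_smul_left, inner_smul_right,
    ModelData.hopping_inner hM.hermitian_K, Complex.conj_ofReal] at hdiag
  exact sub_left_injective hdiag

theorem ModelData.Admissible.exists_hamiltonian_apply_eq_of_inner_single
    (hM : M.Admissible CB1 CB2 CB3) {χ η : Wave d k}
    (h : ∀ x a, ⟪η, lp.single 2 x a⟫_ℂ = ⟪χ, lp.single 2 x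
      (Matrix.toEuclideanLin ((v x : ℂ) • M.A + M.B) a) +
        ((g⁻¹ : ℝ) : ℂ) • M.hopping (lp.single 2 x a)⟫_ℂ) :
    ∃ hχ : χ ∈ (M.hamiltonian g v).domain, M.hamiltonian g v ⟨χ, hχ⟩ = η := by
  refine ModelData.exists_hamiltonian_apply_eq fun x => ext_inner_right ℂ fun a => ?_
  rw [← lp.inner_single_right (𝕜 := ℂ) x a η, h x a, inner_add_right, inner_smul_right,
    ← ModelData.hopping_inner hM.hermitian_K, lp.inner_single_right, lp.inner_single_right,
    inner_add_left, inner_smul_left, inner_toEuclideanLin, hM.isHermitian_site,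
    Complex.conj_ofReal]

theorem ModelData.Admissible.isSelfAdjoint_hamiltonian (hM : M.Admissible CB1 CB2 CB3) (g : ℝ)
    (v : Site d → ℝ) : IsSelfAdjoint (M.hamiltonian g v) := by
  refine isSelfAdjoint_of_isFormalAdjoint (M.dense_domain_hamiltonian g v) hM.isFormalAdjoint
    fun χ η h => hM.exists_hamiltonian_apply_eq_of_inner_single fun x a => ?_
  obtain ⟨hmem, heq⟩ := M.exists_hamiltonian_single_eq g v x a
  rw [← heq]
  exact h ⟨_, hmem⟩

/-- `(H - z) (δ_x ⊗ a)`. -/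
def ModelData.shiftedColumn (M : ModelData d k) (g : ℝ) (v : Site d → ℝ) (z : ℂ) (x : Site d)
    (a : Spin k) : Wave d k :=
  lp.single 2 x (Matrix.toEuclideanLin ((v x : ℂ) • M.A + M.B) a) +
    ((g⁻¹ : ℝ) : ℂ) • M.hopping (lp.single 2 x a) - z • lp.single 2 x a

theorem ModelData.Admissible.eq_zero_of_inner_shiftedColumn (hM : M.Admissible CB1 CB2 CB3)
    {z : ℂ} (hz : z.im ≠ 0) {χ : Wave d k}
    (h : ∀ x a, ⟪χ, M.shiftedColumn g v z x a⟫_ℂ = 0) : χ = 0 := by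
  obtain ⟨hmem, heq⟩ : ∃ hχ : χ ∈ (M.hamiltonian g v).domain,
      M.hamiltonian g v ⟨χ, hχ⟩ = conj z • χ := by
    refine hM.exists_hamiltonian_apply_eq_of_inner_single fun x a => ?_
    have horth := h x a
    rw [ModelData.shiftedColumn, inner_sub_right, inner_smul_right, sub_eq_zero] at horth
    rw [horth, inner_smul_left, Complex.conj_conj]
  exact eq_zero_of_apply_eq_smul (z := conj z) hM.isFormalAdjoint (by simpa using hz) heq

theorem ModelData.Admissible.dense_span_shiftedColumn (hM : M.Admissible CB1 CB2 CB3) (g : ℝ)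
    (v : Site d → ℝ) {z : ℂ} (hz : z.im ≠ 0) :
    Dense (Submodule.span ℂ (Set.range fun p : Site d × Spin k =>
      M.shiftedColumn g v z p.1 p.2) : Set (Wave d k)) := by
  rw [Submodule.dense_iff_topologicalClosure_eq_top,
    Submodule.topologicalClosure_eq_top_iff, Submodule.eq_bot_iff]
  intro χ hχ
  exact hM.eq_zero_of_inner_shiftedColumn hz fun x a =>
    (Submodule.mem_orthogonal' _ _).1 hχ _ (Submodule.subset_span ⟨(x, a), rfl⟩)

/-- The resolvent `(H - z)⁻¹` of the Hamiltonian. -/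
def ModelData.green (M : ModelData d k) (g : ℝ) (v : Site d → ℝ) (z : ℂ) :
    Wave d k →L[ℂ] Wave d k :=
  resolventAt (M.hamiltonian g v) z

theorem ModelData.Admissible.isResolventAt_green (hM : M.Admissible CB1 CB2 CB3) (g : ℝ)
    (v : Site d → ℝ) {z : ℂ} (hz : z.im ≠ 0) :
    IsResolventAt (M.hamiltonian g v) z (M.green g v z) :=
  isResolventAt_resolventAt (hM.isSelfAdjoint_hamiltonian g v) hz

theorem ModelData.Admissible.norm_green_le (hM : M.Admissible CB1 CB2 CB3) (g : ℝ)
    (v : Site d → ℝ) {z : ℂ} (hz : z.im ≠ 0) : ‖M.green g v z‖ ≤ |z.im|⁻¹ :=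
  norm_resolventAt_le (hM.isSelfAdjoint_hamiltonian g v) hz

theorem ModelData.Admissible.green_equation (hM : M.Admissible CB1 CB2 CB3) (g : ℝ)
    (v : Site d → ℝ) {z : ℂ} (hz : z.im ≠ 0) (ψ : Wave d k) (x : Site d) :
    Matrix.toEuclideanLin ((v x : ℂ) • M.A + M.B) (M.green g v z ψ x) +
      ((g⁻¹ : ℝ) : ℂ) • M.hopping (M.green g v z ψ) x - z • M.green g v z ψ x = ψ x := by
  obtain ⟨hmem, heq⟩ := (hM.isResolventAt_green g v hz).1 ψ
  have happly := congrArg (fun φ : Wave d k => φ x) heq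
  simpa only [lp.coeFn_sub, lp.coeFn_smul, Pi.sub_apply, Pi.smul_apply,
    ModelData.hamiltonian_apply] using happly

theorem ModelData.Admissible.green_eq_of_equation (hM : M.Admissible CB1 CB2 CB3) {z : ℂ}
    (hz : z.im ≠ 0) {ψ φ : Wave d k}
    (h : ∀ x, Matrix.toEuclideanLin ((v x : ℂ) • M.A + M.B) (φ x) +
      ((g⁻¹ : ℝ) : ℂ) • M.hopping φ x - z • φ x = ψ x) : M.green g v z ψ = φ := by
  obtain ⟨hmem, heq⟩ := ModelData.exists_hamiltonian_apply_eq (M := M) (g := g) (v := v)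
    (ψ := φ) (χ := ψ + z • φ) fun x => by
      rw [lp.coeFn_add, lp.coeFn_smul, Pi.add_apply, Pi.smul_apply, ← h x, sub_add_cancel]
  simpa only [heq, add_sub_cancel_right] using (hM.isResolventAt_green g v hz).2 ⟨φ, hmem⟩

theorem ModelData.shiftedColumn_eq_add (M : ModelData d k) (g : ℝ) (v w : Site d → ℝ) (z : ℂ)
    (x : Site d) (a : Spin k) : M.shiftedColumn g v z x a = M.shiftedColumn g w z x a +
      ((v x - w x : ℝ) : ℂ) • lp.single 2 x (Matrix.toEuclideanLin M.A a) := by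
  have hsite : Matrix.toEuclideanLin ((v x : ℂ) • M.A + M.B) a =
      Matrix.toEuclideanLin ((w x : ℂ) • M.A + M.B) a +
        ((v x - w x : ℝ) : ℂ) • Matrix.toEuclideanLin M.A a := by
    simp only [map_add, map_smul, LinearMap.add_apply, LinearMap.smul_apply, Complex.ofReal_sub]
    module
  rw [ModelData.shiftedColumn, ModelData.shiftedColumn, hsite, lp.single_add, lp.single_smul]
  abel

theorem ModelData.Admissible.green_shiftedColumn (hM : M.Admissible CB1 CB2 CB3) (g : ℝ)
    (v w : Site d → ℝ) {z : ℂ} (hz : z.im ≠ 0) (x : Site d) (a : Spin k) :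
    M.green g w z (M.shiftedColumn g v z x a) = lp.single 2 x a +
      ((v x - w x : ℝ) : ℂ) • M.green g w z (lp.single 2 x (Matrix.toEuclideanLin M.A a)) := by
  have hinv : M.green g w z (M.shiftedColumn g w z x a) = lp.single 2 x a := by
    obtain ⟨hmem, heq⟩ := M.exists_hamiltonian_single_eq g w x a
    simpa only [heq, ModelData.shiftedColumn] using (hM.isResolventAt_green g w hz).2 ⟨_, hmem⟩
  rw [M.shiftedColumn_eq_add g v w, map_add, map_smul, hinv]

theorem ModelData.Admissible.continuousAt_green_shiftedColumn (hM : M.Admissible CB1 CB2 CB3)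
    (g : ℝ) (v : Site d → ℝ) {z : ℂ} (hz : z.im ≠ 0) (x : Site d) (a : Spin k) :
    ContinuousAt (fun w : Site d → ℝ => M.green g w z (M.shiftedColumn g v z x a)) v := by
  simp only [hM.green_shiftedColumn g v _ hz]
  refine continuousAt_const.add ?_
  have hcoeff : Tendsto (fun w : Site d → ℝ => ((v x - w x : ℝ) : ℂ)) (𝓝 v) (𝓝 0) := by
    have hcont : Continuous fun w : Site d → ℝ => ((v x - w x : ℝ) : ℂ) := by fun_prop
    simpa using hcont.tendsto v
  have hbdd : IsBoundedUnder (· ≤ ·) (𝓝 v) (norm ∘ fun w : Site d → ℝ =>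
      M.green g w z (lp.single 2 x (Matrix.toEuclideanLin M.A a))) :=
    isBoundedUnder_of ⟨_, fun w =>
      ContinuousLinearMap.le_of_opNorm_le _ (hM.norm_green_le g w hz) _⟩
  simpa [ContinuousAt] using hcoeff.zero_smul_isBoundedUnder_le hbdd

theorem ModelData.Admissible.continuous_green (hM : M.Admissible CB1 CB2 CB3) (g : ℝ) {z : ℂ}
    (hz : z.im ≠ 0) (ψ : Wave d k) : Continuous fun v : Site d → ℝ => M.green g v z ψ := by
  refine continuous_iff_continuousAt.2 fun v =>
    continuousAt_clm_apply_of_dense_span (fun w => hM.norm_green_le g w hz)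
      (hM.dense_span_shiftedColumn g v hz) ?_ ψ
  rintro _ ⟨⟨x, a⟩, rfl⟩
  exact hM.continuousAt_green_shiftedColumn g v hz x a

theorem ModelData.Admissible.green_update (hM : M.Admissible CB1 CB2 CB3) (g : ℝ)
    (v : Site d → ℝ) {z : ℂ} (hz : z.im ≠ 0) (x : Site d) (t : ℝ) (ψ : Wave d k) :
    M.green g (Function.update v x t) z ψ + ((t - v x : ℝ) : ℂ) • M.green g v z
      (lp.single 2 x (Matrix.toEuclideanLin M.A (M.green g (Function.update v x t) z ψ x))) =
      M.green g v z ψ := by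
  set φ := M.green g (Function.update v x t) z ψ with hφ
  have hresolvent : M.green g v z (ψ - ((t - v x : ℝ) : ℂ) •
      lp.single 2 x (Matrix.toEuclideanLin M.A (φ x))) = φ := by
    refine hM.green_eq_of_equation hz fun y => ?_
    have heq := hM.green_equation g (Function.update v x t) hz ψ y
    rw [← hφ] at heq
    rw [lp.coeFn_sub, lp.coeFn_smul, Pi.sub_apply, Pi.smul_apply, ← heq]
    by_cases hy : y = x
    · subst hy
      simp only [lp.single_apply_self, Function.update_self, map_add, map_smul,
        LinearMap.add_apply, LinearMap.smul_apply, Complex.ofReal_sub]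
      module
    · rw [lp.single_apply_ne _ _ _ hy, Function.update_of_ne hy, smul_zero, sub_zero]
  rw [map_sub, map_smul] at hresolvent
  nth_rewrite 1 [← hresolvent]
  exact sub_add_cancel _ _

theorem ModelData.Admissible.green_shift (hM : M.Admissible CB1 CB2 CB3) (g : ℝ)
    (v : Site d → ℝ) {z : ℂ} (hz : z.im ≠ 0) (a : Site d) :
    M.green g (fun x => v (x + a)) z = (shift a).conjStarAlgEquiv (M.green g v z) := by
  ext1 ψ
  refine hM.green_eq_of_equation hz fun x => ?_
  have heq := hM.green_equation g v hz ((shift a).symm ψ) (x + a)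
  rw [shift_symm_apply, add_sub_cancel_right] at heq
  rw [← heq]
  simp only [LinearIsometryEquiv.conjStarAlgEquiv_apply_apply, shift_apply,
    ModelData.hopping_apply, add_right_comm, sub_add_eq_add_sub]

end Hamiltonian

section Kernel

variable {d k : ℕ}

theorem kernel_add (T T' : Wave d k →L[ℂ] Wave d k) (m n : Site d) :
    kernel (T + T') m n = kernel T m n + kernel T' m n := rfl

theorem kernel_smul (c : ℂ) (T : Wave d k →L[ℂ] Wave d k) (m n : Site d) :
    kernel (c • T) m n = c • kernel T m n := rfl

/-- The wave function concentrated at the site `n`, with spin `i`; these functions are the standard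
basis in which `kernel` is the matrix of an operator. -/
def pointWave (n : Site d) (i : Fin k) : Wave d k := lp.single 2 n (EuclideanSpace.single i (1 : ℂ))

theorem norm_pointWave (n : Site d) (i : Fin k) : ‖pointWave n i‖ = 1 := by
  rw [pointWave, lp.norm_single (by norm_num), PiLp.norm_single, norm_one]

theorem norm_kernel_le_norm_apply (T : Wave d k →L[ℂ] Wave d k) (m n : Site d) (i j : Fin k) :
    ‖kernel T m n i j‖ ≤ ‖T (pointWave n j) m‖ :=
  PiLp.norm_apply_le (T (pointWave n j) m) i

theorem norm_apply_pointWave_le (T : Wave d k →L[ℂ] Wave d k) (m n : Site d) (j : Fin k) :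
    ‖T (pointWave n j) m‖ ≤ ‖T‖ := by
  refine (lp.norm_apply_le_norm two_ne_zero _ m).trans ?_
  simpa only [norm_pointWave, mul_one] using T.le_opNorm (pointWave n j)

theorem norm_kernel_le (T : Wave d k →L[ℂ] Wave d k) (m n : Site d) (i j : Fin k) :
    ‖kernel T m n i j‖ ≤ ‖T‖ :=
  (norm_kernel_le_norm_apply T m n i j).trans (norm_apply_pointWave_le T m n j)

theorem kernel_self_eq_inner (T : Wave d k →L[ℂ] Wave d k) (n : Site d) (i : Fin k) :
    kernel T n n i i = ⟪(lp.single 2 n (EuclideanSpace.single i (1 : ℂ)) : Wave d k),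
      T (lp.single 2 n (EuclideanSpace.single i (1 : ℂ)))⟫_ℂ := by
  rw [lp.inner_single_left, EuclideanSpace.inner_single_left]
  simp [kernel]

theorem shift_symm_single (a n : Site d) (φ : Spin k) :
    (shift a).symm (lp.single 2 n φ : Wave d k) = lp.single 2 (n + a) φ := by
  refine lp.ext (funext fun y => ?_)
  rw [shift_symm_apply]
  by_cases h : y = n + a
  · subst h
    rw [add_sub_cancel_right, lp.single_apply_self, lp.single_apply_self]
  · rw [lp.single_apply_ne _ _ _ h, lp.single_apply_ne _ _ _ (mt sub_eq_iff_eq_add.1 h)]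

theorem kernel_shift (T : Wave d k →L[ℂ] Wave d k) (a m n : Site d) :
    kernel ((shift a).conjStarAlgEquiv T) m n = kernel T (m + a) (n + a) := by
  ext i j
  simp only [kernel, Matrix.of_apply, LinearIsometryEquiv.conjStarAlgEquiv_apply_apply,
    shift_apply, shift_symm_single]

theorem kernel_self_im_of_isSelfAdjoint {T : Wave d k →L[ℂ] Wave d k} (hT : IsSelfAdjoint T)
    (n : Site d) (i : Fin k) : (kernel T n n i i).im = 0 := by
  rw [← Complex.conj_eq_iff_im, kernel_self_eq_inner, inner_conj_symm]
  exact hT.isSymmetric _ _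

theorem kernel_self_re_nonneg {T : Wave d k →L[ℂ] Wave d k} (hT : 0 ≤ T) (n : Site d)
    (i : Fin k) : 0 ≤ (kernel T n n i i).re := by
  rw [kernel_self_eq_inner]
  exact ((ContinuousLinearMap.nonneg_iff_isPositive T).1 hT).re_inner_nonneg_right _

end Kernel

/-! ### Regular laws with finite moments -/

section Law

/-- A law on the line that is `α`-regular and has a finite `q`-th moment. The bounds are stated in
`ℝ≥0∞`, where they carry no integrability side condition. -/
structure TameLaw (α q C₁ C₂ : ℝ) (μ : Measure ℝ) : Prop where
  regular : ∀ ε : ℝ, 0 < ε → ∀ t : ℝ, μ (Set.Icc (t - ε) (t + ε)) ≤ ENNReal.ofReal (C₁ * ε ^ α)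
  moment : ∫⁻ x, ENNReal.ofReal (|x| ^ q) ∂μ ≤ ENNReal.ofReal C₂

theorem TameLaw.of_bounds {α q CA1 CA2 : ℝ} {μ : Measure ℝ} [IsFiniteMeasure μ]
    (hreg : IsRegularWith α CA1 μ) (hmom : HasMomentBound q CA2 μ) :
    TameLaw α q (max CA1 1) (max CA2 1) μ where
  regular ε hε t := by
    rw [← ENNReal.ofReal_toReal (measure_ne_top μ _)]
    refine ENNReal.ofReal_le_ofReal ((hreg ε hε t).trans ?_)
    gcongr
    exact le_max_left _ _
  moment := by
    rw [← ofReal_integral_eq_lintegral_ofReal hmom.1 (ae_of_all _ fun x => by positivity)]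
    exact ENNReal.ofReal_le_ofReal (hmom.2.trans (le_max_left _ _))

theorem tendsto_const_mul_rpow_nhds_zero (C : ℝ) {α : ℝ} (hα : 0 < α) :
    Tendsto (fun ε : ℝ => C * ε ^ α) (𝓝 0) (𝓝 0) := by
  simpa [Real.zero_rpow hα.ne'] using
    (Real.continuousAt_rpow_const 0 α (Or.inr hα.le)).tendsto.const_mul C

variable {α q C₁ C₂ : ℝ} {μ : Measure ℝ}

theorem TameLaw.measure_singleton (hμ : TameLaw α q C₁ C₂ μ) (hα : 0 < α) (a : ℝ) :
    μ {a} = 0 := by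
  have hlim : Tendsto (fun ε : ℝ => ENNReal.ofReal (C₁ * ε ^ α)) (𝓝[>] 0) (𝓝 0) := by
    simpa using ENNReal.tendsto_ofReal
      ((tendsto_const_mul_rpow_nhds_zero C₁ hα).mono_left nhdsWithin_le_nhds)
  refine le_antisymm (ge_of_tendsto hlim ?_) zero_le
  filter_upwards [self_mem_nhdsWithin] with ε (hε : 0 < ε)
  refine (measure_mono ?_).trans (hμ.regular ε hε a)
  rw [Set.singleton_subset_iff]
  constructor <;> linarith

theorem four_mul_abs_add_two_rpow_le (hq : 0 ≤ q) (x : ℝ) :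
    (4 * |x| + 2) ^ q ≤ 4 ^ q + 8 ^ q * |x| ^ q := by
  rcases le_total (4 * |x|) 2 with hx | hx
  · have hle : (4 * |x| + 2) ^ q ≤ 4 ^ q := by
      gcongr
      linarith
    exact hle.trans (le_add_of_nonneg_right (by positivity))
  · have hle : (4 * |x| + 2) ^ q ≤ (8 * |x|) ^ q := by
      gcongr
      linarith
    rw [Real.mul_rpow (by norm_num) (abs_nonneg x)] at hle
    exact hle.trans (le_add_of_nonneg_left (by positivity))

theorem TameLaw.moment_affine (hμ : TameLaw α q C₁ C₂ μ) [IsProbabilityMeasure μ] (hC₂ : 0 ≤ C₂)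
    (hq : 0 ≤ q) :
    ∫⁻ x, ENNReal.ofReal ((4 * |x| + 2) ^ q) ∂μ ≤ ENNReal.ofReal (4 ^ q + 8 ^ q * C₂) := by
  have hpt (x : ℝ) : ENNReal.ofReal ((4 * |x| + 2) ^ q) ≤
      ENNReal.ofReal (4 ^ q) + ENNReal.ofReal (8 ^ q) * ENNReal.ofReal (|x| ^ q) := by
    rw [← ENNReal.ofReal_mul (by positivity), ← ENNReal.ofReal_add (by positivity) (by positivity)]
    exact ENNReal.ofReal_le_ofReal (four_mul_abs_add_two_rpow_le hq x)
  refine (lintegral_mono hpt).trans ?_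
  rw [lintegral_add_left measurable_const, lintegral_const, measure_univ, mul_one,
    lintegral_const_mul _ (by fun_prop), ENNReal.ofReal_add (by positivity) (by positivity),
    ENNReal.ofReal_mul (by positivity)]
  gcongr
  exact hμ.moment

theorem TameLaw.measure_le_four_mul_abs_add_two (hμ : TameLaw α q C₁ C₂ μ)
    [IsProbabilityMeasure μ] (hC₂ : 0 ≤ C₂) (hq : 0 ≤ q) {L : ℝ} (hL : 0 ≤ L) :
    ENNReal.ofReal (L ^ q) * μ {x | L ≤ 4 * |x| + 2} ≤ ENNReal.ofReal (4 ^ q + 8 ^ q * C₂) := by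
  refine le_trans ?_ (hμ.moment_affine hC₂ hq)
  refine le_trans ?_ (mul_meas_ge_le_lintegral (by fun_prop) (ENNReal.ofReal (L ^ q)))
  gcongr
  rename_i x
  intro (hx : L ≤ 4 * |x| + 2)
  exact ENNReal.ofReal_le_ofReal (by gcongr)

theorem ofReal_abs_rpow_neg_le_tsum_dyadic {t η a x : ℝ} (ht : 0 < t) (hη : 0 < η)
    (hx : x ∈ Set.Icc (a - η) (a + η)) :
    ENNReal.ofReal (|x - a| ^ (-t)) ≤
      ∑' n : ℕ, (Set.Icc (a - η * (1 / 2) ^ n) (a + η * (1 / 2) ^ n)).indicator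
        (fun _ => ENNReal.ofReal ((η * (1 / 2) ^ n / 2) ^ (-t))) x := by
  rcases eq_or_ne x a with rfl | hxa
  · rw [sub_self, abs_zero, Real.zero_rpow (by linarith), ENNReal.ofReal_zero]
    exact zero_le
  have hpos : 0 < |x - a| := abs_pos.2 (sub_ne_zero.2 hxa)
  have hle : |x - a| ≤ η := abs_le.2 ⟨by linarith [hx.1], by linarith [hx.2]⟩
  obtain ⟨n, hlow, hupp⟩ := exists_nat_pow_near_of_lt_one (x := |x - a| / η) (y := (1 / 2 : ℝ))
    (div_pos hpos hη) ((div_le_one hη).2 hle) (by norm_num) (by norm_num)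
  rw [lt_div_iff₀ hη, pow_succ] at hlow
  rw [div_le_iff₀ hη, mul_comm, abs_le] at hupp
  have hmem : x ∈ Set.Icc (a - η * (1 / 2) ^ n) (a + η * (1 / 2) ^ n) :=
    ⟨by linarith [hupp.1], by linarith [hupp.2]⟩
  refine le_trans ?_ (ENNReal.le_tsum n)
  rw [Set.indicator_of_mem hmem]
  refine ENNReal.ofReal_le_ofReal
    (Real.rpow_le_rpow_of_nonpos (by positivity) ?_ (by linarith))
  linarith

theorem dyadic_rpow_neg_mul_rpow {η : ℝ} (hη : 0 < η) (t α : ℝ) (n : ℕ) :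
    (η * (1 / 2) ^ n / 2) ^ (-t) * (η * (1 / 2) ^ n) ^ α =
      2 ^ t * η ^ (α - t) * ((2 : ℝ) ^ (t - α)) ^ n := by
  have hscale : 0 < η * (1 / 2) ^ n := by positivity
  have hpow : ((1 / 2 : ℝ) ^ n) ^ (α - t) = ((2 : ℝ) ^ (t - α)) ^ n := by
    rw [← Real.rpow_natCast, ← Real.rpow_natCast, ← Real.rpow_mul (by norm_num),
      ← Real.rpow_mul (by norm_num), one_div, Real.inv_rpow (by norm_num),
      ← Real.rpow_neg (by norm_num)]
    ring_nf
  calc (η * (1 / 2) ^ n / 2) ^ (-t) * (η * (1 / 2) ^ n) ^ α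
      = 2 ^ t * ((η * (1 / 2) ^ n) ^ (-t) * (η * (1 / 2) ^ n) ^ α) := by
        rw [Real.div_rpow hscale.le (by norm_num), Real.rpow_neg (by norm_num : (0 : ℝ) ≤ 2)]
        field_simp
    _ = 2 ^ t * η ^ (α - t) * ((2 : ℝ) ^ (t - α)) ^ n := by
        rw [← Real.rpow_add hscale, neg_add_eq_sub, Real.mul_rpow hη.le (by positivity), hpow,
          mul_assoc]

theorem TameLaw.setLIntegral_abs_rpow_neg_le (hμ : TameLaw α q C₁ C₂ μ) (hC₁ : 0 ≤ C₁) {t : ℝ}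
    (ht : 0 < t) (htα : t < α) (a : ℝ) {η : ℝ} (hη : 0 < η) :
    ∫⁻ x in Set.Icc (a - η) (a + η), ENNReal.ofReal (|x - a| ^ (-t)) ∂μ ≤
      ENNReal.ofReal (C₁ * 2 ^ t * (1 - 2 ^ (t - α))⁻¹ * η ^ (α - t)) := by
  let F : ℕ → ℝ → ℝ≥0∞ := fun n =>
    (Set.Icc (a - η * (1 / 2) ^ n) (a + η * (1 / 2) ^ n)).indicator
      fun _ => ENNReal.ofReal ((η * (1 / 2) ^ n / 2) ^ (-t))
  have hscale (n : ℕ) : ∫⁻ x, F n x ∂μ ≤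
      ENNReal.ofReal (C₁ * 2 ^ t * η ^ (α - t) * ((2 : ℝ) ^ (t - α)) ^ n) := by
    rw [lintegral_indicator_const measurableSet_Icc]
    refine (mul_le_mul_right (hμ.regular _ (by positivity) a) _).trans_eq ?_
    rw [← ENNReal.ofReal_mul (by positivity)]
    congr 1
    linear_combination C₁ * dyadic_rpow_neg_mul_rpow hη t α n
  have hgeo : (2 : ℝ) ^ (t - α) < 1 := Real.rpow_lt_one_of_one_lt_of_neg (by norm_num) (by linarith)
  calc ∫⁻ x in Set.Icc (a - η) (a + η), ENNReal.ofReal (|x - a| ^ (-t)) ∂μ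
      ≤ ∫⁻ x in Set.Icc (a - η) (a + η), ∑' n, F n x ∂μ :=
        setLIntegral_mono' measurableSet_Icc fun x hx =>
          ofReal_abs_rpow_neg_le_tsum_dyadic ht hη hx
    _ ≤ ∫⁻ x, ∑' n, F n x ∂μ := setLIntegral_le_lintegral _ _
    _ = ∑' n, ∫⁻ x, F n x ∂μ := lintegral_tsum fun n =>
        (measurable_const.indicator measurableSet_Icc).aemeasurable
    _ ≤ ∑' n, ENNReal.ofReal ((C₁ * 2 ^ t * η ^ (α - t)) * ((2 : ℝ) ^ (t - α)) ^ n) :=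
        ENNReal.tsum_le_tsum hscale
    _ = ENNReal.ofReal (C₁ * 2 ^ t * (1 - 2 ^ (t - α))⁻¹ * η ^ (α - t)) := by
        rw [← ENNReal.ofReal_tsum_of_nonneg (fun n => by positivity)
          ((summable_geometric_of_lt_one (by positivity) hgeo).mul_left _), tsum_mul_left,
          tsum_geometric_of_lt_one (by positivity) hgeo]
        ring_nf

/-- If `x` is far from `r` the quotient is at most `4`; otherwise `x` is comparable to `r`, and
either `x` is within `η` of `re r` or the quotient is at most `(1 + ‖r‖) / η`. -/
theorem ofReal_div_norm_sub_rpow_le (r : ℂ) {t η x : ℝ} (ht : 0 ≤ t) (hη : 0 < η)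
    (hx : x ≠ r.re) :
    ENNReal.ofReal (((1 + ‖r‖) / ‖(x : ℂ) - r‖) ^ t) ≤ ENNReal.ofReal (4 ^ t) +
      {x : ℝ | 1 + ‖r‖ ≤ 4 * |x| + 2}.indicator
        (fun _ => ENNReal.ofReal (((1 + ‖r‖) / η) ^ t)) x +
      ENNReal.ofReal ((1 + ‖r‖) ^ t) * (Set.Icc (r.re - η) (r.re + η)).indicator
        (fun x => ENNReal.ofReal (|x - r.re| ^ (-t))) x := by
  have hxa : 0 < |x - r.re| := abs_pos.2 (sub_ne_zero.2 hx)
  have hre : |x - r.re| ≤ ‖(x : ℂ) - r‖ := by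
    simpa using Complex.abs_re_le_norm ((x : ℂ) - r)
  have hpos : 0 < ‖(x : ℂ) - r‖ := hxa.trans_le hre
  by_cases hfar : (1 + ‖r‖) / 4 ≤ ‖(x : ℂ) - r‖
  · refine le_trans (ENNReal.ofReal_le_ofReal ?_) (le_add_right (le_add_right le_rfl))
    gcongr
    rw [div_le_iff₀ hpos]
    linarith
  by_cases hnear : |x - r.re| ≤ η
  · have hmem : x ∈ Set.Icc (r.re - η) (r.re + η) := by
      rw [abs_le] at hnear
      constructor <;> linarith [hnear.1, hnear.2]
    refine le_trans ?_ (le_add_left le_rfl)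
    rw [Set.indicator_of_mem hmem, ← ENNReal.ofReal_mul (by positivity)]
    refine ENNReal.ofReal_le_ofReal ?_
    rw [Real.div_rpow (by positivity) hpos.le, div_eq_mul_inv, ← Real.rpow_neg hpos.le]
    exact mul_le_mul_of_nonneg_left
      (Real.rpow_le_rpow_of_nonpos hxa hre (by linarith)) (by positivity)
  · push Not at hfar hnear
    have hmem : x ∈ {x : ℝ | 1 + ‖r‖ ≤ 4 * |x| + 2} := by
      have htri : ‖r‖ ≤ |x| + ‖(x : ℂ) - r‖ := by
        simpa using norm_sub_le (x : ℂ) ((x : ℂ) - r)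
      change 1 + ‖r‖ ≤ 4 * |x| + 2
      linarith [abs_nonneg x]
    refine le_trans ?_ (le_add_right (le_add_left le_rfl))
    rw [Set.indicator_of_mem hmem]
    refine ENNReal.ofReal_le_ofReal ?_
    gcongr
    linarith

theorem div_rpow_neg_div_rpow {L : ℝ} (hL : 0 < L) (hα : 0 < α) (hq : 0 < q) :
    (L / L ^ (-(q / α))) ^ (α * q / (α + q)) = L ^ q := by
  rw [Real.rpow_neg hL.le, div_inv_eq_mul, ← Real.rpow_one_add' hL.le (by positivity),
    ← Real.rpow_mul hL.le]
  congr 1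
  field_simp

theorem rpow_mul_rpow_neg_div_rpow {L : ℝ} (hL : 0 < L) (hα : 0 < α) (hq : 0 < q) :
    L ^ (α * q / (α + q)) * (L ^ (-(q / α))) ^ (α - α * q / (α + q)) = 1 := by
  rw [← Real.rpow_mul hL.le, ← Real.rpow_add hL]
  convert Real.rpow_zero L using 2
  field_simp
  ring

theorem mul_div_add_lt_left (hα : 0 < α) (hq : 0 < q) : α * q / (α + q) < α := by
  rw [div_lt_iff₀ (by positivity)]
  nlinarith

theorem TameLaw.lintegral_div_norm_sub_rpow_le (hμ : TameLaw α q C₁ C₂ μ)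
    [IsProbabilityMeasure μ] (hC₁ : 0 ≤ C₁) (hC₂ : 0 ≤ C₂) (hα : 0 < α) (hq : 0 < q) (r : ℂ) :
    ∫⁻ x : ℝ, ENNReal.ofReal (((1 + ‖r‖) / ‖(x : ℂ) - r‖) ^ (α * q / (α + q))) ∂μ ≤
      ENNReal.ofReal (4 ^ (α * q / (α + q)) + (4 ^ q + 8 ^ q * C₂) +
        C₁ * 2 ^ (α * q / (α + q)) * (1 - 2 ^ (α * q / (α + q) - α))⁻¹) := by
  have htα := mul_div_add_lt_left hα hq
  have ht : 0 < α * q / (α + q) := by positivity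
  have hL : 0 < 1 + ‖r‖ := by positivity
  -- the radius balancing the tail term against the singular one
  have hη : 0 < (1 + ‖r‖) ^ (-(q / α)) := by positivity
  have hne : ∀ᵐ x : ℝ ∂μ, x ≠ r.re := compl_mem_ae_iff.2 (hμ.measure_singleton hα r.re)
  have hB : MeasurableSet {x : ℝ | 1 + ‖r‖ ≤ 4 * |x| + 2} :=
    measurableSet_le measurable_const (by fun_prop)
  have hgeo : 0 < 1 - (2 : ℝ) ^ (α * q / (α + q) - α) :=
    sub_pos.2 (Real.rpow_lt_one_of_one_lt_of_neg (by norm_num) (by linarith))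
  refine (lintegral_mono_ae (hne.mono fun x hx =>
    ofReal_div_norm_sub_rpow_le r ht.le hη hx)).trans ?_
  rw [lintegral_add_left (by fun_prop (disch := assumption)),
    lintegral_add_left measurable_const, lintegral_const, measure_univ, mul_one,
    lintegral_indicator_const hB, lintegral_const_mul' _ _ ENNReal.ofReal_ne_top,
    lintegral_indicator measurableSet_Icc, div_rpow_neg_div_rpow hL hα hq,
    ENNReal.ofReal_add (by positivity) (by positivity),
    ENNReal.ofReal_add (by positivity) (by positivity)]
  refine add_le_add (add_le_add le_rfl
    (hμ.measure_le_four_mul_abs_add_two hC₂ hq.le hL.le)) ?_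
  refine (mul_le_mul_right (hμ.setLIntegral_abs_rpow_neg_le hC₁ ht htα r.re hη) _).trans ?_
  rw [← ENNReal.ofReal_mul (by positivity), mul_left_comm, rpow_mul_rpow_neg_div_rpow hL hα hq,
    mul_one]

theorem abs_measureReal_Iic_sub_le (ρ : Measure ℝ) [IsFiniteMeasure ρ] (x y : ℝ) :
    |ρ.real (Set.Iic y) - ρ.real (Set.Iic x)| ≤
      ρ.real (Set.Icc (x - |y - x|) (x + |y - x|)) := by
  have hyx : Set.Iic y ⊆ Set.Iic x ∪ Set.Icc (x - |y - x|) (x + |y - x|) := by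
    intro u (hu : u ≤ y)
    rcases le_or_gt u x with hux | hux
    · exact Or.inl hux
    · exact Or.inr ⟨by linarith [abs_nonneg (y - x)], by linarith [le_abs_self (y - x)]⟩
  have hxy : Set.Iic x ⊆ Set.Iic y ∪ Set.Icc (x - |y - x|) (x + |y - x|) := by
    intro u (hu : u ≤ x)
    rcases le_or_gt u y with huy | huy
    · exact Or.inl huy
    · exact Or.inr ⟨by linarith [neg_abs_le (y - x)], by linarith [abs_nonneg (y - x)]⟩
  have hle := (measureReal_mono hyx (μ := ρ)).trans (measureReal_union_le _ _)
  have hge := (measureReal_mono hxy (μ := ρ)).trans (measureReal_union_le _ _)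
  rw [abs_le]
  constructor <;> linarith

theorem TameLaw.hasDerivAt_cdf_zero (hμ : TameLaw α q C₁ C₂ μ) [IsProbabilityMeasure μ]
    (hC₁ : 0 ≤ C₁) (hα : 1 < α) (x : ℝ) : HasDerivAt (cdf μ) 0 x := by
  rw [hasDerivAt_iff_isLittleO, Asymptotics.isLittleO_iff]
  intro c hc
  have hlim : Tendsto (fun y : ℝ => C₁ * |y - x| ^ (α - 1)) (𝓝 x) (𝓝 0) := by
    have habs : Tendsto (fun y : ℝ => |y - x|) (𝓝 x) (𝓝 0) := by
      simpa using (by fun_prop : Continuous fun y : ℝ => |y - x|).tendsto x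
    exact (tendsto_const_mul_rpow_nhds_zero C₁ (sub_pos.2 hα)).comp habs
  filter_upwards [hlim.eventually_le_const hc] with y hy
  rw [smul_zero, sub_zero, cdf_eq_real, cdf_eq_real, Real.norm_eq_abs, Real.norm_eq_abs]
  rcases eq_or_ne y x with rfl | hyx
  · simp
  have hpos : 0 < |y - x| := abs_pos.2 (sub_ne_zero.2 hyx)
  calc |μ.real (Set.Iic y) - μ.real (Set.Iic x)|
      ≤ μ.real (Set.Icc (x - |y - x|) (x + |y - x|)) := abs_measureReal_Iic_sub_le μ x y
    _ ≤ C₁ * |y - x| ^ α :=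
        ENNReal.toReal_le_of_le_ofReal (by positivity) (hμ.regular _ hpos x)
    _ = C₁ * |y - x| ^ (α - 1) * |y - x| := by
        rw [Real.rpow_sub_one hpos.ne', mul_assoc, div_mul_cancel₀ _ hpos.ne']
    _ ≤ c * |y - x| := by gcongr

theorem TameLaw.exponent_le_one (hμ : TameLaw α q C₁ C₂ μ) [IsProbabilityMeasure μ]
    (hC₁ : 0 ≤ C₁) : α ≤ 1 := by
  by_contra! hα
  have hconst (x : ℝ) : cdf μ x = cdf μ 0 :=
    is_const_of_deriv_eq_zero (fun y => (hμ.hasDerivAt_cdf_zero hC₁ hα y).differentiableAt)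
      (fun y => (hμ.hasDerivAt_cdf_zero hC₁ hα y).deriv) x 0
  have hbot := tendsto_nhds_unique (tendsto_cdf_atBot μ)
    (tendsto_const_nhds.congr fun x => (hconst x).symm)
  have htop := tendsto_nhds_unique (tendsto_cdf_atTop μ)
    (tendsto_const_nhds.congr fun x => (hconst x).symm)
  exact zero_ne_one (hbot.trans htop.symm)

end Law

/-! ### Decoupling for rational functions -/

section Rational

open Polynomial

theorem multiset_prod_map_le_prod_map_mul_pow {ι : Type*} {S : Multiset ι} {f g : ι → ℝ} {b : ℝ}
    {n : ℕ} (hf : ∀ i ∈ S, 0 ≤ f i) (hg : ∀ i ∈ S, 0 ≤ g i) (hfg : ∀ i ∈ S, f i ≤ g i * b)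
    (hb : 1 ≤ b) (hn : S.card ≤ n) : (S.map f).prod ≤ (S.map g).prod * b ^ n := by
  calc (S.map f).prod ≤ (S.map fun i => g i * b).prod := Multiset.prod_map_le_prod_map₀ _ _ hf hfg
    _ = (S.map g).prod * b ^ S.card := by
        rw [Multiset.prod_map_mul, Multiset.map_const', Multiset.prod_replicate]
    _ ≤ (S.map g).prod * b ^ n :=
        mul_le_mul_of_nonneg_left (pow_le_pow_right₀ hb hn) (Multiset.prod_map_nonneg hg)

/-- The size of a polynomial, measured by its leading coefficient and its roots. It is comparable
to `‖P.eval x‖` whenever `x` is bounded and bounded away from the roots. -/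
def rootHeight (P : ℂ[X]) : ℝ :=
  ‖P.leadingCoeff‖ * (P.roots.map fun r => 1 + ‖r‖).prod

theorem norm_eval_eq_mul_prod_roots (P : ℂ[X]) (x : ℂ) :
    ‖P.eval x‖ = ‖P.leadingCoeff‖ * (P.roots.map fun r => ‖x - r‖).prod := by
  rw [(IsAlgClosed.splits P).eval_eq_prod_roots, norm_mul]
  congr 1
  change normHom (P.roots.map fun r => x - r).prod = _
  rw [map_multiset_prod, Multiset.map_map]
  rfl

theorem prod_one_add_norm_roots_pos (P : ℂ[X]) : 0 < (P.roots.map fun r => 1 + ‖r‖).prod := by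
  refine Multiset.prod_pos fun b hb => ?_
  obtain ⟨r, -, rfl⟩ := Multiset.mem_map.1 hb
  positivity

theorem rootHeight_nonneg (P : ℂ[X]) : 0 ≤ rootHeight P :=
  mul_nonneg (norm_nonneg _) (prod_one_add_norm_roots_pos P).le

theorem rootHeight_pos {P : ℂ[X]} (hP : P ≠ 0) : 0 < rootHeight P :=
  mul_pos (norm_pos_iff.2 (leadingCoeff_ne_zero.2 hP)) (prod_one_add_norm_roots_pos P)

theorem norm_eval_le_rootHeight {P : ℂ[X]} {k : ℕ} (hk : P.natDegree ≤ k) (x : ℝ) :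
    ‖P.eval (x : ℂ)‖ ≤ rootHeight P * (1 + |x|) ^ k := by
  rw [norm_eval_eq_mul_prod_roots, rootHeight, mul_assoc]
  refine mul_le_mul_of_nonneg_left (multiset_prod_map_le_prod_map_mul_pow
    (fun r _ => norm_nonneg _) (fun r _ => by positivity) (fun r _ => ?_)
    (le_add_of_nonneg_right (abs_nonneg x)) ((card_roots' P).trans hk)) (norm_nonneg _)
  have htri : ‖(x : ℂ) - r‖ ≤ |x| + ‖r‖ := by
    simpa only [Complex.norm_real, Real.norm_eq_abs] using norm_sub_le (x : ℂ) r
  nlinarith [norm_nonneg r, abs_nonneg x]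

theorem inv_norm_eval_eq {P : ℂ[X]} (hP : P ≠ 0) (x : ℂ) :
    ‖P.eval x‖⁻¹ = (rootHeight P)⁻¹ * (P.roots.map fun r => (1 + ‖r‖) / ‖x - r‖).prod := by
  have hlead : ‖P.leadingCoeff‖ ≠ 0 := norm_ne_zero_iff.2 (leadingCoeff_ne_zero.2 hP)
  have hprod := (prod_one_add_norm_roots_pos P).ne'
  rw [Multiset.prod_map_div, norm_eval_eq_mul_prod_roots, rootHeight, mul_inv, mul_inv]
  field_simp

/-- The reals that are bounded by `T` and stay at distance at least `c` from the points of `R`. -/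
def goodSet (T c : ℝ) (R : Multiset ℂ) : Set ℝ := {x | |x| ≤ T ∧ ∀ r ∈ R, c ≤ ‖(x : ℂ) - r‖}

theorem measurableSet_goodSet (T c : ℝ) (R : Multiset ℂ) : MeasurableSet (goodSet T c R) := by
  refine IsClosed.measurableSet ?_
  rw [goodSet, Set.ofPred_and]
  refine (isClosed_le (by fun_prop) continuous_const).inter ?_
  simp only [Set.ofPred_forall]
  refine isClosed_iInter fun r => isClosed_iInter fun _ => ?_
  exact isClosed_le continuous_const (by fun_prop)

theorem goodSet_anti {T c : ℝ} {R R' : Multiset ℂ} (h : R ≤ R') :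
    goodSet T c R' ⊆ goodSet T c R :=
  fun _ hx => ⟨hx.1, fun r hr => hx.2 r (Multiset.mem_of_le h hr)⟩

theorem rootHeight_le_of_mem_goodSet {P : ℂ[X]} {k : ℕ} (hk : P.natDegree ≤ k) {T c : ℝ}
    (hT : 0 ≤ T) (hc : 0 < c) {x : ℝ} (hx : x ∈ goodSet T c P.roots) :
    rootHeight P ≤ ‖P.eval (x : ℂ)‖ * ((1 + T) / c + 1) ^ k := by
  rw [norm_eval_eq_mul_prod_roots, rootHeight, mul_assoc]
  refine mul_le_mul_of_nonneg_left (multiset_prod_map_le_prod_map_mul_pow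
    (fun r _ => by positivity) (fun r _ => norm_nonneg _) (fun r hr => ?_)
    (le_add_of_nonneg_left (by positivity)) ((card_roots' P).trans hk)) (norm_nonneg _)
  have htri : ‖r‖ ≤ |x| + ‖(x : ℂ) - r‖ := by
    simpa using norm_sub_le (x : ℂ) ((x : ℂ) - r)
  have hfar : 1 + T ≤ ‖(x : ℂ) - r‖ * ((1 + T) / c) := by
    rw [mul_div_left_comm]
    exact le_mul_of_one_le_right (by positivity) ((one_le_div hc).2 (hx.2 r hr))
  linarith [hx.1]

theorem rootHeight_div_le_of_mem_goodSet {P Q : ℂ[X]} {k : ℕ} (hP : P.natDegree ≤ k)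
    (hQ : Q.natDegree ≤ k) (hQ0 : Q ≠ 0) {T c : ℝ} (hT : 0 ≤ T) (hc : 0 < c) {x : ℝ}
    (hxP : x ∈ goodSet T c P.roots) (hxQ : x ∈ goodSet T c Q.roots) :
    rootHeight P / rootHeight Q / (((1 + T) / c + 1) ^ k * (1 + T) ^ k) ≤
      ‖P.eval (x : ℂ)‖ / ‖Q.eval (x : ℂ)‖ := by
  have hheight := rootHeight_pos hQ0
  have hQpos : 0 < ‖Q.eval (x : ℂ)‖ := pos_of_mul_pos_left
    (hheight.trans_le (rootHeight_le_of_mem_goodSet hQ hT hc hxQ)) (by positivity)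
  have hQle : ‖Q.eval (x : ℂ)‖ ≤ rootHeight Q * (1 + T) ^ k := by
    refine (norm_eval_le_rootHeight hQ x).trans ?_
    gcongr
    exact hxQ.1
  rw [div_div, div_le_div_iff₀ (by positivity) hQpos]
  calc rootHeight P * ‖Q.eval (x : ℂ)‖
      ≤ (‖P.eval (x : ℂ)‖ * ((1 + T) / c + 1) ^ k) * (rootHeight Q * (1 + T) ^ k) := by
        gcongr
        exact rootHeight_le_of_mem_goodSet hP hT hc hxP
    _ = ‖P.eval (x : ℂ)‖ * (rootHeight Q * (((1 + T) / c + 1) ^ k * (1 + T) ^ k)) := by ring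

variable {α q C₁ C₂ : ℝ} {μ : Measure ℝ}

theorem TameLaw.measure_near_le (hμ : TameLaw α q C₁ C₂ μ) {c : ℝ} (hc : 0 < c)
    (R : Multiset ℂ) : μ {x : ℝ | ∃ r ∈ R, ‖(x : ℂ) - r‖ < c} ≤
      R.card * ENNReal.ofReal (C₁ * c ^ α) := by
  induction R using Multiset.induction with
  | empty => simp
  | cons a R ih =>
    have hsub : {x : ℝ | ∃ r ∈ a ::ₘ R, ‖(x : ℂ) - r‖ < c} ⊆
        Set.Icc (a.re - c) (a.re + c) ∪ {x : ℝ | ∃ r ∈ R, ‖(x : ℂ) - r‖ < c} := by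
      rintro x ⟨r, hr, hx⟩
      rcases Multiset.mem_cons.1 hr with rfl | hr
      · have hre := (Complex.abs_re_le_norm ((x : ℂ) - r)).trans hx.le
        rw [Complex.sub_re, Complex.ofReal_re, abs_le] at hre
        exact Or.inl ⟨by linarith [hre.1], by linarith [hre.2]⟩
      · exact Or.inr ⟨r, hr, hx⟩
    refine (measure_mono hsub).trans ((measure_union_le _ _).trans ?_)
    rw [Multiset.card_cons, Nat.cast_add, Nat.cast_one, add_mul, one_mul, add_comm]
    exact add_le_add ih (hμ.regular c hc a.re)

theorem TameLaw.measure_near_le_quarter (hμ : TameLaw α q C₁ C₂ μ) (hα : 0 < α) (hC₁ : 0 ≤ C₁)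
    {N : ℕ} {R : Multiset ℂ} (hR : R.card ≤ N) :
    μ {x : ℝ | ∃ r ∈ R, ‖(x : ℂ) - r‖ < (4 * (N * C₁ + 1))⁻¹ ^ α⁻¹} ≤ ENNReal.ofReal (1 / 4) := by
  refine (hμ.measure_near_le (by positivity) R).trans ?_
  rw [Real.rpow_inv_rpow (by positivity) hα.ne', ← ENNReal.ofReal_natCast,
    ← ENNReal.ofReal_mul (by positivity)]
  refine ENNReal.ofReal_le_ofReal ?_
  calc (R.card : ℝ) * (C₁ * (4 * (N * C₁ + 1))⁻¹) ≤ N * (C₁ * (4 * (N * C₁ + 1))⁻¹) := by gcongr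
    _ ≤ 1 / 4 := by
      rw [← mul_assoc, ← div_eq_mul_inv, div_le_iff₀ (by positivity)]
      linarith

theorem TameLaw.measure_le_abs_le_quarter (hμ : TameLaw α q C₁ C₂ μ) (hq : 0 < q)
    (hC₂ : 0 ≤ C₂) :
    μ {x : ℝ | (4 * C₂ + 1) ^ q⁻¹ ≤ |x|} ≤ ENNReal.ofReal (1 / 4) := by
  have hmarkov : ENNReal.ofReal (4 * C₂ + 1) * μ {x : ℝ | (4 * C₂ + 1) ^ q⁻¹ ≤ |x|} ≤
      ENNReal.ofReal C₂ := by
    refine le_trans ?_ ((mul_meas_ge_le_lintegral (by fun_prop)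
      (ENNReal.ofReal (4 * C₂ + 1))).trans hμ.moment)
    gcongr with x
    intro hx
    exact ENNReal.ofReal_le_ofReal
      ((Real.rpow_inv_le_iff_of_pos (by positivity) (abs_nonneg x) hq).1 hx)
  rw [mul_comm, ← ENNReal.le_div_iff_mul_le
    (Or.inl (by rw [ne_eq, ENNReal.ofReal_eq_zero]; linarith)) (Or.inl ENNReal.ofReal_ne_top),
    ← ENNReal.ofReal_div_of_pos (by linarith)] at hmarkov
  refine hmarkov.trans (ENNReal.ofReal_le_ofReal ?_)
  rw [div_le_iff₀ (by linarith)]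
  linarith

theorem half_le_measure_goodSet [IsProbabilityMeasure μ] {T c : ℝ} {R : Multiset ℂ}
    (htail : μ {x : ℝ | T ≤ |x|} ≤ ENNReal.ofReal (1 / 4))
    (hnear : μ {x : ℝ | ∃ r ∈ R, ‖(x : ℂ) - r‖ < c} ≤ ENNReal.ofReal (1 / 4)) :
    1 / 2 ≤ μ (goodSet T c R) := by
  have hcompl : (goodSet T c R)ᶜ ⊆ {x : ℝ | T ≤ |x|} ∪ {x : ℝ | ∃ r ∈ R, ‖(x : ℂ) - r‖ < c} := by
    intro x hx
    by_contra! hout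
    simp only [Set.mem_union, Set.mem_ofPred_eq, not_or, not_le, not_exists, not_and,
      not_lt] at hout
    exact hx ⟨hout.1.le, hout.2⟩
  have hhalf : μ (goodSet T c R)ᶜ ≤ 1 / 2 := by
    refine (measure_mono hcompl).trans ((measure_union_le _ _).trans
      ((add_le_add htail hnear).trans_eq ?_))
    rw [← ENNReal.ofReal_add (by norm_num) (by norm_num),
      show (1 / 4 + 1 / 4 : ℝ) = 2⁻¹ by norm_num, ENNReal.ofReal_inv_of_pos (by norm_num),
      ENNReal.ofReal_ofNat, one_div]
  rw [prob_compl_eq_one_sub (measurableSet_goodSet T c R), tsub_le_iff_left] at hhalf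
  refine (ENNReal.add_le_add_iff_right (by simp : (1 / 2 : ℝ≥0∞) ≠ ∞)).1 ?_
  rwa [ENNReal.add_halves]

theorem exists_half_le_measure_goodSet (hα : 0 < α) (hq : 0 < q) (hC₁ : 0 ≤ C₁) (hC₂ : 0 ≤ C₂)
    (N : ℕ) :
    ∃ T c : ℝ, 1 ≤ T ∧ 0 < c ∧ c ≤ 1 ∧ ∀ (μ : Measure ℝ) [IsProbabilityMeasure μ],
      TameLaw α q C₁ C₂ μ → ∀ R : Multiset ℂ, R.card ≤ N → 1 / 2 ≤ μ (goodSet T c R) := by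
  have hNC : 0 ≤ N * C₁ := by positivity
  refine ⟨(4 * C₂ + 1) ^ q⁻¹, (4 * (N * C₁ + 1))⁻¹ ^ α⁻¹,
    Real.one_le_rpow (by linarith) (by positivity), by positivity,
    Real.rpow_le_one (by positivity) (inv_le_one_of_one_le₀ (by linarith)) (by positivity), ?_⟩
  intro μ _ hμ R hR
  exact half_le_measure_goodSet (hμ.measure_le_abs_le_quarter hq hC₂)
    (hμ.measure_near_le_quarter hα hC₁ hR)

theorem rpow_mul_prod_le_one_add_sum {k : ℕ} {q t s a : ℝ} (hq : 0 < q) (ht : 0 < t) (hs : 0 < s)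
    (hst : s * (k / q + k / t) = 1) (ha : 0 ≤ a) {ι : Type*} {S : Multiset ι} (hS : S.card ≤ k)
    {X : ι → ℝ} (hX : ∀ i, 0 ≤ X i) :
    (a ^ k * (S.map X).prod) ^ s ≤ 1 + a ^ q + (S.map fun i => X i ^ t).sum := by
  set m := 1 + a ^ q + (S.map fun i => X i ^ t).sum
  have hterm : ∀ b ∈ S.map fun i => X i ^ t, 0 ≤ b := by
    intro b hb
    obtain ⟨i, -, rfl⟩ := Multiset.mem_map.1 hb
    exact Real.rpow_nonneg (hX i) t
  have hsum := Multiset.sum_nonneg hterm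
  have haq : 0 ≤ a ^ q := by positivity
  have hm1 : 1 ≤ m := by linarith
  have hm0 : 0 < m := by linarith
  have hle_a : a ≤ m ^ q⁻¹ := by
    rw [Real.le_rpow_inv_iff_of_pos ha hm0.le hq]
    linarith
  have hle_X : ∀ i ∈ S, X i ≤ m ^ t⁻¹ := by
    intro i hi
    rw [Real.le_rpow_inv_iff_of_pos (hX i) hm0.le ht]
    linarith [Multiset.single_le_sum hterm _ (Multiset.mem_map_of_mem _ hi)]
  have hle_prod : (S.map X).prod ≤ (m ^ t⁻¹) ^ k := by
    simpa using multiset_prod_map_le_prod_map_mul_pow (g := fun _ => 1) (fun i _ => hX i)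
      (fun _ _ => zero_le_one) (by simpa using hle_X) (Real.one_le_rpow hm1 (by positivity)) hS
  have hprod : 0 ≤ (S.map X).prod := Multiset.prod_map_nonneg fun i _ => hX i
  calc (a ^ k * (S.map X).prod) ^ s ≤ ((m ^ q⁻¹) ^ k * (m ^ t⁻¹) ^ k) ^ s := by gcongr
    _ = m ^ (1 : ℝ) := by
      rw [← Real.rpow_natCast, ← Real.rpow_natCast, ← Real.rpow_mul hm0.le,
        ← Real.rpow_mul hm0.le, ← Real.rpow_add hm0, ← Real.rpow_mul hm0.le, ← hst]
      congr 1
      field_simp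
    _ = m := Real.rpow_one m

theorem lintegral_multiset_sum_le {X : Type*} [MeasurableSpace X] {μ : Measure X} {ι : Type*}
    (S : Multiset ι) {f : ι → X → ℝ} (hf : ∀ i, Measurable (f i)) (hf0 : ∀ i x, 0 ≤ f i x)
    {C : ℝ≥0∞} (h : ∀ i, ∫⁻ x, ENNReal.ofReal (f i x) ∂μ ≤ C) :
    ∫⁻ x, ENNReal.ofReal (S.map fun i => f i x).sum ∂μ ≤ S.card * C := by
  induction S using Multiset.induction with
  | empty => simp
  | cons a S ih =>
    have hS (x : X) : 0 ≤ (S.map fun i => f i x).sum :=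
      Multiset.sum_nonneg fun b hb => by
        obtain ⟨i, -, rfl⟩ := Multiset.mem_map.1 hb
        exact hf0 i x
    simp only [Multiset.map_cons, Multiset.sum_cons, Multiset.card_cons, Nat.cast_add,
      Nat.cast_one, add_mul, one_mul, ENNReal.ofReal_add (hf0 a _) (hS _)]
    rw [lintegral_add_left (hf a).ennreal_ofReal, add_comm]
    exact add_le_add ih (h a)

theorem norm_eval_div_rpow_le {k : ℕ} {q t s : ℝ} (hq : 0 < q) (ht : 0 < t) (hs : 0 < s)
    (hst : s * (k / q + k / t) = 1) {P Q : ℂ[X]} (hP : P.natDegree ≤ k) (hQ : Q.natDegree ≤ k)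
    (hQ0 : Q ≠ 0) (x : ℝ) :
    (‖P.eval (x : ℂ)‖ / ‖Q.eval (x : ℂ)‖) ^ s ≤
      (rootHeight P / rootHeight Q) ^ s * (1 + (1 + |x|) ^ q +
        (Q.roots.map fun r => ((1 + ‖r‖) / ‖(x : ℂ) - r‖) ^ t).sum) := by
  have hheightP := rootHeight_nonneg P
  have hheightQ := rootHeight_nonneg Q
  have hprod : 0 ≤ (Q.roots.map fun r => (1 + ‖r‖) / ‖(x : ℂ) - r‖).prod :=
    Multiset.prod_map_nonneg fun r _ => by positivity
  have hquot : ‖P.eval (x : ℂ)‖ / ‖Q.eval (x : ℂ)‖ ≤ rootHeight P / rootHeight Q *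
      ((1 + |x|) ^ k * (Q.roots.map fun r => (1 + ‖r‖) / ‖(x : ℂ) - r‖).prod) := by
    rw [div_eq_mul_inv, inv_norm_eval_eq hQ0, div_eq_mul_inv, mul_mul_mul_comm]
    gcongr
    exact norm_eval_le_rootHeight hP x
  calc (‖P.eval (x : ℂ)‖ / ‖Q.eval (x : ℂ)‖) ^ s
      ≤ (rootHeight P / rootHeight Q *
          ((1 + |x|) ^ k * (Q.roots.map fun r => (1 + ‖r‖) / ‖(x : ℂ) - r‖).prod)) ^ s := by gcongr
    _ = (rootHeight P / rootHeight Q) ^ s *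
          ((1 + |x|) ^ k * (Q.roots.map fun r => (1 + ‖r‖) / ‖(x : ℂ) - r‖).prod) ^ s :=
        Real.mul_rpow (by positivity) (by positivity)
    _ ≤ _ := by
        gcongr
        exact rpow_mul_prod_le_one_add_sum hq ht hs hst (by positivity)
          ((card_roots' Q).trans hQ) fun r => by positivity

theorem exists_lintegral_norm_eval_div_le (hα : 0 < α) (hq : 0 < q) (hC₁ : 0 ≤ C₁) (hC₂ : 0 ≤ C₂)
    {k : ℕ} {s : ℝ} (hs : 0 < s) (hsk : s * (k * (2 / q + 1 / α)) = 1) :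
    ∃ D : ℝ, 0 < D ∧ ∀ (μ : Measure ℝ) [IsProbabilityMeasure μ], TameLaw α q C₁ C₂ μ →
      ∀ P Q : ℂ[X], P.natDegree ≤ k → Q.natDegree ≤ k → Q ≠ 0 →
        ∫⁻ x : ℝ, ENNReal.ofReal ((‖P.eval (x : ℂ)‖ / ‖Q.eval (x : ℂ)‖) ^ s) ∂μ ≤
          ENNReal.ofReal ((rootHeight P / rootHeight Q) ^ s * D) := by
  set t := α * q / (α + q) with ht_def
  have ht : 0 < t := by positivity
  have hst : s * (k / q + k / t) = 1 := by
    rw [← hsk, ht_def]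
    field_simp
    ring
  have hgeo : 0 < 1 - (2 : ℝ) ^ (t - α) := sub_pos.2 (Real.rpow_lt_one_of_one_lt_of_neg
    (by norm_num) (sub_neg.2 (mul_div_add_lt_left hα hq)))
  set E : ℝ := 4 ^ t + (4 ^ q + 8 ^ q * C₂) + C₁ * 2 ^ t * (1 - 2 ^ (t - α))⁻¹
  refine ⟨1 + (4 ^ q + 8 ^ q * C₂) + k * E, by positivity, ?_⟩
  intro μ _ hμ P Q hP hQ hQ0
  have hratio : 0 ≤ rootHeight P / rootHeight Q :=
    div_nonneg (rootHeight_nonneg P) (rootHeight_nonneg Q)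
  have hpt (x : ℝ) : ENNReal.ofReal ((‖P.eval (x : ℂ)‖ / ‖Q.eval (x : ℂ)‖) ^ s) ≤
      ENNReal.ofReal ((rootHeight P / rootHeight Q) ^ s) *
        (1 + ENNReal.ofReal ((4 * |x| + 2) ^ q) +
          ENNReal.ofReal (Q.roots.map fun r => ((1 + ‖r‖) / ‖(x : ℂ) - r‖) ^ t).sum) := by
    refine (ENNReal.ofReal_le_ofReal
      (norm_eval_div_rpow_le hq ht hs hst hP hQ hQ0 x)).trans ?_
    have haff : (1 + |x|) ^ q ≤ (4 * |x| + 2) ^ q :=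
      Real.rpow_le_rpow (by positivity) (by linarith [abs_nonneg x]) hq.le
    rw [ENNReal.ofReal_mul (by positivity), ← ENNReal.ofReal_one]
    gcongr
    refine ENNReal.ofReal_add_le.trans (add_le_add_left (ENNReal.ofReal_add_le.trans ?_) _)
    gcongr
  refine (lintegral_mono hpt).trans ?_
  rw [lintegral_const_mul' _ _ ENNReal.ofReal_ne_top, lintegral_add_left (by fun_prop),
    lintegral_add_left measurable_const, lintegral_const, measure_univ, mul_one,
    ENNReal.ofReal_mul (by positivity), ENNReal.ofReal_add (by positivity) (by positivity),
    ENNReal.ofReal_add (by positivity) (by positivity), ENNReal.ofReal_one]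
  gcongr
  · exact hμ.moment_affine hC₂ hq.le
  · refine (lintegral_multiset_sum_le Q.roots (fun r => by fun_prop)
      (fun r x => by positivity)
      (fun r => hμ.lintegral_div_norm_sub_rpow_le hC₁ hC₂ hα hq r)).trans ?_
    rw [ENNReal.ofReal_mul (by positivity), ENNReal.ofReal_natCast]
    gcongr
    exact (card_roots' Q).trans hQ

theorem le_setLIntegral_norm_eval_div {P Q : ℂ[X]} {k : ℕ} (hP : P.natDegree ≤ k)
    (hQ : Q.natDegree ≤ k) (hQ0 : Q ≠ 0) {T c : ℝ} (hT : 0 ≤ T) (hc : 0 < c) {s : ℝ}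
    (hs : 0 ≤ s) (R : Multiset ℂ) (hR : 1 / 2 ≤ μ (goodSet T c (R + P.roots + Q.roots))) :
    ENNReal.ofReal ((rootHeight P / rootHeight Q / (((1 + T) / c + 1) ^ k * (1 + T) ^ k)) ^ s) *
        (1 / 2) ≤
      ∫⁻ x : ℝ in goodSet T c R,
        ENNReal.ofReal ((‖P.eval (x : ℂ)‖ / ‖Q.eval (x : ℂ)‖) ^ s) ∂μ := by
  have hratio : 0 ≤ rootHeight P / rootHeight Q :=
    div_nonneg (rootHeight_nonneg P) (rootHeight_nonneg Q)
  refine (mul_le_mul_right hR _).trans ?_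
  rw [← setLIntegral_const]
  refine (setLIntegral_mono' (measurableSet_goodSet _ _ _) fun x hx => ?_).trans
    (lintegral_mono_set (goodSet_anti (by rw [add_assoc]; exact Multiset.le_add_right _ _)))
  refine ENNReal.ofReal_le_ofReal (Real.rpow_le_rpow (by positivity)
    (rootHeight_div_le_of_mem_goodSet hP hQ hQ0 hT hc ?_ ?_) hs)
  · exact goodSet_anti ((Multiset.le_add_left _ _).trans (Multiset.le_add_right _ _)) hx
  · exact goodSet_anti (Multiset.le_add_left _ _) hx

theorem exists_lintegral_norm_eval_div_le_setLIntegral (hα : 0 < α) (hq : 0 < q) (hC₁ : 0 ≤ C₁)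
    (hC₂ : 0 ≤ C₂) {k : ℕ} {s : ℝ} (hs : 0 < s) (hsk : s * (k * (2 / q + 1 / α)) = 1) :
    ∃ T c C : ℝ, 1 ≤ T ∧ 0 < c ∧ c ≤ 1 ∧ 0 < C ∧ ∀ (μ : Measure ℝ) [IsProbabilityMeasure μ],
      TameLaw α q C₁ C₂ μ → ∀ P Q : ℂ[X], P.natDegree ≤ k → Q.natDegree ≤ k → Q ≠ 0 →
      ∀ R : Multiset ℂ, R.card ≤ k →
        ∫⁻ x : ℝ, ENNReal.ofReal ((‖P.eval (x : ℂ)‖ / ‖Q.eval (x : ℂ)‖) ^ s) ∂μ ≤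
          ENNReal.ofReal C * ∫⁻ x : ℝ in goodSet T c R,
            ENNReal.ofReal ((‖P.eval (x : ℂ)‖ / ‖Q.eval (x : ℂ)‖) ^ s) ∂μ := by
  obtain ⟨T, c, hT, hc, hc1, hgood⟩ := exists_half_le_measure_goodSet hα hq hC₁ hC₂ (3 * k)
  obtain ⟨D, hD, hupper⟩ := exists_lintegral_norm_eval_div_le hα hq hC₁ hC₂ hs hsk
  have hT0 : 0 ≤ T := by linarith
  set κ : ℝ := ((1 + T) / c + 1) ^ k * (1 + T) ^ k
  have hκ0 : 0 < κ := by positivity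
  refine ⟨T, c, 2 * (D * κ ^ s), hT, hc, hc1, by positivity, ?_⟩
  intro μ _ hμ P Q hP hQ hQ0 R hR
  have hcard : (R + P.roots + Q.roots).card ≤ 3 * k := by
    rw [Multiset.card_add, Multiset.card_add]
    linarith [(card_roots' P).trans hP, (card_roots' Q).trans hQ]
  have hlower := le_setLIntegral_norm_eval_div hP hQ hQ0 hT0 hc hs.le R (hgood μ hμ _ hcard)
  have hratio : 0 ≤ rootHeight P / rootHeight Q :=
    div_nonneg (rootHeight_nonneg P) (rootHeight_nonneg Q)
  have hhalf : (1 / 2 : ℝ≥0∞) = ENNReal.ofReal 2⁻¹ := by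
    rw [ENNReal.ofReal_inv_of_pos (by norm_num), ENNReal.ofReal_ofNat, one_div]
  calc ∫⁻ x : ℝ, ENNReal.ofReal ((‖P.eval (x : ℂ)‖ / ‖Q.eval (x : ℂ)‖) ^ s) ∂μ
      ≤ ENNReal.ofReal ((rootHeight P / rootHeight Q) ^ s * D) := hupper μ hμ P Q hP hQ hQ0
    _ = ENNReal.ofReal (2 * (D * κ ^ s)) *
          (ENNReal.ofReal ((rootHeight P / rootHeight Q / κ) ^ s) * (1 / 2)) := by
        rw [hhalf, ← ENNReal.ofReal_mul (by positivity), ← ENNReal.ofReal_mul (by positivity),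
          Real.div_rpow hratio hκ0.le]
        field_simp
    _ ≤ _ := by gcongr

end Rational

/-! ### Decoupling at a single site -/

section Site

open Polynomial

variable {k : ℕ}

theorem rpow_sum_le_sum_rpow {ι : Type*} (S : Finset ι) {f : ι → ℝ} (hf : ∀ i, 0 ≤ f i) {s : ℝ}
    (hs : 0 < s) (hs1 : s ≤ 1) : (∑ i ∈ S, f i) ^ s ≤ ∑ i ∈ S, f i ^ s := by
  classical
  induction S using Finset.induction_on with
  | empty => simp [Real.zero_rpow hs.ne']
  | insert a S ha ih =>
    rw [Finset.sum_insert ha, Finset.sum_insert ha]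
    exact (Real.rpow_add_le_add_rpow (hf a) (Finset.sum_nonneg fun i _ => hf i) hs.le hs1).trans
      (by gcongr)

theorem norm_le_sum_norm_apply (u : Spin k) : ‖u‖ ≤ ∑ i, ‖u i‖ := by
  rw [EuclideanSpace.norm_eq]
  exact Real.sqrt_le_iff.2
    ⟨by positivity, Finset.sum_sq_le_sq_sum_of_nonneg fun i _ => norm_nonneg _⟩

theorem norm_rpow_le_sum_norm_apply_rpow (u : Spin k) {s : ℝ} (hs : 0 < s) (hs1 : s ≤ 1) :
    ‖u‖ ^ s ≤ ∑ i, ‖u i‖ ^ s :=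
  (Real.rpow_le_rpow (norm_nonneg u) (norm_le_sum_norm_apply u) hs.le).trans
    (rpow_sum_le_sum_rpow _ (fun _ => norm_nonneg _) hs hs1)

theorem norm_matrix_apply_le (N : Matrix (Fin k) (Fin k) ℂ) (i j : Fin k) : ‖N i j‖ ≤ ‖N‖ := by
  have hcol : N i j = Matrix.toEuclideanLin N (EuclideanSpace.single j 1) i := by
    simp [Matrix.toLpLin_apply]
  rw [hcol]
  simpa using (PiLp.norm_apply_le (Matrix.toEuclideanLin N (EuclideanSpace.single j 1)) i).trans
    (norm_toEuclideanLin_le N _)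

theorem norm_det_le_factorial_mul_pow {N : Matrix (Fin k) (Fin k) ℂ} {b : ℝ}
    (hb : ∀ i j, ‖N i j‖ ≤ b) : ‖N.det‖ ≤ k.factorial * b ^ k := by
  have hdet := Matrix.det_le (A := N) (abv := NormedField.toAbsoluteValue ℂ) (x := b) hb
  rwa [Fintype.card_fin, nsmul_eq_mul] at hdet

theorem norm_adjugate_apply_le {N : Matrix (Fin k) (Fin k) ℂ} {b : ℝ} (hb1 : 1 ≤ b)
    (hb : ∀ i j, ‖N i j‖ ≤ b) (i j : Fin k) : ‖N.adjugate i j‖ ≤ k.factorial * b ^ k := by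
  rw [Matrix.adjugate_apply]
  refine norm_det_le_factorial_mul_pow fun i' j' => ?_
  rw [Matrix.updateRow_apply]
  split_ifs
  · obtain rfl | hne := eq_or_ne j' i
    · simpa using hb1
    · rw [Pi.single_eq_of_ne hne, norm_zero]
      linarith
  · exact hb i' j'

theorem det_smul_eq_toEuclideanLin_adjugate (N : Matrix (Fin k) (Fin k) ℂ) (u : Spin k) :
    N.det • u = Matrix.toEuclideanLin N.adjugate (Matrix.toEuclideanLin N u) := by
  ext i
  simp only [Matrix.toLpLin_apply, Matrix.mulVec_mulVec, Matrix.adjugate_mul,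
    Matrix.smul_mulVec, Matrix.one_mulVec]
  rfl

theorem norm_det_mul_norm_le {N : Matrix (Fin k) (Fin k) ℂ} {b : ℝ} (hb1 : 1 ≤ b)
    (hb : ∀ i j, ‖N i j‖ ≤ b) (u : Spin k) :
    ‖N.det‖ * ‖u‖ ≤ k * (k * (k.factorial * b ^ k)) * ‖Matrix.toEuclideanLin N u‖ := by
  set y := Matrix.toEuclideanLin N u
  have hcoord (i : Fin k) :
      ‖Matrix.toEuclideanLin N.adjugate y i‖ ≤ k * (k.factorial * b ^ k) * ‖y‖ := by
    calc ‖∑ j, N.adjugate i j * y j‖ ≤ ∑ _j : Fin k, (k.factorial * b ^ k) * ‖y‖ := by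
          refine (norm_sum_le _ _).trans (Finset.sum_le_sum fun j _ => ?_)
          rw [norm_mul]
          exact mul_le_mul (norm_adjugate_apply_le hb1 hb i j) (PiLp.norm_apply_le y j)
            (norm_nonneg _) (by positivity)
      _ = k * (k.factorial * b ^ k) * ‖y‖ := by simp [mul_assoc]
  calc ‖N.det‖ * ‖u‖ = ‖Matrix.toEuclideanLin N.adjugate y‖ := by
        rw [← norm_smul, det_smul_eq_toEuclideanLin_adjugate]
    _ ≤ ∑ _i : Fin k, k * (k.factorial * b ^ k) * ‖y‖ :=
        (norm_le_sum_norm_apply _).trans (Finset.sum_le_sum fun i _ => hcoord i)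
    _ = k * (k * (k.factorial * b ^ k)) * ‖y‖ := by simp [mul_assoc]

theorem one_le_norm_det_mul {A : Matrix (Fin k) (Fin k) ℂ} (hA : IsUnit A) {b : ℝ}
    (hb : ‖A⁻¹‖ ≤ b) : 1 ≤ ‖A.det‖ * (k.factorial * b ^ k) := by
  have hdet : A.det * A⁻¹.det = 1 := by
    rw [← Matrix.det_mul, Matrix.mul_nonsing_inv A ((Matrix.isUnit_iff_isUnit_det A).1 hA),
      Matrix.det_one]
  calc (1 : ℝ) = ‖A.det‖ * ‖A⁻¹.det‖ := by rw [← norm_mul, hdet, norm_one]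
    _ ≤ ‖A.det‖ * (k.factorial * b ^ k) := by
        gcongr
        exact norm_det_le_factorial_mul_pow fun i j => (norm_matrix_apply_le _ i j).trans hb

theorem pow_le_norm_eval_charpoly {N : Matrix (Fin k) (Fin k) ℂ} {T c t : ℝ} (hc : 0 ≤ c)
    (hc1 : c ≤ 1) (ht : t ∈ goodSet T c N.charpoly.roots) : c ^ k ≤ ‖N.charpoly.eval (t : ℂ)‖ := by
  have hcard : N.charpoly.roots.card ≤ k := by
    simpa [Matrix.charpoly_natDegree_eq_dim] using card_roots' N.charpoly
  rw [norm_eval_eq_mul_prod_roots, (Matrix.charpoly_monic N).leadingCoeff, norm_one, one_mul]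
  calc c ^ k ≤ c ^ N.charpoly.roots.card := pow_le_pow_of_le_one hc hc1 hcard
    _ = (N.charpoly.roots.map fun _ => c).prod := by
        rw [Multiset.map_const', Multiset.prod_replicate]
    _ ≤ _ := Multiset.prod_map_le_prod_map₀ _ _ (fun _ _ => hc) ht.2

theorem det_smul_add_sub_smul_one {A : Matrix (Fin k) (Fin k) ℂ} (hA : IsUnit A)
    (B : Matrix (Fin k) (Fin k) ℂ) (t z : ℂ) :
    (t • A + B - z • 1).det = A.det * (A⁻¹ * (z • 1 - B)).charpoly.eval t := by
  have hfactor : t • A + B - z • 1 = A * (Matrix.scalar (Fin k) t - A⁻¹ * (z • 1 - B)) := by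
    rw [mul_sub, ← mul_assoc, Matrix.mul_nonsing_inv A ((Matrix.isUnit_iff_isUnit_det A).1 hA),
      one_mul, Matrix.scalar_apply, ← Matrix.smul_one_eq_diagonal, mul_smul_comm, mul_one]
    abel
  rw [hfactor, Matrix.det_mul, Matrix.eval_charpoly]

theorem toEuclideanLin_sub_smul_one (N : Matrix (Fin k) (Fin k) ℂ) (z : ℂ) (u : Spin k) :
    Matrix.toEuclideanLin (N - z • 1) u = Matrix.toEuclideanLin N u - z • u := by
  simp [map_sub]

theorem one_add_norm_mul_norm_le_of_far {N : Matrix (Fin k) (Fin k) ℂ} {Y : ℝ} (hN : ‖N‖ ≤ Y)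
    {z : ℂ} (hz : 2 * Y + 1 ≤ ‖z‖) (u : Spin k) :
    (1 + ‖z‖) * ‖u‖ ≤ 2 * ‖Matrix.toEuclideanLin N u - z • u‖ := by
  have htri : ‖z‖ * ‖u‖ ≤ Y * ‖u‖ + ‖Matrix.toEuclideanLin N u - z • u‖ := by
    rw [← norm_smul]
    calc ‖z • u‖ ≤ ‖Matrix.toEuclideanLin N u‖ + ‖Matrix.toEuclideanLin N u - z • u‖ := by
          simpa using norm_sub_le (Matrix.toEuclideanLin N u) (Matrix.toEuclideanLin N u - z • u)
      _ ≤ _ := by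
          gcongr
          exact (norm_toEuclideanLin_le N u).trans (by gcongr)
  nlinarith [norm_nonneg u]

theorem norm_le_of_mem_goodSet {A : Matrix (Fin k) (Fin k) ℂ} (hA : IsUnit A) {b : ℝ}
    (hAi : ‖A⁻¹‖ ≤ b) (B : Matrix (Fin k) (Fin k) ℂ) {T c t : ℝ} (hc : 0 < c) (hc1 : c ≤ 1) {z : ℂ}
    (ht : t ∈ goodSet T c (A⁻¹ * (z • 1 - B)).charpoly.roots) {Y : ℝ} (hY : 1 ≤ Y)
    (hent : ∀ i j, ‖((t : ℂ) • A + B - z • 1) i j‖ ≤ Y) (u : Spin k) :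
    ‖u‖ ≤ k.factorial * b ^ k * (k * (k * (k.factorial * Y ^ k))) / c ^ k *
      ‖Matrix.toEuclideanLin ((t : ℂ) • A + B - z • 1) u‖ := by
  have hb : 0 ≤ b := (norm_nonneg _).trans hAi
  have hadj := norm_det_mul_norm_le hY hent u
  rw [det_smul_add_sub_smul_one hA, norm_mul] at hadj
  set e := ‖(A⁻¹ * (z • 1 - B)).charpoly.eval (t : ℂ)‖
  rw [div_mul_eq_mul_div, le_div_iff₀ (by positivity), mul_comm ‖u‖]
  calc c ^ k * ‖u‖ ≤ e * ‖u‖ * 1 := by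
        rw [mul_one]
        gcongr
        exact pow_le_norm_eval_charpoly hc.le hc1 ht
    _ ≤ e * ‖u‖ * (‖A.det‖ * (k.factorial * b ^ k)) := by
        gcongr
        exact one_le_norm_det_mul hA hAi
    _ = k.factorial * b ^ k * (‖A.det‖ * e * ‖u‖) := by ring
    _ ≤ k.factorial * b ^ k * (k * (k * (k.factorial * Y ^ k)) *
          ‖Matrix.toEuclideanLin ((t : ℂ) • A + B - z • 1) u‖) := by gcongr
    _ = _ := by ring

theorem exists_one_add_norm_mul_norm_le (k : ℕ) {CB1 CB2 T c : ℝ} (hCB1 : 0 ≤ CB1)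
    (hCB2 : 0 ≤ CB2) (hT : 0 ≤ T) (hc : 0 < c) (hc1 : c ≤ 1) :
    ∃ C : ℝ, 0 < C ∧ ∀ A B : Matrix (Fin k) (Fin k) ℂ, IsUnit A → ‖A‖ ≤ CB1 → ‖A⁻¹‖ ≤ CB1 →
      ‖B‖ ≤ CB2 → ∀ (z : ℂ) (t : ℝ), t ∈ goodSet T c (A⁻¹ * (z • 1 - B)).charpoly.roots →
      ∀ u : Spin k, (1 + ‖z‖) * ‖u‖ ≤
        C * ‖Matrix.toEuclideanLin ((t : ℂ) • A + B) u - z • u‖ := by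
  set Y := T * CB1 + CB2
  have hY : 0 ≤ Y := by positivity
  set K := k.factorial * CB1 ^ k * (k * (k * (k.factorial * (3 * Y + 1) ^ k))) / c ^ k
  refine ⟨2 + (2 * Y + 2) * K, by positivity, ?_⟩
  intro A B hA hAn hAi hB z t ht u
  have hnorm : ‖(t : ℂ) • A + B‖ ≤ Y := by
    refine (norm_add_le _ _).trans (add_le_add ?_ hB)
    rw [norm_smul, Complex.norm_real, Real.norm_eq_abs]
    exact mul_le_mul ht.1 hAn (norm_nonneg A) hT
  rcases le_or_gt (2 * Y + 1) ‖z‖ with hz | hz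
  · refine (one_add_norm_mul_norm_le_of_far hnorm hz u).trans ?_
    gcongr
    exact le_add_of_nonneg_right (by positivity)
  · have hent (i j : Fin k) : ‖((t : ℂ) • A + B - z • 1) i j‖ ≤ 3 * Y + 1 := by
      have hdiag : ‖(z • (1 : Matrix (Fin k) (Fin k) ℂ)) i j‖ ≤ ‖z‖ := by
        rw [Matrix.smul_apply, Matrix.one_apply]
        split_ifs <;> simp
      rw [Matrix.sub_apply]
      linarith [norm_sub_le (((t : ℂ) • A + B) i j) ((z • (1 : Matrix (Fin k) (Fin k) ℂ)) i j),
        (norm_matrix_apply_le _ i j).trans hnorm]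
    rw [← toEuclideanLin_sub_smul_one]
    calc (1 + ‖z‖) * ‖u‖ ≤ (2 * Y + 2) *
          (K * ‖Matrix.toEuclideanLin ((t : ℂ) • A + B - z • 1) u‖) :=
          mul_le_mul (by linarith)
            (norm_le_of_mem_goodSet hA hAi B hc hc1 ht (by linarith) hent u) (norm_nonneg u)
            (by positivity)
      _ ≤ _ := by
          rw [← mul_assoc]
          gcongr
          exact le_add_of_nonneg_left zero_le_two

theorem eval_det_X_smul_add (N N' : Matrix (Fin k) (Fin k) ℂ) (t : ℂ) :
    (Matrix.det ((X : ℂ[X]) • N.map C + N'.map C)).eval t = (t • N + N').det := by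
  rw [← coe_evalRingHom, RingHom.map_det]
  congr 1
  ext i j
  simp [mul_comm t]

theorem exists_polynomial_eval_mul_apply_eq (L : Spin k →ₗ[ℂ] Spin k) (w : Spin k) :
    ∃ (P : Fin k → ℂ[X]) (Q : ℂ[X]), (∀ i, (P i).natDegree ≤ k) ∧ Q.natDegree ≤ k ∧ Q ≠ 0 ∧
      ∀ (t : ℂ) (u : Spin k), u + t • L u = w → ∀ i, Q.eval t * u i = (P i).eval t := by
  obtain ⟨N, rfl⟩ := Matrix.toEuclideanLin.surjective L
  refine ⟨fun i => Matrix.det ((X : ℂ[X]) • (N.updateCol i 0).map C +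
    ((1 : Matrix (Fin k) (Fin k) ℂ).updateCol i w.ofLp).map C),
    Matrix.det ((X : ℂ[X]) • N.map C + (1 : Matrix (Fin k) (Fin k) ℂ).map C),
    fun i => ?_, ?_, fun hzero => ?_, fun t u hu i => ?_⟩
  · simpa using natDegree_det_X_add_C_le (N.updateCol i 0)
      ((1 : Matrix (Fin k) (Fin k) ℂ).updateCol i w.ofLp)
  · simpa using natDegree_det_X_add_C_le N (1 : Matrix (Fin k) (Fin k) ℂ)
  · have heval := eval_det_X_smul_add N 1 0
    rw [hzero] at heval
    simp at heval
  · have hsystem : (t • N + 1).mulVec u.ofLp = w.ofLp := by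
      rw [← hu, Matrix.add_mulVec, Matrix.one_mulVec, Matrix.smul_mulVec, add_comm]
      rfl
    have hcol : t • N.updateCol i 0 + (1 : Matrix (Fin k) (Fin k) ℂ).updateCol i w.ofLp =
        (t • N + 1).updateCol i w.ofLp := by
      ext a b
      by_cases hb : b = i <;> simp [hb]
    rw [eval_det_X_smul_add, eval_det_X_smul_add, hcol, ← Matrix.cramer_apply,
      Matrix.cramer_eq_adjugate_mulVec, ← hsystem, Matrix.mulVec_mulVec, Matrix.adjugate_mul,
      Matrix.smul_mulVec, Matrix.one_mulVec]
    rfl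

theorem ae_eval_ofReal_ne_zero {μ : Measure ℝ} [NullSingletonClass μ] {Q : ℂ[X]} (hQ : Q ≠ 0) :
    ∀ᵐ t : ℝ ∂μ, Q.eval (t : ℂ) ≠ 0 := by
  have hfin : {t : ℝ | Q.eval (t : ℂ) = 0}.Finite := by
    refine ((finite_setOfPred_isRoot hQ).preimage Complex.ofReal_injective.injOn).subset ?_
    exact fun t ht => ht
  exact compl_mem_ae_iff.2 (hfin.measure_zero μ)

theorem lintegral_norm_rpow_le_sum {μ : Measure ℝ} {u : ℝ → Spin k} {P : Fin k → ℂ[X]} {Q : ℂ[X]}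
    (h : ∀ᵐ t : ℝ ∂μ, ∀ i, ‖u t i‖ = ‖(P i).eval (t : ℂ)‖ / ‖Q.eval (t : ℂ)‖) {s : ℝ}
    (hs : 0 < s) (hs1 : s ≤ 1) :
    ∫⁻ t, ENNReal.ofReal (‖u t‖ ^ s) ∂μ ≤
      ∑ i, ∫⁻ t : ℝ, ENNReal.ofReal ((‖(P i).eval (t : ℂ)‖ / ‖Q.eval (t : ℂ)‖) ^ s) ∂μ := by
  have hmeas (p : ℂ[X]) : Measurable fun t : ℝ => ‖p.eval (t : ℂ)‖ :=
    (p.continuous.comp Complex.continuous_ofReal).norm.measurable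
  refine (lintegral_mono_ae ?_).trans (lintegral_finsetSum _ fun i _ =>
    (((hmeas (P i)).div (hmeas Q)).pow_const s).ennreal_ofReal).le
  filter_upwards [h] with t ht
  simp only [Pi.div_apply, ← ht]
  rw [← ENNReal.ofReal_sum_of_nonneg fun i _ => by positivity]
  exact ENNReal.ofReal_le_ofReal (norm_rpow_le_sum_norm_apply_rpow (u t) hs hs1)

theorem rpow_le_mul_rpow_neg_mul_rpow {C m x y s : ℝ} (hC : 0 ≤ C) (hm : 0 < m) (hx : 0 ≤ x)
    (hy : 0 ≤ y) (hs : 0 ≤ s) (h : m * x ≤ C * y) : x ^ s ≤ C ^ s * m ^ (-s) * y ^ s := by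
  have hle : x ≤ C * m⁻¹ * y := by
    rw [mul_right_comm, ← div_eq_mul_inv, le_div_iff₀ hm, mul_comm]
    exact h
  calc x ^ s ≤ (C * m⁻¹ * y) ^ s := Real.rpow_le_rpow hx hle hs
    _ = C ^ s * m ^ (-s) * y ^ s := by
        rw [Real.mul_rpow (by positivity) hy, Real.mul_rpow hC (by positivity),
          Real.inv_rpow hm.le, Real.rpow_neg hm.le]

variable {α q C₁ C₂ : ℝ}

theorem exists_lintegral_norm_rpow_le_setLIntegral (k : ℕ) (hα : 0 < α) (hq : 0 < q) (hC₁ : 0 ≤ C₁)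
    (hC₂ : 0 ≤ C₂) {s : ℝ} (hs : 0 < s) (hs1 : s ≤ 1) (hsk : s * (k * (2 / q + 1 / α)) = 1) :
    ∃ T c C : ℝ, 1 ≤ T ∧ 0 < c ∧ c ≤ 1 ∧ 0 < C ∧ ∀ (μ : Measure ℝ) [IsProbabilityMeasure μ],
      TameLaw α q C₁ C₂ μ → ∀ (L : Spin k →ₗ[ℂ] Spin k) (w : Spin k) (u : ℝ → Spin k),
        (∀ t : ℝ, u t + (t : ℂ) • L (u t) = w) → ∀ R : Multiset ℂ, R.card ≤ k →
        ∫⁻ t, ENNReal.ofReal (‖u t‖ ^ s) ∂μ ≤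
          ENNReal.ofReal C * ∫⁻ t in goodSet T c R, ENNReal.ofReal (‖u t‖ ^ s) ∂μ := by
  obtain ⟨T, c, C, hT, hc, hc1, hC, hdec⟩ :=
    exists_lintegral_norm_eval_div_le_setLIntegral hα hq hC₁ hC₂ hs hsk
  refine ⟨T, c, (k + 1) * C, hT, hc, hc1, by positivity, fun μ _ hμ L w u hu R hR => ?_⟩
  have : NullSingletonClass μ := ⟨hμ.measure_singleton hα⟩
  obtain ⟨P, Q, hP, hQ, hQ0, hPQ⟩ := exists_polynomial_eval_mul_apply_eq L w
  have hfrac : ∀ᵐ t : ℝ ∂μ, ∀ i, ‖u t i‖ = ‖(P i).eval (t : ℂ)‖ / ‖Q.eval (t : ℂ)‖ := by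
    filter_upwards [ae_eval_ofReal_ne_zero hQ0] with t ht i
    rw [← hPQ t (u t) (hu t) i, norm_mul, mul_div_cancel_left₀ _ (norm_ne_zero_iff.2 ht)]
  set J := ∫⁻ t in goodSet T c R, ENNReal.ofReal (‖u t‖ ^ s) ∂μ
  have hgood (i : Fin k) : ∫⁻ t : ℝ in goodSet T c R,
      ENNReal.ofReal ((‖(P i).eval (t : ℂ)‖ / ‖Q.eval (t : ℂ)‖) ^ s) ∂μ ≤ J := by
    refine lintegral_mono_ae ?_
    filter_upwards [ae_restrict_of_ae hfrac] with t ht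
    rw [← ht i]
    gcongr
    exact PiLp.norm_apply_le _ _
  calc ∫⁻ t, ENNReal.ofReal (‖u t‖ ^ s) ∂μ
      ≤ ∑ i, ∫⁻ t : ℝ, ENNReal.ofReal ((‖(P i).eval (t : ℂ)‖ / ‖Q.eval (t : ℂ)‖) ^ s) ∂μ :=
        lintegral_norm_rpow_le_sum hfrac hs hs1
    _ ≤ ∑ _i : Fin k, ENNReal.ofReal C * J := Finset.sum_le_sum fun i _ =>
        (hdec μ hμ (P i) Q (hP i) hQ hQ0 R hR).trans (mul_le_mul_right (hgood i) _)
    _ = ENNReal.ofReal (k * C) * J := by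
        rw [Finset.sum_const, Finset.card_univ, Fintype.card_fin, nsmul_eq_mul, ← mul_assoc,
          ← ENNReal.ofReal_natCast, ← ENNReal.ofReal_mul (by positivity)]
    _ ≤ ENNReal.ofReal ((k + 1) * C) * J := by
        gcongr
        exact le_add_of_nonneg_right zero_le_one

theorem exists_lintegral_norm_rpow_le (k : ℕ) (hα : 0 < α) (hq : 0 < q) (hC₁ : 0 ≤ C₁)
    (hC₂ : 0 ≤ C₂) {CB1 CB2 : ℝ} (hCB1 : 0 ≤ CB1) (hCB2 : 0 ≤ CB2) {s : ℝ} (hs : 0 < s)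
    (hs1 : s ≤ 1) (hsk : s * (k * (2 / q + 1 / α)) = 1) :
    ∃ K : ℝ, 0 < K ∧ ∀ (μ : Measure ℝ) [IsProbabilityMeasure μ], TameLaw α q C₁ C₂ μ →
      ∀ A B : Matrix (Fin k) (Fin k) ℂ, IsUnit A → ‖A‖ ≤ CB1 → ‖A⁻¹‖ ≤ CB1 → ‖B‖ ≤ CB2 →
      ∀ (z : ℂ) (L : Spin k →ₗ[ℂ] Spin k) (w : Spin k) (u : ℝ → Spin k),
        (∀ t : ℝ, u t + (t : ℂ) • L (u t) = w) →
        ∫⁻ t, ENNReal.ofReal (‖u t‖ ^ s) ∂μ ≤ ENNReal.ofReal (K * (1 + ‖z‖) ^ (-s)) *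
          ∫⁻ t, ENNReal.ofReal
            (‖Matrix.toEuclideanLin ((t : ℂ) • A + B) (u t) - z • u t‖ ^ s) ∂μ := by
  obtain ⟨T, c, C, hT, hc, hc1, hC, hdec⟩ :=
    exists_lintegral_norm_rpow_le_setLIntegral k hα hq hC₁ hC₂ hs hs1 hsk
  obtain ⟨C', hC', hlow⟩ :=
    exists_one_add_norm_mul_norm_le k hCB1 hCB2 (zero_le_one.trans hT) hc hc1
  refine ⟨C * C' ^ s, by positivity, fun μ _ hμ A B hA hAn hAi hB z L w u hu => ?_⟩
  set R := (A⁻¹ * (z • 1 - B)).charpoly.roots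
  set J := ∫⁻ t, ENNReal.ofReal
    (‖Matrix.toEuclideanLin ((t : ℂ) • A + B) (u t) - z • u t‖ ^ s) ∂μ
  have hR : R.card ≤ k := by
    simpa [Matrix.charpoly_natDegree_eq_dim] using card_roots' (A⁻¹ * (z • 1 - B)).charpoly
  have hgood : ∫⁻ t in goodSet T c R, ENNReal.ofReal (‖u t‖ ^ s) ∂μ ≤
      ENNReal.ofReal (C' ^ s * (1 + ‖z‖) ^ (-s)) * J := by
    rw [← lintegral_const_mul' _ _ ENNReal.ofReal_ne_top]
    refine (setLIntegral_mono' (measurableSet_goodSet T c R) fun t ht => ?_).trans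
      (setLIntegral_le_lintegral (goodSet T c R) _)
    rw [← ENNReal.ofReal_mul (by positivity)]
    exact ENNReal.ofReal_le_ofReal (rpow_le_mul_rpow_neg_mul_rpow hC'.le (by positivity)
      (norm_nonneg _) (norm_nonneg _) hs.le (hlow A B hA hAn hAi hB z t ht (u t)))
  calc ∫⁻ t, ENNReal.ofReal (‖u t‖ ^ s) ∂μ
      ≤ ENNReal.ofReal C * ∫⁻ t in goodSet T c R, ENNReal.ofReal (‖u t‖ ^ s) ∂μ :=
        hdec μ hμ L w u hu R hR
    _ ≤ ENNReal.ofReal C * (ENNReal.ofReal (C' ^ s * (1 + ‖z‖) ^ (-s)) * J) := by gcongr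
    _ = ENNReal.ofReal (C * C' ^ s * (1 + ‖z‖) ^ (-s)) * J := by
        rw [← mul_assoc, ← ENNReal.ofReal_mul hC.le, ← mul_assoc]

end Site

/-! ### Fractional moments of the resolvent -/

section Moments

theorem infinitePi_map_update {ι X : Type*} [DecidableEq ι] [MeasurableSpace X] (μ : Measure X)
    [IsProbabilityMeasure μ] (x : ι) : ((Measure.infinitePi fun _ : ι => μ).prod μ).map
      (fun p => Function.update p.1 x p.2) = Measure.infinitePi fun _ : ι => μ := by
  refine Measure.eq_infinitePi _ fun S t ht => ?_
  have hmeas : Measurable fun p : (ι → X) × X => Function.update p.1 x p.2 := measurable_update'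
  rw [Measure.map_apply hmeas (MeasurableSet.pi S.countable_toSet fun i _ => ht i)]
  by_cases hx : x ∈ S
  · have hpre : (fun p : (ι → X) × X => Function.update p.1 x p.2) ⁻¹' (Set.pi S t) =
        (Set.pi (S.erase x : Finset ι) t) ×ˢ (t x) := by
      ext ⟨w, r⟩
      simp only [Set.mem_preimage, Set.mem_pi, Set.mem_prod, Finset.mem_coe, Finset.mem_erase]
      refine ⟨fun h => ⟨fun i hi => ?_, by simpa using h x hx⟩, ?_⟩
      · simpa [Function.update_of_ne hi.1] using h i hi.2
      · rintro ⟨hne, hxr⟩ i hi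
        obtain rfl | hix := eq_or_ne i x
        · simpa using hxr
        · simpa [Function.update_of_ne hix] using hne i ⟨hix, hi⟩
    rw [hpre, Measure.prod_prod, Measure.infinitePi_pi _ fun i _ => ht i,
      Finset.prod_erase_mul S (fun i => μ (t i)) hx]
  · have hpre : (fun p : (ι → X) × X => Function.update p.1 x p.2) ⁻¹' (Set.pi S t) =
        (Set.pi S t) ×ˢ Set.univ := by
      ext ⟨w, r⟩
      simp only [Set.mem_preimage, Set.mem_pi, Set.mem_prod, Finset.mem_coe, Set.mem_univ, and_true]
      refine forall₂_congr fun i hi => ?_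
      rw [Function.update_of_ne (fun h : i = x => hx (h ▸ hi))]
    rw [hpre, Measure.prod_prod, Measure.infinitePi_pi _ fun i _ => ht i, measure_univ, mul_one]

theorem lintegral_infinitePi_update {ι X : Type*} [DecidableEq ι] [MeasurableSpace X]
    (μ : Measure X) [IsProbabilityMeasure μ] (x : ι) {F : (ι → X) → ℝ≥0∞} (hF : Measurable F) :
    ∫⁻ v, ∫⁻ t, F (Function.update v x t) ∂μ ∂(Measure.infinitePi fun _ : ι => μ) =
      ∫⁻ v, F v ∂(Measure.infinitePi fun _ : ι => μ) := by
  have hmeas : Measurable fun p : (ι → X) × X => Function.update p.1 x p.2 := measurable_update'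
  conv_rhs => rw [← infinitePi_map_update μ x]
  rw [lintegral_map hF hmeas]
  exact (lintegral_prod (fun p => F (Function.update p.1 x p.2)) (hF.comp hmeas).aemeasurable).symm

theorem le_two_mul_of_le_mul_one_add {A B S : ℝ≥0∞} (hS : S ≠ ⊤) (hAB : A * B ≤ 2⁻¹)
    (h : S ≤ A * (1 + B * S)) : S ≤ 2 * A := by
  have hle : S ≤ A + S / 2 := calc
    S ≤ A + A * B * S := by rwa [mul_add, mul_one, ← mul_assoc] at h
    _ ≤ A + S / 2 := by
      rw [ENNReal.div_eq_inv_mul]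
      gcongr
  have hhalf : S / 2 ≤ A := by
    refine (ENNReal.add_le_add_iff_right (ENNReal.div_ne_top hS two_ne_zero)).1 ?_
    rwa [ENNReal.add_halves]
  rw [← ENNReal.div_le_iff' two_ne_zero ENNReal.ofNat_ne_top]
  exact hhalf

variable {d k : ℕ} {μ : Measure ℝ} {M : ModelData d k} {CB1 CB2 CB3 g s : ℝ} {z : ℂ}

/-- The fractional moment `⟨‖((H - z)⁻¹ ψ)(x)‖ ^ s⟩`, for independent `v(x)` with law `μ`. -/
def ModelData.greenMoment (M : ModelData d k) (g : ℝ) (μ : Measure ℝ) (s : ℝ) (z : ℂ)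
    (ψ : Wave d k) (x : Site d) : ℝ≥0∞ :=
  ∫⁻ v, ENNReal.ofReal (‖M.green g v z ψ x‖ ^ s) ∂(Measure.infinitePi fun _ : Site d => μ)

/-- The fractional moment `⟨‖(v(x) A + B - z) ((H - z)⁻¹ ψ)(x)‖ ^ s⟩`, for independent `v(x)` with
law `μ`. -/
def ModelData.siteMoment (M : ModelData d k) (g : ℝ) (μ : Measure ℝ) (s : ℝ) (z : ℂ)
    (ψ : Wave d k) (x : Site d) : ℝ≥0∞ :=
  ∫⁻ v, ENNReal.ofReal (‖Matrix.toEuclideanLin ((v x : ℂ) • M.A + M.B) (M.green g v z ψ x) -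
    z • M.green g v z ψ x‖ ^ s) ∂(Measure.infinitePi fun _ : Site d => μ)

theorem continuous_wave_apply {X : Type*} [TopologicalSpace X] {f : X → Wave d k}
    (hf : Continuous f) (x : Site d) : Continuous fun y => f y x :=
  (lp.lipschitzWith_one_eval 2 x).continuous.comp hf

theorem measurable_ofReal_norm_rpow {X E : Type*} [TopologicalSpace X] [MeasurableSpace X]
    [OpensMeasurableSpace X] [SeminormedAddCommGroup E] {f : X → E} (hf : Continuous f)
    (hs : 0 ≤ s) : Measurable fun x => ENNReal.ofReal (‖f x‖ ^ s) :=
  (hf.norm.rpow_const fun _ => Or.inr hs).measurable.ennreal_ofReal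

theorem ModelData.Admissible.continuous_green_apply (hM : M.Admissible CB1 CB2 CB3)
    (g : ℝ) (hz : z.im ≠ 0) (ψ : Wave d k) (x : Site d) :
    Continuous fun v : Site d → ℝ => M.green g v z ψ x :=
  continuous_wave_apply (hM.continuous_green g hz ψ) x

theorem ModelData.Admissible.continuous_site_term (hM : M.Admissible CB1 CB2 CB3) (g : ℝ)
    (hz : z.im ≠ 0) (ψ : Wave d k) (x : Site d) : Continuous fun v : Site d → ℝ =>
      Matrix.toEuclideanLin ((v x : ℂ) • M.A + M.B) (M.green g v z ψ x) -
        z • M.green g v z ψ x := by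
  simp only [map_add, map_smul, LinearMap.add_apply, LinearMap.smul_apply]
  have hG := hM.continuous_green_apply g hz ψ x
  have hlin (N : Matrix (Fin k) (Fin k) ℂ) : Continuous fun v : Site d → ℝ =>
      Matrix.toEuclideanLin N (M.green g v z ψ x) :=
    (LinearMap.continuous_of_finiteDimensional _).comp hG
  exact (((by fun_prop : Continuous fun v : Site d → ℝ => ((v x : ℝ) : ℂ)).smul
    (hlin M.A)).add (hlin M.B)).sub (hG.const_smul z)

theorem ModelData.Admissible.norm_hopping_apply_le (hM : M.Admissible CB1 CB2 CB3)
    (ψ : Wave d k) (x : Site d) : ‖M.hopping ψ x‖ ≤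
      ∑ i : Fin d, (CB3 * ‖ψ (x - unitVec i)‖ + CB3 * ‖ψ (x + unitVec i)‖) := by
  rw [ModelData.hopping_apply]
  refine (norm_sum_le _ _).trans (Finset.sum_le_sum fun i _ => (norm_add_le _ _).trans ?_)
  obtain ⟨hK, hK'⟩ := hM.norm_K i
  exact add_le_add
    ((norm_toEuclideanLin_le _ _).trans (mul_le_mul_of_nonneg_right hK (norm_nonneg _)))
    ((norm_toEuclideanLin_le _ _).trans (mul_le_mul_of_nonneg_right hK' (norm_nonneg _)))

theorem ModelData.Admissible.norm_site_term_le (hM : M.Admissible CB1 CB2 CB3) (hg : 0 < g)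
    (v : Site d → ℝ) (hz : z.im ≠ 0) (ψ : Wave d k) (x : Site d) :
    ‖Matrix.toEuclideanLin ((v x : ℂ) • M.A + M.B) (M.green g v z ψ x) -
      z • M.green g v z ψ x‖ ≤ ‖ψ x‖ + ∑ i : Fin d,
        (CB3 / g * ‖M.green g v z ψ (x - unitVec i)‖ +
          CB3 / g * ‖M.green g v z ψ (x + unitVec i)‖) := by
  set u := M.green g v z ψ
  have heq : Matrix.toEuclideanLin ((v x : ℂ) • M.A + M.B) (u x) - z • u x =
      ψ x - ((g⁻¹ : ℝ) : ℂ) • M.hopping u x := by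
    rw [← hM.green_equation g v hz ψ x]
    abel
  rw [heq]
  refine (norm_sub_le _ _).trans ?_
  gcongr
  rw [norm_smul, Complex.norm_real, Real.norm_eq_abs, abs_of_pos (by positivity)]
  refine (mul_le_mul_of_nonneg_left (hM.norm_hopping_apply_le u x) (by positivity)).trans_eq ?_
  rw [Finset.mul_sum]
  refine Finset.sum_congr rfl fun i _ => ?_
  field_simp

theorem ModelData.Admissible.norm_site_term_rpow_le (hM : M.Admissible CB1 CB2 CB3)
    (hCB3 : 0 ≤ CB3) (hg : 0 < g) (v : Site d → ℝ) (hz : z.im ≠ 0) (hs : 0 < s) (hs1 : s ≤ 1)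
    (ψ : Wave d k) (x : Site d) :
    ‖Matrix.toEuclideanLin ((v x : ℂ) • M.A + M.B) (M.green g v z ψ x) -
      z • M.green g v z ψ x‖ ^ s ≤ ‖ψ x‖ ^ s + (CB3 / g) ^ s *
        ∑ i : Fin d, (‖M.green g v z ψ (x - unitVec i)‖ ^ s +
          ‖M.green g v z ψ (x + unitVec i)‖ ^ s) := by
  set u := M.green g v z ψ
  set f : Fin d → ℝ := fun i =>
    CB3 / g * ‖u (x - unitVec i)‖ + CB3 / g * ‖u (x + unitVec i)‖
  have hf : ∀ i, 0 ≤ f i := fun i => by positivity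
  calc _ ≤ (‖ψ x‖ + ∑ i, f i) ^ s :=
        Real.rpow_le_rpow (norm_nonneg _) (hM.norm_site_term_le hg v hz ψ x) hs.le
    _ ≤ ‖ψ x‖ ^ s + (∑ i, f i) ^ s :=
        Real.rpow_add_le_add_rpow (norm_nonneg _) (Finset.sum_nonneg fun i _ => hf i) hs.le hs1
    _ ≤ ‖ψ x‖ ^ s + ∑ i, f i ^ s := by
        gcongr
        exact rpow_sum_le_sum_rpow _ hf hs hs1
    _ ≤ _ := by
        rw [Finset.mul_sum]
        gcongr with i
        refine (Real.rpow_add_le_add_rpow (by positivity) (by positivity) hs.le hs1).trans_eq ?_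
        rw [Real.mul_rpow (by positivity) (norm_nonneg _),
          Real.mul_rpow (by positivity) (norm_nonneg _), mul_add]

theorem ModelData.Admissible.greenMoment_le_inv_im (hM : M.Admissible CB1 CB2 CB3) (g : ℝ)
    (μ : Measure ℝ) [IsProbabilityMeasure μ] (hs : 0 ≤ s) (hz : z.im ≠ 0) {ψ : Wave d k}
    (hψ : ‖ψ‖ ≤ 1) (x : Site d) : M.greenMoment g μ s z ψ x ≤ ENNReal.ofReal (|z.im|⁻¹ ^ s) := by
  calc M.greenMoment g μ s z ψ x
      ≤ ∫⁻ _, ENNReal.ofReal (|z.im|⁻¹ ^ s) ∂(Measure.infinitePi fun _ : Site d => μ) := by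
        refine lintegral_mono fun v =>
          ENNReal.ofReal_le_ofReal (Real.rpow_le_rpow (norm_nonneg _) ?_ hs)
        calc ‖M.green g v z ψ x‖ ≤ ‖M.green g v z ψ‖ := lp.norm_apply_le_norm two_ne_zero _ x
          _ ≤ ‖M.green g v z‖ * ‖ψ‖ := (M.green g v z).le_opNorm ψ
          _ ≤ |z.im|⁻¹ * 1 := by
            gcongr
            exact hM.norm_green_le g v hz
          _ = _ := mul_one _
    _ = _ := by rw [lintegral_const, measure_univ, mul_one]

theorem exists_greenMoment_le_siteMoment {α q C₁ C₂ : ℝ} (k : ℕ) (hα : 0 < α) (hq : 0 < q)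
    (hC₁ : 0 ≤ C₁) (hC₂ : 0 ≤ C₂) {CB1 CB2 : ℝ} (hCB1 : 0 ≤ CB1) (hCB2 : 0 ≤ CB2) {s : ℝ}
    (hs : 0 < s) (hs1 : s ≤ 1) (hsk : s * (k * (2 / q + 1 / α)) = 1) :
    ∃ K : ℝ, 0 < K ∧ ∀ (d : ℕ) (M : ModelData d k) (CB3 : ℝ), M.Admissible CB1 CB2 CB3 →
      ∀ (μ : Measure ℝ) [IsProbabilityMeasure μ], TameLaw α q C₁ C₂ μ → ∀ (g : ℝ) (z : ℂ),
      z.im ≠ 0 → ∀ (ψ : Wave d k) (x : Site d), M.greenMoment g μ s z ψ x ≤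
        ENNReal.ofReal (K * (1 + ‖z‖) ^ (-s)) * M.siteMoment g μ s z ψ x := by
  obtain ⟨K, hK, hdec⟩ := exists_lintegral_norm_rpow_le k hα hq hC₁ hC₂ hCB1 hCB2 hs hs1 hsk
  refine ⟨K, hK, fun d M CB3 hM μ _ hμ g z hz ψ x => ?_⟩
  rw [ModelData.greenMoment, ModelData.siteMoment,
    ← lintegral_infinitePi_update μ x
      (measurable_ofReal_norm_rpow (hM.continuous_green_apply g hz ψ x) hs.le),
    ← lintegral_infinitePi_update μ x
      (measurable_ofReal_norm_rpow (hM.continuous_site_term g hz ψ x) hs.le),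
    ← lintegral_const_mul' _ _ ENNReal.ofReal_ne_top]
  refine lintegral_mono fun v => ?_
  simp only [Function.update_self]
  let L : Spin k →ₗ[ℂ] Spin k :=
    (lp.evalₗ (𝕜 := ℂ) (fun _ : Site d => Spin k) 2 x) ∘ₗ
      (M.green g (Function.update v x 0) z).toLinearMap ∘ₗ
      (lp.lsingle (𝕜 := ℂ) 2 x) ∘ₗ Matrix.toEuclideanLin M.A
  refine hdec μ hμ M.A M.B hM.isUnit_A hM.norm_A hM.norm_inv_A hM.norm_B z L
    (M.green g (Function.update v x 0) z ψ x) _ fun t => ?_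
  have hrankOne := hM.green_update g (Function.update v x 0) hz x t ψ
  rw [Function.update_idem, Function.update_self, sub_zero] at hrankOne
  exact congrArg (fun φ : Wave d k => φ x) hrankOne

theorem ModelData.Admissible.siteMoment_le_sum (hM : M.Admissible CB1 CB2 CB3) (hCB3 : 0 ≤ CB3)
    (hg : 0 < g) (μ : Measure ℝ) [IsProbabilityMeasure μ] (hs : 0 < s) (hs1 : s ≤ 1)
    (hz : z.im ≠ 0) {ψ : Wave d k} (hψ : ‖ψ‖ ≤ 1) (x : Site d) :
    M.siteMoment g μ s z ψ x ≤ 1 + ENNReal.ofReal ((CB3 / g) ^ s) * ∑ i : Fin d,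
      (M.greenMoment g μ s z ψ (x - unitVec i) + M.greenMoment g μ s z ψ (x + unitVec i)) := by
  set ν := Measure.infinitePi fun _ : Site d => μ
  have hmeas (y : Site d) : Measurable fun v => ENNReal.ofReal (‖M.green g v z ψ y‖ ^ s) :=
    measurable_ofReal_norm_rpow (hM.continuous_green_apply g hz ψ y) hs.le
  have hψx : ‖ψ x‖ ^ s ≤ 1 :=
    Real.rpow_le_one (norm_nonneg _) ((lp.norm_apply_le_norm two_ne_zero ψ x).trans hψ) hs.le
  calc M.siteMoment g μ s z ψ x
      ≤ ∫⁻ v, (1 + ENNReal.ofReal ((CB3 / g) ^ s) * ∑ i : Fin d,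
          (ENNReal.ofReal (‖M.green g v z ψ (x - unitVec i)‖ ^ s) +
            ENNReal.ofReal (‖M.green g v z ψ (x + unitVec i)‖ ^ s))) ∂ν := by
        refine lintegral_mono fun v => ?_
        have hofReal (i : Fin d) := ENNReal.ofReal_add
          (by positivity : 0 ≤ ‖M.green g v z ψ (x - unitVec i)‖ ^ s)
          (by positivity : 0 ≤ ‖M.green g v z ψ (x + unitVec i)‖ ^ s)
        simp only [← hofReal]
        rw [← ENNReal.ofReal_sum_of_nonneg fun i _ => by positivity,
          ← ENNReal.ofReal_mul (by positivity), ← ENNReal.ofReal_one,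
          ← ENNReal.ofReal_add zero_le_one (by positivity)]
        refine ENNReal.ofReal_le_ofReal
          ((hM.norm_site_term_rpow_le hCB3 hg v hz hs hs1 ψ x).trans ?_)
        gcongr
    _ = _ := by
        rw [lintegral_add_left measurable_const, lintegral_const, measure_univ, mul_one,
          lintegral_const_mul' _ _ ENNReal.ofReal_ne_top]
        congr 2
        exact (lintegral_finsetSum _ fun i _ => (hmeas _).add (hmeas _)).trans
          (Finset.sum_congr rfl fun i _ => lintegral_add_left (hmeas _) _)

theorem mul_rpow_neg_mul_div_rpow_le_half {K D b g y s : ℝ} (hb : 0 ≤ b) (hg : 0 < g)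
    (hy : 0 < y) (h : 4 * K * D * b ^ s ≤ (g * y) ^ s) :
    K * y ^ (-s) * ((b / g) ^ s * (2 * D)) ≤ 2⁻¹ := by
  rw [Real.mul_rpow hg.le hy.le] at h
  rw [Real.rpow_neg hy.le, Real.div_rpow hb hg.le]
  rw [show K * (y ^ s)⁻¹ * (b ^ s / g ^ s * (2 * D)) = (2 * K * D * b ^ s) / (g ^ s * y ^ s) by
    field_simp, div_le_iff₀ (by positivity)]
  linarith

theorem exists_greenMoment_le {α q C₁ C₂ : ℝ} (k : ℕ) (hα : 0 < α) (hq : 0 < q) (hC₁ : 0 ≤ C₁)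
    (hC₂ : 0 ≤ C₂) {CB1 CB2 CB3 : ℝ} (hCB1 : 0 ≤ CB1) (hCB2 : 0 ≤ CB2) (hCB3 : 0 ≤ CB3) {s : ℝ}
    (hs : 0 < s) (hs1 : s ≤ 1) (hsk : s * (k * (2 / q + 1 / α)) = 1) :
    ∃ K : ℝ, 0 < K ∧ ∀ (d : ℕ) (M : ModelData d k), M.Admissible CB1 CB2 CB3 →
      ∀ (μ : Measure ℝ) [IsProbabilityMeasure μ], TameLaw α q C₁ C₂ μ → ∀ g : ℝ, 0 < g →
      ∀ z : ℂ, z.im ≠ 0 → 4 * K * d * CB3 ^ s ≤ (g * (1 + ‖z‖)) ^ s → ∀ ψ : Wave d k, ‖ψ‖ ≤ 1 →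
      ∀ x : Site d, M.greenMoment g μ s z ψ x ≤ ENNReal.ofReal (2 * K * (1 + ‖z‖) ^ (-s)) := by
  obtain ⟨K, hK, hdec⟩ := exists_greenMoment_le_siteMoment k hα hq hC₁ hC₂ hCB1 hCB2 hs hs1 hsk
  refine ⟨K, hK, fun d M hM μ _ hμ g hg z hz hgz ψ hψ x₀ => ?_⟩
  set a := ENNReal.ofReal (K * (1 + ‖z‖) ^ (-s))
  set b := ENNReal.ofReal ((CB3 / g) ^ s * (2 * d)) with hb
  set S : ℝ≥0∞ := ⨆ x, M.greenMoment g μ s z ψ x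
  have hle (x : Site d) : M.greenMoment g μ s z ψ x ≤ S := le_iSup (M.greenMoment g μ s z ψ) x
  have hfin : S ≠ ⊤ := ne_top_of_le_ne_top ENNReal.ofReal_ne_top
    (iSup_le (hM.greenMoment_le_inv_im g μ hs.le hz hψ))
  have hself : S ≤ a * (1 + b * S) := iSup_le fun x => calc
    _ ≤ a * M.siteMoment g μ s z ψ x := hdec d M CB3 hM μ hμ g z hz ψ x
    _ ≤ a * (1 + ENNReal.ofReal ((CB3 / g) ^ s) * ∑ _i : Fin d, (S + S)) := by
      gcongr
      refine (hM.siteMoment_le_sum hCB3 hg μ hs hs1 hz hψ x).trans ?_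
      gcongr <;> exact hle _
    _ = a * (1 + b * S) := by
      rw [hb, ENNReal.ofReal_mul (by positivity), ENNReal.ofReal_mul zero_le_two,
        ENNReal.ofReal_natCast, ENNReal.ofReal_ofNat, Finset.sum_const, Finset.card_univ,
        Fintype.card_fin, nsmul_eq_mul]
      ring
  have hsmall : a * b ≤ 2⁻¹ := by
    rw [← ENNReal.ofReal_mul (by positivity), ← ENNReal.ofReal_ofNat 2,
      ← ENNReal.ofReal_inv_of_pos zero_lt_two]
    exact ENNReal.ofReal_le_ofReal
      (mul_rpow_neg_mul_div_rpow_le_half hCB3 hg (by positivity) hgz)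
  calc M.greenMoment g μ s z ψ x₀ ≤ S := hle x₀
    _ ≤ 2 * a := le_two_mul_of_le_mul_one_add hfin hsmall hself
    _ = _ := by rw [mul_assoc, ENNReal.ofReal_mul zero_le_two, ENNReal.ofReal_ofNat]

end Moments

/-! ### Measures from positive functionals -/

section Riesz

open scoped CompactlySupported

variable {X : Type*} [TopologicalSpace X]

theorem integrable_zeroAtInfty [MeasurableSpace X] [OpensMeasurableSpace X] (ρ : Measure X)
    [IsFiniteMeasure ρ] (f : C₀(X, ℝ)) : Integrable f ρ :=
  Integrable.of_bound (map_continuous f).stronglyMeasurable.aestronglyMeasurable ‖f‖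
    (ae_of_all _ fun t => f.toBCF.norm_coe_le_norm t)

variable [T2Space X] [LocallyCompactSpace X]

theorem exists_compactlySupported_eq_one {K : Set X} (hK : IsCompact K) :
    ∃ χ : C_c(X, ℝ), (∀ t ∈ K, χ t = 1) ∧ ∀ t, 0 ≤ χ t ∧ χ t ≤ 1 := by
  obtain ⟨χ, hone, -, hsupp, hIcc⟩ :=
    exists_continuous_one_zero_of_isCompact hK isClosed_empty (Set.disjoint_empty K)
  exact ⟨⟨χ, hsupp⟩, fun t ht => hone ht, hIcc⟩

theorem exists_compactlySupported_abs_sub_le (f : C₀(X, ℝ)) {η : ℝ} (hη : 0 < η) :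
    ∃ φ : C_c(X, ℝ), ∀ t, |f t - φ t| ≤ η := by
  obtain ⟨K, hK, hfK⟩ := mem_cocompact.1 (Metric.tendsto_nhds.1 (zero_at_infty f) η hη)
  obtain ⟨χ, hχK, hχ⟩ := exists_compactlySupported_eq_one hK
  refine ⟨⟨⟨fun t => f t * χ t, (map_continuous f).mul (map_continuous χ)⟩,
    χ.hasCompactSupport.mul_left⟩, fun t => ?_⟩
  change |f t - f t * χ t| ≤ η
  by_cases ht : t ∈ K
  · simpa only [hχK t ht, mul_one, sub_self, abs_zero] using hη.le
  · have hft : |f t| < η := by simpa using hfK ht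
    have hχt : |1 - χ t| ≤ 1 := abs_le.2 ⟨by linarith [(hχ t).2], by linarith [(hχ t).1]⟩
    calc |f t - f t * χ t| = |f t| * |1 - χ t| := by rw [← abs_mul, mul_one_sub]
      _ ≤ η * 1 := by gcongr
      _ = η := mul_one η

variable [MeasurableSpace X] [BorelSpace X] {Λ : C₀(X, ℝ) →ₗ[ℝ] ℝ}

theorem rieszMeasure_univ_le_one {L : C_c(X, ℝ) →ₚ[ℝ] ℝ}
    (hL : ∀ φ : C_c(X, ℝ), (∀ t, |φ t| ≤ 1) → |L φ| ≤ 1) :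
    RealRMK.rieszMeasure L Set.univ ≤ 1 := by
  rw [isOpen_univ.measure_eq_iSup_isCompact]
  refine iSup₂_le fun K _ => iSup_le fun hK => ?_
  obtain ⟨χ, hχK, hχ⟩ := exists_compactlySupported_eq_one hK
  refine (RealRMK.rieszMeasure_le_of_eq_one L (fun t => (hχ t).1) hK hχK).trans ?_
  have habs : |L χ| ≤ 1 := hL χ fun t => by
    rw [abs_of_nonneg (hχ t).1]
    exact (hχ t).2
  exact ENNReal.ofReal_le_one.2 ((le_abs_self _).trans habs)

theorem integral_eq_of_forall_compactlySupported {ρ : Measure X} [IsFiniteMeasure ρ]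
    (hbound : ∀ (f : C₀(X, ℝ)) (C : ℝ), 0 ≤ C → (∀ t, |f t| ≤ C) → |Λ f| ≤ C)
    (h : ∀ φ : C_c(X, ℝ), ∫ t, φ t ∂ρ = Λ φ) (f : C₀(X, ℝ)) : ∫ t, f t ∂ρ = Λ f := by
  rw [← sub_eq_zero, ← abs_nonpos_iff]
  refine le_of_forall_pos_le_add fun ε hε => ?_
  set m := ρ.real Set.univ
  have hm : 0 ≤ m := measureReal_nonneg
  obtain ⟨φ, hφ⟩ := exists_compactlySupported_abs_sub_le f (by positivity : 0 < ε / (m + 1))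
  have hΛ : |Λ f - Λ φ| ≤ ε / (m + 1) := by
    rw [← map_sub]
    exact hbound _ _ (by positivity) hφ
  have hint : |∫ t, f t ∂ρ - ∫ t, φ t ∂ρ| ≤ ε / (m + 1) * m := by
    rw [← integral_sub (integrable_zeroAtInfty ρ f)
      ((map_continuous φ).integrable_of_hasCompactSupport φ.hasCompactSupport)]
    exact norm_integral_le_of_norm_le_const (f := fun t => f t - φ t) (ae_of_all _ hφ)
  calc |∫ t, f t ∂ρ - Λ f|
      = |(∫ t, f t ∂ρ - ∫ t, φ t ∂ρ) - (Λ f - Λ φ)| := by rw [h]; congr 1; ring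
    _ ≤ ε / (m + 1) * m + ε / (m + 1) := (abs_sub _ _).trans (add_le_add hint hΛ)
    _ = 0 + ε := by field_simp; ring

theorem existsUnique_measure_integral_eq {Y : Type*} [TopologicalSpace Y]
    [TopologicalSpace.MetrizableSpace Y] [LocallyCompactSpace Y] [SigmaCompactSpace Y]
    [MeasurableSpace Y] [BorelSpace Y] {Λ : C₀(Y, ℝ) →ₗ[ℝ] ℝ}
    (hpos : ∀ f : C₀(Y, ℝ), (∀ t, 0 ≤ f t) → 0 ≤ Λ f)
    (hbound : ∀ (f : C₀(Y, ℝ)) (C : ℝ), 0 ≤ C → (∀ t, |f t| ≤ C) → |Λ f| ≤ C) :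
    ∃! ρ : Measure Y, IsFiniteMeasure ρ ∧ ∀ f : C₀(Y, ℝ), ∫ t, f t ∂ρ = Λ f := by
  let L : C_c(Y, ℝ) →ₚ[ℝ] ℝ := PositiveLinearMap.mk₀
    { toFun := fun φ => Λ φ
      map_add' := fun φ χ => map_add Λ (φ : C₀(Y, ℝ)) χ
      map_smul' := fun c φ => map_smul Λ c (φ : C₀(Y, ℝ)) } fun φ hφ => hpos φ hφ
  have hfin : IsFiniteMeasure (RealRMK.rieszMeasure L) :=
    ⟨(rieszMeasure_univ_le_one fun φ hφ => hbound φ 1 zero_le_one hφ).trans_lt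
      ENNReal.one_lt_top⟩
  refine ⟨RealRMK.rieszMeasure L, ⟨hfin, integral_eq_of_forall_compactlySupported hbound fun φ =>
    RealRMK.integral_rieszMeasure L φ⟩, fun ρ ⟨hρfin, hρ⟩ => ?_⟩
  exact Measure.ext_of_integral_eq_on_compactlySupported fun φ =>
    (hρ (φ : C₀(Y, ℝ))).trans (RealRMK.integral_rieszMeasure L φ).symm

end Riesz

/-! ### The density of states -/

section DensityOfStates

variable {d k : ℕ} {M : ModelData d k} {g : ℝ} {CB1 CB2 CB3 : ℝ}

theorem norm_kernel_funCalc_le (T : Wave d k →ₗ.[ℂ] Wave d k) {f : C₀(ℝ, ℝ)} {C : ℝ} (hC : 0 ≤ C)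
    (hf : ∀ t, |f t| ≤ C) (m n : Site d) (i j : Fin k) : ‖kernel (funCalc T f) m n i j‖ ≤ C :=
  (norm_kernel_le _ m n i j).trans (norm_funCalc_le T f hC hf)

theorem ModelData.Admissible.continuous_kernel_funCalc (hM : M.Admissible CB1 CB2 CB3) (g : ℝ)
    (f : C₀(ℝ, ℝ)) (m n : Site d) (i j : Fin k) :
    Continuous fun v : Site d → ℝ => kernel (funCalc (M.hamiltonian g v) f) m n i j :=
  (EuclideanSpace.proj (𝕜 := ℂ) i).continuous.comp <| continuous_wave_apply
    (continuous_funCalc_apply (fun v => hM.isSelfAdjoint_hamiltonian g v)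
      (fun _ hz ψ => hM.continuous_green g hz ψ) f _) m

theorem ModelData.Admissible.funCalc_shift (hM : M.Admissible CB1 CB2 CB3) (g : ℝ)
    (v : Site d → ℝ) (f : C₀(ℝ, ℝ)) (a : Site d) :
    funCalc (M.hamiltonian g fun x => v (x + a)) f =
      (shift a).conjStarAlgEquiv (funCalc (M.hamiltonian g v) f) :=
  funCalc_eq_conj (hM.isSelfAdjoint_hamiltonian g v) (hM.isSelfAdjoint_hamiltonian g _) _
    (hM.green_shift g v (by simp) a) f

theorem IsIID.map_eq {μ : Measure ℝ} {Ω : Type*} [MeasurableSpace Ω] {P : Measure Ω}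
    {v : Site d → Ω → ℝ} (hv : IsIID v P μ) :
    P.map (fun ω x => v x ω) = Measure.infinitePi fun _ : Site d => μ := by
  rw [hv.indep.map_fun_eq_infinitePi_map hv.measurable]
  simp only [hv.law]

variable (μ : Measure ℝ) [IsProbabilityMeasure μ]

theorem ModelData.Admissible.integrable_kernel_funCalc (hM : M.Admissible CB1 CB2 CB3) (g : ℝ)
    (f : C₀(ℝ, ℝ)) (m n : Site d) (i j : Fin k) :
    Integrable (fun v => kernel (funCalc (M.hamiltonian g v) f) m n i j)
      (Measure.infinitePi fun _ : Site d => μ) :=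
  Integrable.of_bound (hM.continuous_kernel_funCalc g f m n i j).aestronglyMeasurable ‖f‖
    (ae_of_all _ fun _ =>
      norm_kernel_funCalc_le _ (norm_nonneg f) (fun t => f.toBCF.norm_coe_le_norm t) m n i j)

theorem ModelData.Admissible.integral_kernel_funCalc_self (hM : M.Admissible CB1 CB2 CB3) (g : ℝ)
    (f : C₀(ℝ, ℝ)) (n : Site d) (i j : Fin k) :
    ∫ v, kernel (funCalc (M.hamiltonian g v) f) n n i j ∂(Measure.infinitePi fun _ : Site d => μ) =
      ∫ v, kernel (funCalc (M.hamiltonian g v) f) 0 0 i j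
        ∂(Measure.infinitePi fun _ : Site d => μ) := by
  have hmap := Measure.map_infinitePi_infinitePi_of_inj (P := fun _ => μ)
    (add_left_injective n)
  nth_rewrite 2 [← hmap]
  rw [integral_map (measurable_pi_iff.2 fun x => measurable_pi_apply (x + n)).aemeasurable
    (hM.continuous_kernel_funCalc g f 0 0 i j).aestronglyMeasurable]
  simp only [hM.funCalc_shift, kernel_shift, zero_add]

/-- The averaged trace per unit volume `f ↦ k⁻¹ tr ⟨f(H)(0, 0)⟩` of functions of the Hamiltonian,
as a linear functional on `C₀(ℝ)`. -/
def ModelData.Admissible.averagedTrace (hM : M.Admissible CB1 CB2 CB3) (g : ℝ) :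
    C₀(ℝ, ℝ) →ₗ[ℝ] ℝ where
  toFun f := (k : ℝ)⁻¹ * ∑ i : Fin k, ∫ v, (kernel (funCalc (M.hamiltonian g v) f) 0 0 i i).re
    ∂(Measure.infinitePi fun _ : Site d => μ)
  map_add' f h := by
    rw [← mul_add, ← Finset.sum_add_distrib]
    congr! 2 with i
    refine Eq.trans ?_ (integral_add (hM.integrable_kernel_funCalc μ g f 0 0 i i).re
      (hM.integrable_kernel_funCalc μ g h 0 0 i i).re)
    simp only [funCalc_add (hM.isSelfAdjoint_hamiltonian g _), kernel_add]
    rfl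
  map_smul' c f := by
    rw [RingHom.id_apply, smul_eq_mul, mul_left_comm c, Finset.mul_sum _ _ c]
    congr! 2 with i
    rw [← integral_const_mul]
    simp only [funCalc_smul (hM.isSelfAdjoint_hamiltonian g _), kernel_smul, Matrix.smul_apply,
      smul_eq_mul, Complex.re_ofReal_mul]

theorem ModelData.Admissible.averagedTrace_apply (hM : M.Admissible CB1 CB2 CB3) (f : C₀(ℝ, ℝ)) :
    hM.averagedTrace μ g f = (k : ℝ)⁻¹ * ∑ i : Fin k,
      ∫ v, (kernel (funCalc (M.hamiltonian g v) f) 0 0 i i).re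
        ∂(Measure.infinitePi fun _ : Site d => μ) := rfl

theorem ModelData.Admissible.averagedTrace_nonneg (hM : M.Admissible CB1 CB2 CB3) {f : C₀(ℝ, ℝ)}
    (hf : ∀ t, 0 ≤ f t) : 0 ≤ hM.averagedTrace μ g f :=
  mul_nonneg (by positivity) (Finset.sum_nonneg fun i _ =>
    integral_nonneg fun _ => kernel_self_re_nonneg (funCalc_nonneg _ hf) 0 i)

theorem inv_mul_sum_le {k : ℕ} {F : Fin k → ℝ} {C : ℝ} (hC : 0 ≤ C) (hF : ∀ i, F i ≤ C) :
    (k : ℝ)⁻¹ * ∑ i, F i ≤ C := by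
  rcases Nat.eq_zero_or_pos k with rfl | hk
  · simpa using hC
  · rw [inv_mul_le_iff₀ (Nat.cast_pos.2 hk)]
    simpa using Finset.sum_le_card_nsmul Finset.univ F C fun i _ => hF i

theorem ModelData.Admissible.abs_averagedTrace_le (hM : M.Admissible CB1 CB2 CB3) {f : C₀(ℝ, ℝ)}
    {C : ℝ} (hC : 0 ≤ C) (hf : ∀ t, |f t| ≤ C) : |hM.averagedTrace μ g f| ≤ C := by
  rw [hM.averagedTrace_apply μ, abs_mul, abs_of_nonneg (by positivity)]
  refine (mul_le_mul_of_nonneg_left (Finset.abs_sum_le_sum_abs _ _) (by positivity)).trans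
    (inv_mul_sum_le hC fun i => ?_)
  have hint := norm_integral_le_of_norm_le_const (μ := Measure.infinitePi fun _ : Site d => μ)
    (f := fun v => (kernel (funCalc (M.hamiltonian g v) f) 0 0 i i).re) (ae_of_all _ fun v =>
      (Complex.abs_re_le_norm _).trans (norm_kernel_funCalc_le _ hC hf 0 0 i i))
  simpa using hint

theorem ModelData.Admissible.ofReal_averagedTrace (hM : M.Admissible CB1 CB2 CB3) (f : C₀(ℝ, ℝ))
    (n : Site d) :
    ((hM.averagedTrace μ g f : ℝ) : ℂ) = (k : ℂ)⁻¹ * ∑ i : Fin k,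
      ∫ v, kernel (funCalc (M.hamiltonian g v) f) n n i i
        ∂(Measure.infinitePi fun _ : Site d => μ) := by
  rw [hM.averagedTrace_apply μ]
  push_cast
  congr! 2 with i
  rw [hM.integral_kernel_funCalc_self μ, ← integral_complex_ofReal]
  congr 1
  funext v
  exact Complex.ext (Complex.ofReal_re _)
    (kernel_self_im_of_isSelfAdjoint (isSelfAdjoint_funCalc _ f) 0 i).symm

variable {μ} {Ω : Type*} [MeasurableSpace Ω] {P : Measure Ω} {v : Site d → Ω → ℝ}

theorem IsIID.integrable_kernel_funCalc (hv : IsIID v P μ) (hM : M.Admissible CB1 CB2 CB3) (g : ℝ)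
    (f : C₀(ℝ, ℝ)) (m n : Site d) (i j : Fin k) :
    Integrable (fun ω => kernel (funCalc (M.hamiltonian g fun x => v x ω) f) m n i j) P := by
  have hint := hM.integrable_kernel_funCalc μ g f m n i j
  rw [← hv.map_eq] at hint
  exact hint.comp_measurable (measurable_pi_iff.2 hv.measurable)

theorem IsIID.trace_integral_kernel_funCalc (hv : IsIID v P μ) (hM : M.Admissible CB1 CB2 CB3)
    (g : ℝ) (f : C₀(ℝ, ℝ)) (n : Site d) :
    (k : ℂ)⁻¹ * Matrix.trace (Matrix.of fun i j =>
      ∫ ω, kernel (funCalc (M.hamiltonian g fun x => v x ω) f) n n i j ∂P) =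
        ((hM.averagedTrace μ g f : ℝ) : ℂ) := by
  rw [hM.ofReal_averagedTrace μ f n, Matrix.trace]
  congr! 2 with i
  rw [← hv.map_eq, integral_map (measurable_pi_iff.2 hv.measurable).aemeasurable
    (hM.continuous_kernel_funCalc g f n n i i).aestronglyMeasurable]
  rfl

theorem IsIID.isDensityOfStates_iff (hv : IsIID v P μ) (hM : M.Admissible CB1 CB2 CB3)
    (ρ : Measure ℝ) :
    IsDensityOfStates (fun ω => M.hamiltonian g fun x => v x ω) P ρ ↔
      IsFiniteMeasure ρ ∧ ∀ f : C₀(ℝ, ℝ), ∫ t, f t ∂ρ = hM.averagedTrace μ g f := by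
  constructor
  · refine fun hρ => ⟨hρ.finite, fun f => ?_⟩
    have htrace := hρ.integral_eq f 0
    rw [hv.trace_integral_kernel_funCalc hM] at htrace
    exact_mod_cast htrace
  · rintro ⟨hfin, hρ⟩
    refine ⟨hfin, fun f n i j => hv.integrable_kernel_funCalc hM g f n n i j, fun f n => ?_⟩
    rw [hv.trace_integral_kernel_funCalc hM, hρ]

theorem IsIID.existsUnique_densityOfStates (hv : IsIID v P μ) (hM : M.Admissible CB1 CB2 CB3) :
    ∃! ρ : Measure ℝ, IsDensityOfStates (fun ω => M.hamiltonian g fun x => v x ω) P ρ := by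
  simp only [hv.isDensityOfStates_iff hM]
  exact existsUnique_measure_integral_eq (fun f hf => hM.averagedTrace_nonneg μ hf)
    fun f C => hM.abs_averagedTrace_le μ

end DensityOfStates

/-! ### The Wegner estimate -/

section Wegner

variable {d k : ℕ} {M : ModelData d k} {g : ℝ} {CB1 CB2 CB3 : ℝ}

theorem ModelData.Admissible.mono (hM : M.Admissible CB1 CB2 CB3) {CB1' CB2' CB3' : ℝ}
    (h₁ : CB1 ≤ CB1') (h₂ : CB2 ≤ CB2') (h₃ : CB3 ≤ CB3') : M.Admissible CB1' CB2' CB3' where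
  hermitian_A := hM.hermitian_A
  hermitian_B := hM.hermitian_B
  isUnit_A := hM.isUnit_A
  norm_A := hM.norm_A.trans h₁
  norm_inv_A := hM.norm_inv_A.trans h₁
  norm_B := hM.norm_B.trans h₂
  hermitian_K := hM.hermitian_K
  norm_K i := ⟨(hM.norm_K i).1.trans h₃, (hM.norm_K i).2.trans h₃⟩

theorem ModelData.Admissible.two_mul_abs_im_mul_norm_kernel_le (hM : M.Admissible CB1 CB2 CB3)
    (g : ℝ) (v : Site d → ℝ) {z : ℂ} (hz : z.im ≠ 0) (m n : Site d) (i j : Fin k) :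
    2 * |z.im| * ‖kernel (M.green g v z * M.green g v (conj z)) m n i j‖ ≤
      ‖M.green g v z (pointWave n j) m‖ + ‖M.green g v (conj z) (pointWave n j) m‖ := by
  set G := M.green g v z
  set G' := M.green g v (conj z)
  have hres : G - G' = (z - conj z) • (G * G') :=
    (hM.isResolventAt_green g v hz).sub_eq_smul_mul (hM.isResolventAt_green g v (by simpa using hz))
  calc 2 * |z.im| * ‖kernel (G * G') m n i j‖ = ‖kernel ((z - conj z) • (G * G')) m n i j‖ := by
        rw [kernel_smul, Matrix.smul_apply, norm_smul, Complex.sub_conj]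
        simp
    _ = ‖kernel G m n i j - kernel G' m n i j‖ := by rw [← hres]; rfl
    _ ≤ _ := (norm_sub_le _ _).trans (add_le_add (norm_kernel_le_norm_apply G m n i j)
      (norm_kernel_le_norm_apply G' m n i j))

theorem ModelData.Admissible.abs_im_mul_norm_green_apply_le (hM : M.Admissible CB1 CB2 CB3)
    (g : ℝ) (v : Site d → ℝ) {z : ℂ} (hz : z.im ≠ 0) {s : ℝ} (hs1 : s ≤ 1) (m n : Site d)
    (j : Fin k) :
    |z.im| * ‖M.green g v z (pointWave n j) m‖ ≤
      |z.im| ^ s * ‖M.green g v z (pointWave n j) m‖ ^ s := by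
  rw [← Real.mul_rpow (abs_nonneg _) (norm_nonneg _)]
  refine Real.self_le_rpow_of_le_one (by positivity) ?_ hs1
  calc |z.im| * ‖M.green g v z (pointWave n j) m‖ ≤ |z.im| * |z.im|⁻¹ := by
        gcongr
        exact (norm_apply_pointWave_le _ m n j).trans (hM.norm_green_le g v hz)
    _ = 1 := mul_inv_cancel₀ (abs_pos.2 hz).ne'

theorem ModelData.Admissible.re_kernel_poisson_le (hM : M.Admissible CB1 CB2 CB3) (g : ℝ)
    (v : Site d → ℝ) {z : ℂ} (hz : z.im ≠ 0) {s : ℝ} (hs1 : s ≤ 1) (m n : Site d) (i j : Fin k) :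
    |z.im| * (kernel (funCalc (M.hamiltonian g v) (poisson z)) m n i j).re ≤
      |z.im| ^ s / 2 * (‖M.green g v z (pointWave n j) m‖ ^ s +
        ‖M.green g v (conj z) (pointWave n j) m‖ ^ s) := by
  have hker : (kernel (funCalc (M.hamiltonian g v) (poisson z)) m n i j).re ≤
      |z.im| * ‖kernel (M.green g v z * M.green g v (conj z)) m n i j‖ := by
    rw [funCalc_poisson (hM.isSelfAdjoint_hamiltonian g v) hz, kernel_smul, Matrix.smul_apply,
      smul_eq_mul, Complex.re_ofReal_mul]
    exact mul_le_mul_of_nonneg_left (Complex.re_le_norm _) (abs_nonneg _)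
  have hprod := hM.two_mul_abs_im_mul_norm_kernel_le g v hz m n i j
  have hG := hM.abs_im_mul_norm_green_apply_le g v hz hs1 m n j
  have hG' := hM.abs_im_mul_norm_green_apply_le g v (z := conj z) (by simpa using hz) hs1 m n j
  rw [Complex.conj_im, abs_neg] at hG'
  linarith [mul_le_mul_of_nonneg_left hker (abs_nonneg z.im),
    mul_le_mul_of_nonneg_left hprod (abs_nonneg z.im)]

theorem measureReal_Icc_le_integral_poisson (ρ : Measure ℝ) [IsFiniteMeasure ρ] (lam : ℝ) {ε : ℝ}
    (hε : 0 < ε) :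
    ρ.real (Set.Icc (lam - ε) (lam + ε)) ≤ 2 * ε * ∫ t, poisson ⟨lam, ε⟩ t ∂ρ := by
  rw [← integral_indicator_one measurableSet_Icc, ← integral_const_mul]
  refine integral_mono ((integrable_const (1 : ℝ)).indicator measurableSet_Icc)
    ((integrable_zeroAtInfty ρ _).const_mul _) fun t => ?_
  change _ ≤ 2 * ε * poisson ⟨lam, ε⟩ t
  by_cases ht : t ∈ Set.Icc (lam - ε) (lam + ε)
  · rw [Set.indicator_of_mem ht, Pi.one_apply, poisson_apply (z := ⟨lam, ε⟩) hε.ne',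
      abs_of_pos hε, mul_div_assoc', le_div_iff₀ (by positivity)]
    have hsq : (t - lam) ^ 2 ≤ ε ^ 2 := sq_le_sq' (by linarith [ht.1]) (by linarith [ht.2])
    linarith
  · rw [Set.indicator_of_notMem ht]
    exact mul_nonneg (by positivity) (poisson_nonneg _ t)

theorem ModelData.Admissible.integral_re_kernel_poisson_le (hM : M.Admissible CB1 CB2 CB3)
    (μ : Measure ℝ) [IsProbabilityMeasure μ] (g : ℝ) {z : ℂ} (hz : z.im ≠ 0) {s : ℝ} (hs : 0 ≤ s)
    (hs1 : s ≤ 1) {m : ℝ} (hm : 0 ≤ m) (x : Site d) (i : Fin k)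
    (hG : M.greenMoment g μ s z (pointWave x i) x ≤ ENNReal.ofReal m)
    (hG' : M.greenMoment g μ s (conj z) (pointWave x i) x ≤ ENNReal.ofReal m) :
    |z.im| * ∫ v, (kernel (funCalc (M.hamiltonian g v) (poisson z)) x x i i).re
      ∂(Measure.infinitePi fun _ : Site d => μ) ≤ |z.im| ^ s * m := by
  rw [← integral_const_mul, ← ENNReal.ofReal_le_ofReal_iff (by positivity)]
  refine (ofReal_integral_eq_lintegral_ofReal
    ((hM.integrable_kernel_funCalc μ g (poisson z) x x i i).re.const_mul |z.im|)
    (ae_of_all _ fun v => mul_nonneg (abs_nonneg _)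
      (kernel_self_re_nonneg (funCalc_nonneg _ (poisson_nonneg z)) x i))).le.trans ?_
  calc _ ≤ ∫⁻ v, ENNReal.ofReal (|z.im| ^ s / 2) *
        (ENNReal.ofReal (‖M.green g v z (pointWave x i) x‖ ^ s) +
          ENNReal.ofReal (‖M.green g v (conj z) (pointWave x i) x‖ ^ s))
          ∂(Measure.infinitePi fun _ : Site d => μ) := by
        refine lintegral_mono fun v => ?_
        rw [← ENNReal.ofReal_add (by positivity) (by positivity),
          ← ENNReal.ofReal_mul (by positivity)]
        exact ENNReal.ofReal_le_ofReal (hM.re_kernel_poisson_le g v hz hs1 x x i i)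
    _ = ENNReal.ofReal (|z.im| ^ s / 2) * (M.greenMoment g μ s z (pointWave x i) x +
          M.greenMoment g μ s (conj z) (pointWave x i) x) :=
        (lintegral_const_mul' _ _ ENNReal.ofReal_ne_top).trans (congrArg _ (lintegral_add_left
          (measurable_ofReal_norm_rpow (hM.continuous_green_apply g hz _ x) hs) _))
    _ ≤ ENNReal.ofReal (|z.im| ^ s / 2) * (ENNReal.ofReal m + ENNReal.ofReal m) := by gcongr
    _ = ENNReal.ofReal (|z.im| ^ s * m) := by
        rw [← ENNReal.ofReal_add hm hm, ← ENNReal.ofReal_mul (by positivity)]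
        ring_nf

theorem exists_averagedTrace_poisson_le {α q C₁ C₂ : ℝ} (k : ℕ) (hα : 0 < α) (hq : 0 < q)
    (hC₁ : 0 ≤ C₁) (hC₂ : 0 ≤ C₂) {CB1 CB2 CB3 : ℝ} (hCB1 : 0 ≤ CB1) (hCB2 : 0 ≤ CB2)
    (hCB3 : 0 ≤ CB3) {s : ℝ} (hs : 0 < s) (hs1 : s ≤ 1) (hsk : s * (k * (2 / q + 1 / α)) = 1) :
    ∃ K : ℝ, 0 < K ∧ ∀ (d : ℕ) (M : ModelData d k) (hM : M.Admissible CB1 CB2 CB3)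
      (μ : Measure ℝ) [IsProbabilityMeasure μ], TameLaw α q C₁ C₂ μ → ∀ g : ℝ, 0 < g →
      ∀ z : ℂ, z.im ≠ 0 → 4 * K * d * CB3 ^ s ≤ (g * (1 + ‖z‖)) ^ s →
      |z.im| * hM.averagedTrace μ g (poisson z) ≤ |z.im| ^ s * (2 * K * (1 + ‖z‖) ^ (-s)) := by
  obtain ⟨K, hK, hmoment⟩ := exists_greenMoment_le k hα hq hC₁ hC₂ hCB1 hCB2 hCB3 hs hs1 hsk
  refine ⟨K, hK, fun d M hM μ _ hμ g hg z hz hgz => ?_⟩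
  rw [hM.averagedTrace_apply μ, mul_left_comm, Finset.mul_sum]
  refine inv_mul_sum_le (by positivity) fun i => ?_
  have hψ : ‖pointWave (0 : Site d) i‖ ≤ 1 := (norm_pointWave 0 i).le
  refine hM.integral_re_kernel_poisson_le μ g hz hs.le hs1 (by positivity) 0 i
    (hmoment d M hM μ hμ g hg z hz hgz _ hψ 0) ?_
  have hconj := hmoment d M hM μ hμ g hg (conj z) (by simpa using hz)
  rw [Complex.norm_conj] at hconj
  exact hconj hgz _ hψ 0

theorem wegnerExponent_pos {α q : ℝ} (hα : 0 < α) (hq : 0 < q) (hk : 0 < k) :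
    0 < wegnerExponent α q k := by
  have : (0 : ℝ) < k := Nat.cast_pos.2 hk
  unfold wegnerExponent
  positivity

theorem wegnerExponent_le_one {α q : ℝ} (hα : 0 < α) (hα1 : α ≤ 1) (hq : 0 < q) (hk : 0 < k) :
    wegnerExponent α q k ≤ 1 := by
  have : (1 : ℝ) ≤ k := Nat.one_le_cast.2 hk
  unfold wegnerExponent
  rw [div_le_one (by positivity)]
  calc α * q ≤ 1 * q := by gcongr
    _ ≤ k * q := by gcongr
    _ ≤ 2 * k * α + k * q := le_add_of_nonneg_left (by positivity)

theorem wegnerExponent_mul {α q : ℝ} (hα : 0 < α) (hq : 0 < q) (hk : 0 < k) :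
    wegnerExponent α q k * (k * (2 / q + 1 / α)) = 1 := by
  have : (0 : ℝ) < k := Nat.cast_pos.2 hk
  unfold wegnerExponent
  field_simp

theorem wegnerExponent_one_eq (hk : 0 < k) {δ : ℝ} (hδ : 0 < δ) :
    wegnerExponent 1 (2 * k / δ) k = 1 / ((k : ℝ) + δ) := by
  have : (0 : ℝ) < k := Nat.cast_pos.2 hk
  unfold wegnerExponent
  field_simp
  ring

theorem IsIID.isProbabilityMeasure {Ω : Type*} [MeasurableSpace Ω] {P : Measure Ω}
    [IsProbabilityMeasure P] {v : Site d → Ω → ℝ} {μ : Measure ℝ} (hv : IsIID v P μ) :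
    IsProbabilityMeasure μ := by
  rw [← hv.law 0]
  exact Measure.isProbabilityMeasure_map (hv.measurable 0).aemeasurable

theorem mul_le_mul_rpow_of_mul_rpow_div_le {L D C g l n s : ℝ} (hs : 0 < s) (hL : 0 ≤ L)
    (hD : 0 ≤ D) (hg : 0 ≤ g) (hl : 0 ≤ l) (hln : l ≤ n) (hC : L ^ (1 / s) ≤ C)
    (h : C * D ^ (1 / s) / (1 + l) ≤ g) : L * D ≤ (g * (1 + n)) ^ s := by
  have hn : 0 ≤ n := hl.trans hln
  rw [← Real.rpow_inv_le_iff_of_pos (by positivity) (by positivity) hs, ← one_div,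
    Real.mul_rpow hL hD]
  rw [div_le_iff₀ (by positivity)] at h
  calc L ^ (1 / s) * D ^ (1 / s) ≤ C * D ^ (1 / s) := by gcongr
    _ ≤ g * (1 + l) := h
    _ ≤ g * (1 + n) := by gcongr

theorem exists_wegner_estimate (k : ℕ) (hk : 0 < k) {α q : ℝ} (hα : 0 < α) (hq : 0 < q)
    (CA1 CA2 CB1 CB2 CB3 : ℝ) :
    ∃ C : ℝ, 0 < C ∧ ∀ (d : ℕ) (M : ModelData d k), M.Admissible CB1 CB2 CB3 →
      ∀ (μ : Measure ℝ), IsRegularWith α CA1 μ → HasMomentBound q CA2 μ →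
      ∀ (Ω : Type*) [MeasurableSpace Ω] (P : Measure Ω) [IsProbabilityMeasure P]
        (v : Site d → Ω → ℝ), IsIID v P μ → ∀ (g : ℝ), 0 < g → ∀ ρ : Measure ℝ,
      IsDensityOfStates (fun ω => M.hamiltonian g (fun x => v x ω)) P ρ →
      ∀ lam : ℝ, C * (d : ℝ) ^ (1 / wegnerExponent α q k) / (1 + |lam|) ≤ g →
      ∀ ε : ℝ, 0 < ε → ρ.real (Set.Icc (lam - ε) (lam + ε)) ≤
        C * (1 + |lam|) ^ (-wegnerExponent α q k) * ε ^ wegnerExponent α q k := by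
  set s := wegnerExponent α q k
  have hs : 0 < s := wegnerExponent_pos hα hq hk
  rcases lt_or_ge 1 α with hα1 | hα1
  · refine ⟨1, one_pos, fun d M _ μ hreg hmom Ω _ P _ v hv => ?_⟩
    have := hv.isProbabilityMeasure
    exact absurd ((TameLaw.of_bounds hreg hmom).exponent_le_one (by positivity)) hα1.not_ge
  obtain ⟨K, hK, htrace⟩ := exists_averagedTrace_poisson_le (C₁ := max CA1 1) (C₂ := max CA2 1) k
    hα hq (by positivity) (by positivity) (le_max_right CB1 0) (le_max_right CB2 0)
    (le_max_right CB3 0) hs (wegnerExponent_le_one hα hα1 hq hk) (wegnerExponent_mul hα hq hk)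
  set L := 4 * K * max CB3 0 ^ s
  have hC : 0 < max (4 * K) (L ^ (1 / s)) := lt_max_of_lt_left (by positivity)
  refine ⟨max (4 * K) (L ^ (1 / s)), hC, ?_⟩
  intro d M hM μ hreg hmom Ω _ P _ v hv g hg ρ hρ lam hlam ε hε
  have := hv.isProbabilityMeasure
  have hM' := hM.mono (le_max_left CB1 0) (le_max_left CB2 0) (le_max_left CB3 0)
  obtain ⟨hfin, hint⟩ := (hv.isDensityOfStates_iff hM' ρ).1 hρ
  let z : ℂ := ⟨lam, ε⟩
  have hlz : |lam| ≤ ‖z‖ := Complex.abs_re_le_norm z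
  have hcoupling : 4 * K * d * max CB3 0 ^ s ≤ (g * (1 + ‖z‖)) ^ s := by
    rw [mul_right_comm]
    exact mul_le_mul_rpow_of_mul_rpow_div_le hs (by positivity) (by positivity) hg.le
      (abs_nonneg lam) hlz (le_max_right _ _) hlam
  have hpoisson := htrace d M hM' μ (TameLaw.of_bounds hreg hmom) g hg z hε.ne' hcoupling
  rw [← hint, show |z.im| = ε from abs_of_pos hε] at hpoisson
  calc ρ.real (Set.Icc (lam - ε) (lam + ε)) ≤ 2 * ε * ∫ t, poisson z t ∂ρ :=
        measureReal_Icc_le_integral_poisson ρ lam hε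
    _ ≤ 4 * K * (1 + ‖z‖) ^ (-s) * ε ^ s := by linarith
    _ ≤ max (4 * K) (L ^ (1 / s)) * (1 + |lam|) ^ (-s) * ε ^ s := by
        gcongr ?_ * ?_ * _
        · exact le_max_left _ _
        · exact Real.rpow_le_rpow_of_nonpos (by positivity) (by linarith) (by linarith)

theorem abs_ids_sub_le {ρ : Measure ℝ} [IsFiniteMeasure ρ] {lam c s : ℝ} (hs : 0 < s)
    (h : ∀ ε : ℝ, 0 < ε → ρ.real (Set.Icc (lam - ε) (lam + ε)) ≤ c * ε ^ s) (lam' : ℝ) :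
    |ids ρ lam' - ids ρ lam| ≤ c * |lam' - lam| ^ s := by
  rcases eq_or_ne lam' lam with rfl | hne
  · simp [Real.zero_rpow hs.ne']
  · exact (abs_measureReal_Iic_sub_le ρ lam lam').trans (h _ (abs_pos.2 (sub_ne_zero.2 hne)))

theorem isRegularWith_of_density {D : ℝ≥0} {f : ℝ → ℝ≥0∞} (hf : ∀ x, f x ≤ D) :
    IsRegularWith 1 (2 * D) ((volume : Measure ℝ).withDensity f) := by
  intro ε hε t
  refine ENNReal.toReal_le_of_le_ofReal (by positivity) ?_
  rw [withDensity_apply _ measurableSet_Icc, Real.rpow_one]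
  calc ∫⁻ x in Set.Icc (t - ε) (t + ε), f x
      ≤ ∫⁻ _ in Set.Icc (t - ε) (t + ε), (D : ℝ≥0∞) := lintegral_mono fun x => hf x
    _ = ENNReal.ofReal D * ENNReal.ofReal (t + ε - (t - ε)) := by
        rw [setLIntegral_const, Real.volume_Icc, ENNReal.ofReal_coe_nnreal]
    _ = ENNReal.ofReal (2 * D * ε) := by
        rw [← ENNReal.ofReal_mul D.coe_nonneg]
        ring_nf

theorem integrable_abs_rpow {μ : Measure ℝ} (h : ∀ n : ℕ, Integrable (fun x : ℝ => |x| ^ n) μ)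
    {q : ℝ} (hq : 0 ≤ q) : Integrable (fun x : ℝ => |x| ^ q) μ := by
  obtain ⟨n, hn⟩ := exists_nat_ge q
  refine ((h 0).add (h n)).mono' (by fun_prop) (ae_of_all _ fun x => ?_)
  have hx := abs_nonneg x
  rw [Real.norm_of_nonneg (by positivity)]
  change |x| ^ q ≤ |x| ^ 0 + |x| ^ n
  rw [pow_zero]
  rcases le_total |x| 1 with hx1 | hx1
  · linarith [Real.rpow_le_one hx hx1 hq, pow_nonneg hx n]
  · have hpow := Real.rpow_le_rpow_of_exponent_le hx1 hn
    rw [Real.rpow_natCast] at hpow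
    linarith

theorem exists_abs_ids_sub_le_of_forall_moment (k : ℕ) (hk : 0 < k) {δ : ℝ} (hδ : 0 < δ)
    (CB1 CB2 CB3 : ℝ) {μ : Measure ℝ} {CA1 : ℝ} (hreg : IsRegularWith 1 CA1 μ)
    (hmom : ∀ n : ℕ, Integrable (fun x : ℝ => |x| ^ n) μ) :
    ∃ C : ℝ, 0 < C ∧ ∀ (d : ℕ) (M : ModelData d k), M.Admissible CB1 CB2 CB3 →
      ∀ (Ω : Type*) [MeasurableSpace Ω] (P : Measure Ω) [IsProbabilityMeasure P]
        (v : Site d → Ω → ℝ), IsIID v P μ → ∀ (g : ℝ), 0 < g → ∀ ρ : Measure ℝ,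
      IsDensityOfStates (fun ω => M.hamiltonian g (fun x => v x ω)) P ρ →
      ∀ lam : ℝ, C * (d : ℝ) ^ ((k : ℝ) + δ) / (1 + |lam|) ≤ g → ∀ lam' : ℝ,
        |ids ρ lam' - ids ρ lam| ≤
          C * (1 + |lam|) ^ (-(1 / ((k : ℝ) + δ))) * |lam' - lam| ^ (1 / ((k : ℝ) + δ)) := by
  have hq : 0 < 2 * k / δ := by positivity
  have hmom' : HasMomentBound (2 * k / δ) (∫ x, |x| ^ (2 * k / δ) ∂μ) μ :=
    ⟨integrable_abs_rpow hmom hq.le, le_rfl⟩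
  obtain ⟨C, hC, hwegner⟩ := exists_wegner_estimate k hk one_pos hq CA1
    (∫ x, |x| ^ (2 * k / δ) ∂μ) CB1 CB2 CB3
  rw [wegnerExponent_one_eq hk hδ, one_div_one_div] at hwegner
  refine ⟨C, hC, fun d M hM Ω _ P _ v hv g hg ρ hρ lam hlam => ?_⟩
  have := hρ.finite
  exact abs_ids_sub_le (by positivity) (hwegner d M hM μ hreg hmom' Ω P v hv g hg ρ hρ lam hlam)

theorem mul_one_add_rpow_neg_le {C t s : ℝ} (hC : 0 ≤ C) (ht : 0 ≤ t) (hs : 0 ≤ s) :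
    C * (1 + t) ^ (-s) ≤ C :=
  mul_le_of_le_one_right hC
    (Real.rpow_le_one_of_one_le_of_nonpos (le_add_of_nonneg_right ht) (neg_nonpos.2 hs))

end Wegner

end

theorem corollary2 :
    -- the Wegner-type estimate, with `s = αq / (2kα + kq)`
    (∀ (k : ℕ), 0 < k → ∀ (α q : ℝ), 0 < α → 0 < q → ∀ (CA1 CA2 CB1 CB2 CB3 : ℝ),
      ∃ C : ℝ, 0 < C ∧
        ∀ (d : ℕ) (M : ModelData d k), M.Admissible CB1 CB2 CB3 →
        ∀ (μ : Measure ℝ), IsRegularWith α CA1 μ → HasMomentBound q CA2 μ →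
        ∀ (Ω : Type*) [MeasurableSpace Ω] (P : Measure Ω) [IsProbabilityMeasure P]
          (v : Site d → Ω → ℝ), IsIID v P μ →
        ∀ (g : ℝ), 0 < g →
          (∃! ρ : Measure ℝ,
            IsDensityOfStates (fun ω => M.hamiltonian g (fun x => v x ω)) P ρ) ∧
          ∀ ρ : Measure ℝ,
            IsDensityOfStates (fun ω => M.hamiltonian g (fun x => v x ω)) P ρ →
            ∀ lam : ℝ, C * (d : ℝ) ^ (1 / wegnerExponent α q k) / (1 + |lam|) ≤ g →
              (∀ ε : ℝ, 0 < ε →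
                ρ.real (Set.Icc (lam - ε) (lam + ε)) ≤
                  C * (1 + |lam|) ^ (-wegnerExponent α q k) * ε ^ wegnerExponent α q k) ∧
              ∀ lam' : ℝ,
                |ids ρ lam' - ids ρ lam| ≤
                  C * (1 + |lam|) ^ (-wegnerExponent α q k) *
                    |lam' - lam| ^ wegnerExponent α q k) ∧
    -- bounded densities with all moments: the exponent `1 / (k + δ)` for every `δ > 0`
    (∀ (k : ℕ), 0 < k → ∀ (δ : ℝ), 0 < δ → ∀ (CB1 CB2 CB3 : ℝ) (μ : Measure ℝ),
      (∃ (D : ℝ≥0) (f : ℝ → ℝ≥0∞), Measurable f ∧ (∀ x, f x ≤ D) ∧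
        μ = (volume : Measure ℝ).withDensity f) →
      (∀ n : ℕ, Integrable (fun x : ℝ => |x| ^ n) μ) →
      ∃ C : ℝ, 0 < C ∧
        ∀ (d : ℕ) (M : ModelData d k), M.Admissible CB1 CB2 CB3 →
        ∀ (Ω : Type*) [MeasurableSpace Ω] (P : Measure Ω) [IsProbabilityMeasure P]
          (v : Site d → Ω → ℝ), IsIID v P μ →
        ∀ (g : ℝ), 0 < g →
        ∀ ρ : Measure ℝ,
          IsDensityOfStates (fun ω => M.hamiltonian g (fun x => v x ω)) P ρ →
          (∀ lam : ℝ, C * (d : ℝ) ^ ((k : ℝ) + δ) / (1 + |lam|) ≤ g →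
            ∀ lam' : ℝ,
              |ids ρ lam' - ids ρ lam| ≤
                C * (1 + |lam|) ^ (-(1 / ((k : ℝ) + δ))) *
                  |lam' - lam| ^ (1 / ((k : ℝ) + δ))) ∧
          (C * (d : ℝ) ^ ((k : ℝ) + δ) ≤ g →
            ∀ lam lam' : ℝ,
              |ids ρ lam' - ids ρ lam| ≤ C * |lam' - lam| ^ (1 / ((k : ℝ) + δ)))) := by
  refine ⟨fun k hk α q hα hq CA1 CA2 CB1 CB2 CB3 => ?_, ?_⟩
  · obtain ⟨C, hC, hwegner⟩ := exists_wegner_estimate k hk hα hq CA1 CA2 CB1 CB2 CB3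
    refine ⟨C, hC, fun d M hM μ hreg hmom Ω _ P _ v hv g hg => ?_⟩
    have := hv.isProbabilityMeasure
    refine ⟨hv.existsUnique_densityOfStates hM, fun ρ hρ lam hlam => ?_⟩
    have := hρ.finite
    have hρ_Icc := hwegner d M hM μ hreg hmom Ω P v hv g hg ρ hρ lam hlam
    exact ⟨hρ_Icc, abs_ids_sub_le (wegnerExponent_pos hα hq hk) hρ_Icc⟩
  · rintro k hk δ hδ CB1 CB2 CB3 _ ⟨D, f, -, hfD, rfl⟩ hmom
    obtain ⟨C, hC, hids⟩ := exists_abs_ids_sub_le_of_forall_moment k hk hδ CB1 CB2 CB3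
      (isRegularWith_of_density hfD) hmom
    refine ⟨C, hC, fun d M hM Ω _ P _ v hv g hg ρ hρ => ?_⟩
    have hlocal := hids d M hM Ω P v hv g hg ρ hρ
    refine ⟨hlocal, fun hg' lam lam' => ?_⟩
    have hlam := (div_le_self (by positivity) (le_add_of_nonneg_right (abs_nonneg lam))).trans hg'
    refine (hlocal lam hlam lam').trans ?_
    gcongr
    exact mul_one_add_rpow_neg_le hC.le (abs_nonneg lam) (by positivity)
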